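/- **Theorem (Superlinear local convergence).** Consider the two-stage problem with one subproblem, whose undecomposed form is $$\min_{x\in\mathbb R^{n_0},\,y\in\mathbb R^{n_1}} f_0(x)+f_1(y;x)\quad\text{s.t.}\quad c_0(x)\le 0,\; c_1(y;x)\le 0 .\tag{U}$$ Here $c_0$ and $c_1$ take values in $\mathbb R^{m_0}$ and $\mathbb R^{m_1}$, and all norms are Euclidean. For $z=(x,y,\tilde x,s_1)$ and multipliers $\lambda_0,\lambda_1,\eta$ put $$\varphi(z;\mu)=f_0(x)+f_1(y;\tilde x)-\mu\sum_j\ln s_{1j},$$ $$\mathcal L=f_0(x)+f_1(y;\tilde x)+c_0(x)^T\lambda_0+(c_1(y;\tilde x)+s_1)^T\lambda_1+(\tilde x-x)^T\eta .$$ Let $w=(u,v)$ with $u=(x,\lambda_0,s_0)$ and $v=(y,\tilde x,s_1,\lambda_1,\eta)$. Define $$F_1(w;\mu)=\big(\nabla_y\mathcal L,\ \nabla_{\tilde x}\mathcal L,\ s_1\circ\lambda_1-\mu e,\ c_1(y;\tilde x)+s_1,\ \tilde x-x\big),$$ $$F_0(w)=\big(\nabla_x\mathcal L,\ c_0(x)+s_0,\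 \max\{\min\{s_0,\lambda_0\},-s_0,-\lambda_0\}\big),$$ and $\theta_0(w)=\|F_0(w)\|$, $\theta(w;\mu)=\|(F_0(w),F_1(w;\mu))\|$. *Algorithm.* The constants are $c_{\mu,1}\in(0,1)$, $c_{\mu,2}\in(1,2)$, $c_{\rm tol}>0$, $\tau^{\max}>0$, and $\mu^0>0$. 1. *Master solve.* For the current $\mu^l$, find $w^l$ with $s_1^l,\lambda_1^l>0$, $F_1(w^l;\mu^l)=0$ (so that the subproblem part of $w^l$ is a KKT point of the barrier subproblem at $x^l$) and $\theta_0(w^l)\le c_{\rm tol}\,\mu^l$. 2. *While* $\theta(w^l;\mu^l)\le c_{\rm tol}\,\mu^l$: set $\mu^{l+1}=\min\{c_{\mu,1}\mu^l,(\mu^l)^{c_{\mu,2}}\}$ and $\tau^l=1-\min\{\tau^{\max},\mu^{l+1}\}$. Compute a local solution $\Delta z$, with multipliers $\lambda_0^+$ (for the inequalities) and $(\lambda_1^+,\eta^+)$ (for the equalities), of $$\begin{aligned}\min_{\Delta z}\ &\nabla\varphi(z^l;\mu^{l+1})^T\Delta z+\tfrac12\Delta z^T\nabla^2_{zz}\mathcal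 L(w^l)\Delta z+\tfrac12\textstyle\sum_j\frac{\lambda^l_{1j}}{s^l_{1j}}\Delta s_{1j}^2\\ \text{s.t. }&\nabla c_0(x^l)^T\Delta x+c_0(x^l)\le0,\\ &\nabla_y c_1^T\Delta y+\nabla_{\tilde x} c_1^T\Delta\tilde x+\Delta s_1+c_1(y^l;\tilde x^l)+s_1^l=0,\\ &\Delta\tilde x-\Delta x+\tilde x^l-x^l=0.\end{aligned}$$ Set $s_0^+=-(c_0(x^l)+\nabla c_0(x^l)^T\Delta x)$. Let $\Delta w^l$ consist of $\Delta z$ and the differences $\lambda_0^+-\lambda_0^l$, $s_0^+-s_0^l$, $\lambda_1^+-\lambda_1^l$, $\eta^+-\eta^l$. Put $w^{l+1}=w^l+\alpha^l\Delta w^l$, where $\alpha^l$ is the largest $\alpha\in(0,1]$ with $s_1^l+\alpha\Delta s_1^l\ge(1-\tau^l)s_1^l$ and $\lambda_1^l+\alpha\Delta\lambda_1^l\ge(1-\tau^l)\lambda_1^l$. 3. If the loop condition fails, return to 1 with the current $\mu^l$. *Assumptions.* Let $(x^*,y^*)$ be a local minimizer of (U) which, with multipliers $\lambda_0^*,\lambda_1^*$,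 satisfies the second-order sufficient conditions (the KKT conditions together with $d^T\nabla^2L\,d>0$ for all nonzero $d$ in the critical cone, $L$ being the Lagrangian of (U)), strict complementarity and LICQ. Let $f_0,c_0$ (near $x^*$) and $f_1,c_1$ (near $(y^*,x^*)$) be $C^2$ with locally Lipschitz continuous second derivatives. Let $w^*$ be the corresponding primal-dual point, i.e. $\tilde x^*=x^*$, $s_0^*=-c_0(x^*)$, $s_1^*=-c_1(y^*;x^*)$ and $\eta^*=-\nabla_x\big(f_1+c_1^T\lambda_1^*\big)(y^*;x^*)$. *Claim.* There is $\rho>0$, depending only on the problem and on $w^*$, such that for all constants of the algorithm there are $\varepsilon,\bar\mu>0$ with the following property. Suppose that the solver of the quadratic program returns a local solution with $\|\Delta z\|\le\rho$, and that the algorithm encounters in step 1 an iterate $w^{l_0}$ with $\|w^{l_0}-w^*\|\le\varepsilon$ and $\mu^{l_0}\le\bar\mu$. Then for every $l\ge l_0$ the loop condition $\theta(w^l;\mu^l)\le c_{\rm tol}\,\mu^l$ holds and such a local solution of the quadratic program exists, so the algorithm remains in the while-loop. Moreover $w^l\to w^*$ at a Q-superlinear rate, that is, $\|w^{l+1}-w^*\|=o(\|w^l-w^*\|)$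 as $l\to\infty$. -/

import Mathlib

open Filter Topology Asymptotics
open scoped InnerProductSpace

noncomputable section

/-- `ℝⁿ` with the Euclidean norm. -/
abbrev Vec (n : ℕ) := EuclideanSpace ℝ (Fin n)

/-- Primal variables `z = (x, y, x̃, s)` of the barrier problem (one subproblem). -/
abbrev Primal (n₀ n₁ m₁ : ℕ) := Vec n₀ × Vec n₁ × Vec n₀ × Vec m₁

/-- Data of the two-stage problem with one subproblem:
`min f₀(x) + f₁(y; x)` subject to `c₀(x) ≤ 0` and `c₁(y; x) ≤ 0`.
The subproblem functions take the pair `(y, x)`. -/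
structure TwoStage (n₀ n₁ m₀ m₁ : ℕ) where
  f₀ : Vec n₀ → ℝ
  c₀ : Vec n₀ → Vec m₀
  f₁ : Vec n₁ × Vec n₀ → ℝ
  c₁ : Vec n₁ × Vec n₀ → Vec m₁

/-- A primal-dual point `w = (u, v)` with master part `u = (x, lam₀, s₀)` and subproblem part
`v = (y, x̃, s₁, lam₁, eta)`.  Here `s₀` is the slack of `c₀(x) ≤ 0`, and `eta` is the multiplier
of `x̃ - x = 0`. -/
structure PDPoint (n₀ n₁ m₀ m₁ : ℕ) where
  x : Vec n₀
  lam₀ : Vec m₀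
  s₀ : Vec m₀
  y : Vec n₁
  xt : Vec n₀
  s₁ : Vec m₁
  lam₁ : Vec m₁
  eta : Vec n₀

/-- The constants of the algorithm: `c_{μ,1}`, `c_{μ,2}`, `c₀` and `τ^max`. -/
structure AlgConsts where
  cmu₁ : ℝ
  cmu₂ : ℝ
  ctol : ℝ
  tauMax : ℝ

/-- The ranges required of the constants of the algorithm. -/
structure AlgConsts.Valid (k : AlgConsts) : Prop where
  cmu₁_pos : 0 < k.cmu₁
  cmu₁_lt : k.cmu₁ < 1
  cmu₂_gt : 1 < k.cmu₂
  cmu₂_lt : k.cmu₂ < 2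
  ctol_pos : 0 < k.ctol
  tauMax_pos : 0 < k.tauMax

/-- The next smoothing parameter `min {c_{μ,1} μ, μ ^ c_{μ,2}}`. -/
def AlgConsts.nextMu (k : AlgConsts) (μ : ℝ) : ℝ := min (k.cmu₁ * μ) (μ ^ k.cmu₂)

/-- The fraction-to-the-boundary parameter belonging to the new smoothing parameter `μ'`; it tends
to one as `μ'` tends to zero. -/
def AlgConsts.tau (k : AlgConsts) (μ' : ℝ) : ℝ := 1 - min k.tauMax μ'

/-- `f` is `C²` near `p`, with second derivative Lipschitz on a neighbourhood of `p`. -/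
def C2LipAt {V W : Type*} [NormedAddCommGroup V] [NormedSpace ℝ V]
    [NormedAddCommGroup W] [NormedSpace ℝ W] (f : V → W) (p : V) : Prop :=
  ContDiffAt ℝ 2 f p ∧
    ∃ K : NNReal, ∃ U ∈ 𝓝 p, LipschitzOnWith K (fderiv ℝ (fderiv ℝ f)) U

namespace PDPoint

variable {n₀ n₁ m₀ m₁ : ℕ}

/-- The primal part `z = (x, y, x̃, s₁)`. -/
def z (w : PDPoint n₀ n₁ m₀ m₁) : Primal n₀ n₁ m₁ := (w.x, w.y, w.xt, w.s₁)

/-- Euclidean distance of primal-dual points. -/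
def edist (w w' : PDPoint n₀ n₁ m₀ m₁) : ℝ :=
  √(‖w.x - w'.x‖ ^ 2 + ‖w.lam₀ - w'.lam₀‖ ^ 2 + ‖w.s₀ - w'.s₀‖ ^ 2 + ‖w.y - w'.y‖ ^ 2
    + ‖w.xt - w'.xt‖ ^ 2 + ‖w.s₁ - w'.s₁‖ ^ 2 + ‖w.lam₁ - w'.lam₁‖ ^ 2 + ‖w.eta - w'.eta‖ ^ 2)

/-- The point `w + α Δ`. -/
def move (w : PDPoint n₀ n₁ m₀ m₁) (α : ℝ) (Δ : PDPoint n₀ n₁ m₀ m₁) : PDPoint n₀ n₁ m₀ m₁ where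
  x := w.x + α • Δ.x
  lam₀ := w.lam₀ + α • Δ.lam₀
  s₀ := w.s₀ + α • Δ.s₀
  y := w.y + α • Δ.y
  xt := w.xt + α • Δ.xt
  s₁ := w.s₁ + α • Δ.s₁
  lam₁ := w.lam₁ + α • Δ.lam₁
  eta := w.eta + α • Δ.eta

/-- The step sizes in `(0, 1]` admitted by the fraction-to-the-boundary rule with parameter `τ`. -/
def ftbSet (w Δ : PDPoint n₀ n₁ m₀ m₁) (τ : ℝ) : Set ℝ :=
  {α | 0 < α ∧ α ≤ 1 ∧
    (∀ j, (1 - τ) * w.s₁ j ≤ w.s₁ j + α * Δ.s₁ j) ∧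
    (∀ j, (1 - τ) * w.lam₁ j ≤ w.lam₁ j + α * Δ.lam₁ j)}

end PDPoint

namespace TwoStage

variable {n₀ n₁ m₀ m₁ : ℕ} (P : TwoStage n₀ n₁ m₀ m₁)

/-! ### The undecomposed problem, in the variables `(x, y)` -/

/-- Objective of the undecomposed problem. -/
def objective (p : Vec n₀ × Vec n₁) : ℝ := P.f₀ p.1 + P.f₁ (p.2, p.1)

/-- Feasible set of the undecomposed problem. -/
def feasibleSet : Set (Vec n₀ × Vec n₁) :=
  {p | (∀ i, P.c₀ p.1 i ≤ 0) ∧ (∀ j, P.c₁ (p.2, p.1) j ≤ 0)}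

/-- Lagrangian of the undecomposed problem. -/
def undecompLag (l₀ : Vec m₀) (l₁ : Vec m₁) (p : Vec n₀ × Vec n₁) : ℝ :=
  P.objective p + ⟪P.c₀ p.1, l₀⟫_ℝ + ⟪P.c₁ (p.2, p.1), l₁⟫_ℝ

/-- Derivative at `p = (x, y)` of the `i`-th master constraint, as a function of `(x, y)`. -/
def dcon₀ (p : Vec n₀ × Vec n₁) (i : Fin m₀) : Vec n₀ × Vec n₁ →L[ℝ] ℝ :=
  fderiv ℝ (fun q : Vec n₀ × Vec n₁ => P.c₀ q.1 i) p

/-- Derivative at `p = (x, y)` of the `j`-th subproblem constraint, as a function of `(x, y)`. -/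
def dcon₁ (p : Vec n₀ × Vec n₁) (j : Fin m₁) : Vec n₀ × Vec n₁ →L[ℝ] ℝ :=
  fderiv ℝ (fun q : Vec n₀ × Vec n₁ => P.c₁ (q.2, q.1) j) p

/-- The critical cone of the undecomposed problem at `p` with multipliers `l₀`, `l₁`. -/
def criticalCone (p : Vec n₀ × Vec n₁) (l₀ : Vec m₀) (l₁ : Vec m₁) : Set (Vec n₀ × Vec n₁) :=
  {d | (∀ i, P.c₀ p.1 i = 0 → P.dcon₀ p i d ≤ 0) ∧
       (∀ i, P.c₀ p.1 i = 0 → 0 < l₀ i → P.dcon₀ p i d = 0) ∧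
       (∀ j, P.c₁ (p.2, p.1) j = 0 → P.dcon₁ p j d ≤ 0) ∧
       (∀ j, P.c₁ (p.2, p.1) j = 0 → 0 < l₁ j → P.dcon₁ p j d = 0)}

/-- `p = (x, y)` with multipliers `l₀`, `l₁` satisfies the KKT conditions of the undecomposed
problem. -/
structure IsKKT (p : Vec n₀ × Vec n₁) (l₀ : Vec m₀) (l₁ : Vec m₁) : Prop where
  feasible : p ∈ P.feasibleSet
  stationary : fderiv ℝ (P.undecompLag l₀ l₁) p = 0
  nonneg₀ : ∀ i, 0 ≤ l₀ i
  nonneg₁ : ∀ j, 0 ≤ l₁ j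
  compl₀ : ∀ i, l₀ i * P.c₀ p.1 i = 0
  compl₁ : ∀ j, l₁ j * P.c₁ (p.2, p.1) j = 0

/-- Linear independence constraint qualification for the undecomposed problem. -/
def LICQ (p : Vec n₀ × Vec n₁) : Prop :=
  LinearIndependent ℝ
    (Sum.elim (fun i : {i : Fin m₀ // P.c₀ p.1 i = 0} => P.dcon₀ p i)
      (fun j : {j : Fin m₁ // P.c₁ (p.2, p.1) j = 0} => P.dcon₁ p j))

/-- Strict complementarity for the undecomposed problem. -/
def StrictCompl (p : Vec n₀ × Vec n₁) (l₀ : Vec m₀) (l₁ : Vec m₁) : Prop :=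
  (∀ i, P.c₀ p.1 i = 0 → 0 < l₀ i) ∧ (∀ j, P.c₁ (p.2, p.1) j = 0 → 0 < l₁ j)

/-- Positive curvature of the Lagrangian on the critical cone. -/
def SecondOrder (p : Vec n₀ × Vec n₁) (l₀ : Vec m₀) (l₁ : Vec m₁) : Prop :=
  ∀ d ∈ P.criticalCone p l₀ l₁, d ≠ 0 →
    0 < fderiv ℝ (fderiv ℝ (P.undecompLag l₀ l₁)) p d d

/-- A local minimizer `(x, y)` of the undecomposed problem, with multipliers, at which the
second-order sufficient conditions, strict complementarity and LICQ hold and the problem data are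
`C²` with locally Lipschitz second derivatives. -/
structure IsRegularSolution (x : Vec n₀) (y : Vec n₁) (l₀ : Vec m₀) (l₁ : Vec m₁) : Prop where
  localMin : IsLocalMinOn P.objective P.feasibleSet (x, y)
  kkt : P.IsKKT (x, y) l₀ l₁
  secondOrder : P.SecondOrder (x, y) l₀ l₁
  strictCompl : P.StrictCompl (x, y) l₀ l₁
  licq : P.LICQ (x, y)
  smooth_f₀ : C2LipAt P.f₀ x
  smooth_c₀ : C2LipAt P.c₀ x
  smooth_f₁ : C2LipAt P.f₁ (y, x)
  smooth_c₁ : C2LipAt P.c₁ (y, x)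

/-- The primal-dual point belonging to `(x, y)` and its multipliers: `x̃ = x`, the slacks are
`s₀ = -c₀(x)` and `s₁ = -c₁(y; x)`, and `eta = -∇ₓ (f₁(y; x) + c₁(y; x)ᵀ l₁)`. -/
def primalDual (x : Vec n₀) (y : Vec n₁) (l₀ : Vec m₀) (l₁ : Vec m₁) : PDPoint n₀ n₁ m₀ m₁ where
  x := x
  lam₀ := l₀
  s₀ := -P.c₀ x
  y := y
  xt := x
  s₁ := -P.c₁ (y, x)
  lam₁ := l₁
  eta := -gradient (fun x' => P.f₁ (y, x') + ⟪P.c₁ (y, x'), l₁⟫_ℝ) x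

/-! ### The barrier problem and its optimality measures -/

/-- Lagrangian of the subproblem,
`f₁(y; x̃) + (c₁(y; x̃) + s₁)ᵀ lam₁ + (x̃ - x)ᵀ eta`. -/
def subLag (z : Primal n₀ n₁ m₁) (l₁ : Vec m₁) (eta : Vec n₀) : ℝ :=
  P.f₁ (z.2.1, z.2.2.1) + ⟪P.c₁ (z.2.1, z.2.2.1) + z.2.2.2, l₁⟫_ℝ + ⟪z.2.2.1 - z.1, eta⟫_ℝ

/-- Lagrangian of the undecomposed problem written in the variables `z = (x, y, x̃, s₁)`. -/
def lag (z : Primal n₀ n₁ m₁) (l₀ : Vec m₀) (l₁ : Vec m₁) (eta : Vec n₀) : ℝ :=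
  P.f₀ z.1 + ⟪P.c₀ z.1, l₀⟫_ℝ + P.subLag z l₁ eta

/-- Barrier objective `f₀(x) + f₁(y; x̃) - μ ∑ⱼ ln s₁ⱼ`. -/
def barrier (μ : ℝ) (z : Primal n₀ n₁ m₁) : ℝ :=
  P.f₀ z.1 + P.f₁ (z.2.1, z.2.2.1) - μ * ∑ j, Real.log (z.2.2.2 j)

/-- `∇ₓ` of the Lagrangian, i.e. `∇f₀(x) + ∇c₀(x) lam₀ - eta`. -/
def gradX (w : PDPoint n₀ n₁ m₀ m₁) : Vec n₀ :=
  gradient (fun x => P.lag (x, w.y, w.xt, w.s₁) w.lam₀ w.lam₁ w.eta) w.x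

/-- `∇_y` of the subproblem Lagrangian. -/
def gradY (w : PDPoint n₀ n₁ m₀ m₁) : Vec n₁ :=
  gradient (fun y => P.subLag (w.x, y, w.xt, w.s₁) w.lam₁ w.eta) w.y

/-- `∇_x̃` of the subproblem Lagrangian. -/
def gradXt (w : PDPoint n₀ n₁ m₀ m₁) : Vec n₀ :=
  gradient (fun xt => P.subLag (w.x, w.y, xt, w.s₁) w.lam₁ w.eta) w.xt

/-- The vector `F₁(w; μ)` vanishes: `v` is a stationary point of the barrier subproblem. -/
structure SubStationary (w : PDPoint n₀ n₁ m₀ m₁) (μ : ℝ) : Prop where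
  y_eq : P.gradY w = 0
  xt_eq : P.gradXt w = 0
  compl : ∀ j, w.s₁ j * w.lam₁ j - μ = 0
  con : P.c₁ (w.y, w.xt) + w.s₁ = 0
  copy : w.xt - w.x = 0

/-- Squared Euclidean norm of the master block of the optimality system: stationarity in `x`,
`c₀(x) + s₀`, and `max {min {s₀, lam₀}, -s₀, -lam₀}`. -/
def masterSq (w : PDPoint n₀ n₁ m₀ m₁) : ℝ :=
  ‖P.gradX w‖ ^ 2 + ‖P.c₀ w.x + w.s₀‖ ^ 2
    + ∑ i, (max (min (w.s₀ i) (w.lam₀ i)) (max (-w.s₀ i) (-w.lam₀ i))) ^ 2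

/-- Squared Euclidean norm of the subproblem block `F₁(w; μ)`. -/
def subSq (w : PDPoint n₀ n₁ m₀ m₁) (μ : ℝ) : ℝ :=
  ‖P.gradY w‖ ^ 2 + ‖P.gradXt w‖ ^ 2 + ∑ j, (w.s₁ j * w.lam₁ j - μ) ^ 2
    + ‖P.c₁ (w.y, w.xt) + w.s₁‖ ^ 2 + ‖w.xt - w.x‖ ^ 2

/-- The master optimality measure `θ₀`, in which the gradient of the smoothed value function is
`-eta`. -/
def theta₀ (w : PDPoint n₀ n₁ m₀ m₁) : ℝ := √(P.masterSq w)

/-- The optimality measure `θ(w; μ)`, the Euclidean norm of the whole optimality system. -/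
def theta (w : PDPoint n₀ n₁ m₀ m₁) (μ : ℝ) : ℝ := √(P.masterSq w + P.subSq w μ)

/-! ### The extrapolation step -/

/-- Linearization of `c₀` at `w` in the direction `d`. -/
def lin₀ (w : PDPoint n₀ n₁ m₀ m₁) (d : Primal n₀ n₁ m₁) : Vec m₀ :=
  P.c₀ w.x + fderiv ℝ P.c₀ w.x d.1

/-- Objective of the quadratic program solved at `w` for the smoothing parameter `μ`. -/
def qpObjective (w : PDPoint n₀ n₁ m₀ m₁) (μ : ℝ) (d : Primal n₀ n₁ m₁) : ℝ :=
  fderiv ℝ (P.barrier μ) w.z d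
    + 1 / 2 * fderiv ℝ (fderiv ℝ (fun z => P.lag z w.lam₀ w.lam₁ w.eta)) w.z d d
    + 1 / 2 * ∑ j, w.lam₁ j / w.s₁ j * d.2.2.2 j ^ 2

/-- Feasible set of the quadratic program. -/
def qpFeasible (w : PDPoint n₀ n₁ m₀ m₁) : Set (Primal n₀ n₁ m₁) :=
  {d | (∀ i, P.lin₀ w d i ≤ 0) ∧
       fderiv ℝ P.c₁ (w.y, w.xt) (d.2.1, d.2.2.1) + d.2.2.2 + (P.c₁ (w.y, w.xt) + w.s₁) = 0 ∧
       d.2.2.1 - d.1 + (w.xt - w.x) = 0}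

/-- `d` is a local minimizer of the quadratic program at `w`, and `l₀`, `l₁`, `eta` are
Lagrange multipliers for its inequality constraints and its two groups of equality constraints. -/
structure IsQPSolution (w : PDPoint n₀ n₁ m₀ m₁) (μ : ℝ) (d : Primal n₀ n₁ m₁)
    (l₀ : Vec m₀) (l₁ : Vec m₁) (eta : Vec n₀) : Prop where
  feasible : d ∈ P.qpFeasible w
  localMin : IsLocalMinOn (P.qpObjective w μ) (P.qpFeasible w) d
  nonneg : ∀ i, 0 ≤ l₀ i
  compl : ∀ i, l₀ i * P.lin₀ w d i = 0
  stationary : ∀ h : Primal n₀ n₁ m₁,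
    fderiv ℝ (P.barrier μ) w.z h
      + fderiv ℝ (fderiv ℝ (fun z => P.lag z w.lam₀ w.lam₁ w.eta)) w.z d h
      + ∑ j, w.lam₁ j / w.s₁ j * d.2.2.2 j * h.2.2.2 j
      + ⟪l₀, fderiv ℝ P.c₀ w.x h.1⟫_ℝ
      + ⟪l₁, fderiv ℝ P.c₁ (w.y, w.xt) (h.2.1, h.2.2.1) + h.2.2.2⟫_ℝ
      + ⟪eta, h.2.2.1 - h.1⟫_ℝ = 0

/-- The primal-dual step `Δw` made of the primal step `d` and the new multipliers; the new master
slack `s₀` is the slack of the linearized constraint. -/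
def stepOf (w : PDPoint n₀ n₁ m₀ m₁) (d : Primal n₀ n₁ m₁)
    (l₀ : Vec m₀) (l₁ : Vec m₁) (eta : Vec n₀) : PDPoint n₀ n₁ m₀ m₁ where
  x := d.1
  lam₀ := l₀ - w.lam₀
  s₀ := -P.lin₀ w d - w.s₀
  y := d.2.1
  xt := d.2.2.1
  s₁ := d.2.2.2
  lam₁ := l₁ - w.lam₁
  eta := eta - w.eta

/-! ### The algorithm -/

/-- Condition of the while-loop. -/
def LoopCond (k : AlgConsts) (w : PDPoint n₀ n₁ m₀ m₁) (μ : ℝ) : Prop :=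
  P.theta w μ ≤ k.ctol * μ

/-- One pass through the body of the while-loop, from `(w, μ)` to `(w', μ')`.  The quadratic
program may be nonconvex; the solver returns a local solution of size at most `ρ`. -/
def LoopPass (k : AlgConsts) (ρ : ℝ) (w : PDPoint n₀ n₁ m₀ m₁) (μ : ℝ)
    (w' : PDPoint n₀ n₁ m₀ m₁) (μ' : ℝ) : Prop :=
  μ' = k.nextMu μ ∧
  ∃ (d : Primal n₀ n₁ m₁) (l₀ : Vec m₀) (l₁ : Vec m₁) (eta : Vec n₀) (α : ℝ),
    P.IsQPSolution w μ' d l₀ l₁ eta ∧ ‖d‖ ≤ ρ ∧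
    IsGreatest (w.ftbSet (P.stepOf w d l₀ l₁ eta) (k.tau μ')) α ∧
    w' = w.move α (P.stepOf w d l₀ l₁ eta)

/-- `w` may be the result of the master solve with smoothing parameter `μ`: the master measure is
at most `c₀ μ`, and the subproblem part is a KKT point of the barrier subproblem at `x`. -/
structure IsMasterIterate (k : AlgConsts) (w : PDPoint n₀ n₁ m₀ m₁) (μ : ℝ) : Prop where
  theta₀_le : P.theta₀ w ≤ k.ctol * μ
  s₁_pos : ∀ j, 0 < w.s₁ j
  lam₁_pos : ∀ j, 0 < w.lam₁ j
  sub : P.SubStationary w μ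

/-- One transition of the algorithm: a pass through the while-loop if its condition holds, and
otherwise a new master solve with the same smoothing parameter. -/
def Transition (k : AlgConsts) (ρ : ℝ) (w : PDPoint n₀ n₁ m₀ m₁) (μ : ℝ)
    (w' : PDPoint n₀ n₁ m₀ m₁) (μ' : ℝ) : Prop :=
  (P.LoopCond k w μ → P.LoopPass k ρ w μ w' μ') ∧
  (¬ P.LoopCond k w μ → μ' = μ ∧ P.IsMasterIterate k w' μ')

/-- The first `N` transitions (all of them if `N = ⊤`) of the sequence `(w t, μ t)` form a run of
the algorithm, started with a master solve. -/
structure IsRun (k : AlgConsts) (ρ : ℝ) (N : ℕ∞)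
    (w : ℕ → PDPoint n₀ n₁ m₀ m₁) (μ : ℕ → ℝ) : Prop where
  mu_pos : 0 < μ 0
  start : P.IsMasterIterate k (w 0) (μ 0)
  trans : ∀ t : ℕ, (t : ℕ∞) < N → P.Transition k ρ (w t) (μ t) (w (t + 1)) (μ (t + 1))

end TwoStage

end

/-! Near the solution the algorithm is Newton's method for a smooth square system. Strict
complementarity fixes the active set `I` of the master constraints, and the max-min function in θ₀
then reduces to `s₀ i` for `i ∈ I` and `lam₀ i` otherwise. The whole optimality system becomes F(w)
= μe, where F is `residual` and μe is `muRes`, and F has a locally Lipschitz derivative. SOSC,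
strict complementarity and LICQ make F' injective at w*
(`IsRegularSolution.eq_zero_of_linResidual`). Dimensions agree, so
`HasLipDeriv.exists_newton_bounds` yields uniformly bounded inverses, ‖F(w)‖ comparable with E = ‖w
- w*‖, and quadratic Taylor remainders.

The quadratic program must be matched with the Newton equation F'(w)Δ = μ'e - F(w). A QP solution
with ‖Δz‖ ≤ ρ leaves the inactive constraints slack, so their multipliers vanish. The step is then
so short that the multipliers of the active constraints stay positive, and those constraints hold
with equality (`LocalBounds.exists_qp_radius`). Only the local geometry enters, hence ρ does not
depend on the constants of the algorithm. Conversely, the Newton step is a local solution of the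
possibly nonconvex QP: SOSC makes the Hessian plus a penalty on the active gradients nonnegative
(`IsRegularSolution.exists_penalty`). The terms λ₁/s₁ pay for the subproblem part of the penalty,
and the positive multipliers on feasible directions pay for the master part (`IsC2At.isQPSolution`).

The loop condition gives E = O(μ) and ‖Δ‖ = O(μ). The linearized complementarity equation then
admits the full step (`full_step_of_complementarity`). The new residual is O(μ²), which is below
`ctol` times μ' because `cmu₂ < 2`, so the loop continues. Its products s₁λ₁ are at least μ'/2. This
lower bound gives μ = O(E) whenever there are subproblem constraints, and without them μ does not
enter the equations. Therefore E' = O(E² + μ') = O((E + μ^(cmu₂ - 1)) E), with the μ' term absent in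
the second case, and `cmu₂ > 1` makes the rate superlinear. One pass is analysed in
`LocalBounds.exists_loop_bounds`. -/

noncomputable section

set_option linter.unusedSectionVars false

/-! ### Lipschitz derivatives and the local theory of Newton's method. -/

section Calculus

variable {V W X Y Z : Type*} [NormedAddCommGroup V] [NormedSpace ℝ V]
  [NormedAddCommGroup W] [NormedSpace ℝ W] [NormedAddCommGroup X] [NormedSpace ℝ X]
  [NormedAddCommGroup Y] [NormedSpace ℝ Y] [NormedAddCommGroup Z] [NormedSpace ℝ Z]

/-- `g` is Lipschitz on a neighbourhood of `p`. -/
def LipNear (g : V → W) (p : V) : Prop :=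
  (fun q : V × V => g q.1 - g q.2) =O[𝓝 (p, p)] fun q => q.1 - q.2

namespace LipNear

variable {p : V}

theorem continuousAt {g : V → W} (h : LipNear g p) : ContinuousAt g p := by
  have ht : Tendsto (fun a : V => (a, p)) (𝓝 p) (𝓝 (p, p)) := by
    exact (Continuous.prodMk_left p).tendsto p
  have h1 := IsBigO.comp_tendsto h ht
  have h2 : Tendsto (fun a : V => a - p) (𝓝 p) (𝓝 0) := by
    simpa using Continuous.tendsto (f := fun a : V => a - p) (by fun_prop) p
  have h3 := IsBigO.trans_tendsto h1 h2
  have h4 : Tendsto (fun a => (g a - g p) + g p) (𝓝 p) (𝓝 (0 + g p)) :=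
    h3.add tendsto_const_nhds
  simpa [ContinuousAt] using h4

theorem const (c : W) : LipNear (fun _ : V => c) p := by
  simpa [LipNear] using isBigO_zero _ _

theorem of_hasStrictFDerivAt {g : V → W} {g' : V →L[ℝ] W} (h : HasStrictFDerivAt g g' p) :
    LipNear g p :=
  h.isBigO_sub

theorem add {f g : V → W} (hf : LipNear f p) (hg : LipNear g p) :
    LipNear (fun q => f q + g q) p := by
  refine (IsBigO.add hf hg).congr_left fun q => ?_
  exact (add_sub_add_comm _ _ _ _).symm

theorem clm_comp {f : V → W} (L : W →L[ℝ] X) (hf : LipNear f p) : LipNear (fun q => L (f q)) p := by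
  have := (L.isBigO_comp (fun q : V × V => f q.1 - f q.2) (𝓝 (p, p))).trans hf
  simpa [LipNear] using this

theorem comp_clm {f : W → X} (L : V →L[ℝ] W) (hf : LipNear f (L p)) :
    LipNear (fun q => f (L q)) p := by
  have ht : Tendsto (fun q : V × V => (L q.1, L q.2)) (𝓝 (p, p)) (𝓝 (L p, L p)) :=
    Continuous.tendsto (f := fun q : V × V => (L q.1, L q.2)) (by fun_prop) (p, p)
  refine (IsBigO.comp_tendsto hf ht).trans ?_
  have := L.isBigO_comp (fun q : V × V => q.1 - q.2) (𝓝 (p, p))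
  simpa [Function.comp_def] using this

/-- The difference splits as B(f₁ - f₂, g₁) + B(f₂, g₁ - g₂), and the undifferenced factors stay
bounded near `p`. -/
theorem bilin (B : W →L[ℝ] X →L[ℝ] Y) {f : V → W} {g : V → X} (hf : LipNear f p)
    (hg : LipNear g p) : LipNear (fun q => B (f q) (g q)) p := by
  have hb : ∀ (a : V × V → W) (b : V × V → X),
      (fun q => B (a q) (b q)) =O[𝓝 (p, p)] fun q => ‖a q‖ * ‖b q‖ := fun a b =>
    IsBigO.of_bound ‖B‖ (Eventually.of_forall fun q => by
      rw [norm_mul, norm_norm, norm_norm, ← mul_assoc]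
      exact B.le_opNorm₂ _ _)
  have hg1 : (fun q : V × V => g q.1) =O[𝓝 (p, p)] fun _ => (1 : ℝ) :=
    (hg.continuousAt.tendsto.comp (continuous_fst.tendsto (p, p))).isBigO_one ℝ
  have hf2 : (fun q : V × V => f q.2) =O[𝓝 (p, p)] fun _ => (1 : ℝ) :=
    (hf.continuousAt.tendsto.comp (continuous_snd.tendsto (p, p))).isBigO_one ℝ
  have h1 := (hb (fun q => f q.1 - f q.2) fun q => g q.1).trans
    ((IsBigO.norm_norm hf).mul hg1.norm_left)
  have h2 := (hb (fun q => f q.2) fun q => g q.1 - g q.2).trans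
    (hf2.norm_left.mul (IsBigO.norm_norm hg))
  simp only [mul_one, one_mul] at h1 h2
  refine ((h1.add h2).of_norm_right).congr_left fun q => ?_
  simp only [map_sub, sub_apply]
  abel

theorem exists_ball {g : V → W} (h : LipNear g p) :
    ∃ K : ℝ, 0 < K ∧ ∃ r : ℝ, 0 < r ∧ ∀ a ∈ Metric.ball p r, ∀ b ∈ Metric.ball p r,
      ‖g a - g b‖ ≤ K * ‖a - b‖ := by
  obtain ⟨K, hK, hb⟩ := IsBigO.exists_pos h
  rw [isBigOWith_iff, nhds_prod_eq] at hb
  obtain ⟨r, hr, hs⟩ := (Metric.nhds_basis_ball.prod_self).mem_iff.1 hb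
  exact ⟨K, hK, r, hr, fun a ha b hb => hs (Set.mk_mem_prod ha hb)⟩

end LipNear

/-- `f'` is the derivative of `f` near `p`, and `f'` is Lipschitz near `p`. -/
structure HasLipDeriv (f : V → W) (f' : V → V →L[ℝ] W) (p : V) : Prop where
  hasFDerivAt : ∀ᶠ q in 𝓝 p, HasFDerivAt f (f' q) q
  lipNear : LipNear f' p

namespace HasLipDeriv

variable {p : V}

/-- A derivative that is continuous at `p` is a strict derivative there, and strict
differentiability implies a local Lipschitz bound. -/
theorem lipNear_self {f : V → W} {f' : V → V →L[ℝ] W} (h : HasLipDeriv f f' p) : LipNear f p :=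
  .of_hasStrictFDerivAt
    (hasStrictFDerivAt_of_hasFDerivAt_of_continuousAt h.hasFDerivAt h.lipNear.continuousAt)

theorem clm (L : V →L[ℝ] W) : HasLipDeriv L (fun _ => L) p :=
  ⟨Eventually.of_forall fun _ => L.hasFDerivAt, .const L⟩

theorem add {f g : V → W} {f' g' : V → V →L[ℝ] W} (hf : HasLipDeriv f f' p)
    (hg : HasLipDeriv g g' p) : HasLipDeriv (fun q => f q + g q) (fun q => f' q + g' q) p :=
  ⟨by filter_upwards [hf.1, hg.1] with q h1 h2 using h1.add h2, hf.2.add hg.2⟩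

theorem prodMk {f : V → W} {g : V → X} {f' : V → V →L[ℝ] W} {g' : V → V →L[ℝ] X}
    (hf : HasLipDeriv f f' p) (hg : HasLipDeriv g g' p) :
    HasLipDeriv (fun q => (f q, g q)) (fun q => (f' q).prod (g' q)) p :=
  ⟨by filter_upwards [hf.1, hg.1] with q h1 h2 using h1.prodMk h2,
    by
    refine IsBigO.congr_left (((hf.2.clm_comp (ContinuousLinearMap.compL ℝ V W (W × X)
      (.inl ℝ W X))).add (hg.2.clm_comp (ContinuousLinearMap.compL ℝ V X (W × X)
      (.inr ℝ W X))))) fun q => ?_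
    ext v <;> simp⟩

theorem clm_comp {f : V → W} {f' : V → V →L[ℝ] W} (L : W →L[ℝ] X) (hf : HasLipDeriv f f' p) :
    HasLipDeriv (fun q => L (f q)) (fun q => L.comp (f' q)) p :=
  ⟨by filter_upwards [hf.1] with q h1 using L.hasFDerivAt.comp q h1,
    hf.2.clm_comp (ContinuousLinearMap.compL ℝ V W X L)⟩

theorem comp_clm {f : W → X} {f' : W → W →L[ℝ] X} (L : V →L[ℝ] W) (hf : HasLipDeriv f f' (L p)) :
    HasLipDeriv (fun q => f (L q)) (fun q => (f' (L q)).comp L) p :=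
  ⟨by
    filter_upwards [L.continuous.continuousAt.eventually hf.1] with q h1
    exact h1.comp q L.hasFDerivAt,
    (LipNear.comp_clm L hf.2).clm_comp ((ContinuousLinearMap.compL ℝ V W X).flip L)⟩

theorem bilin (B : W →L[ℝ] X →L[ℝ] Y) {f : V → W} {g : V → X} {f' : V → V →L[ℝ] W}
    {g' : V → V →L[ℝ] X} (hf : HasLipDeriv f f' p) (hg : HasLipDeriv g g' p) :
    HasLipDeriv (fun q => B (f q) (g q))
      (fun q => B.precompR V (f q) (g' q) + B.precompL V (f' q) (g q)) p :=
  ⟨by filter_upwards [hf.1, hg.1] with q h1 h2 using B.hasFDerivAt_of_bilinear h1 h2,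
    (LipNear.bilin (B.precompR V) hf.lipNear_self hg.2).add
      (LipNear.bilin (B.precompL V) hf.2 hg.lipNear_self)⟩

end HasLipDeriv

theorem C2LipAt.hasLipDeriv_fderiv {f : V → W} {p : V} (h : C2LipAt f p) :
    HasLipDeriv (fderiv ℝ f) (fderiv ℝ (fderiv ℝ f)) p := by
  obtain ⟨h2, K, U, hU, hK⟩ := h
  refine ⟨?_, ?_⟩
  · filter_upwards [h2.eventually (by simp)] with q hq
    have : ContDiffAt ℝ 1 (fderiv ℝ f) q := hq.fderiv_right (by norm_num)
    exact (this.differentiableAt (by simp)).hasFDerivAt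
  · refine IsBigO.of_bound K ?_
    filter_upwards [prod_mem_nhds hU hU] with q hq
    exact hK.norm_sub_le hq.1 hq.2

theorem C2LipAt.hasLipDeriv {f : V → W} {p : V} (h : C2LipAt f p) :
    HasLipDeriv f (fderiv ℝ f) p := by
  refine ⟨?_, h.hasLipDeriv_fderiv.lipNear_self⟩
  filter_upwards [h.1.eventually (by simp)] with q hq
  exact (hq.differentiableAt (by simp)).hasFDerivAt

/-- `f'` is the derivative of `f` near `p`, and `f''` is the second derivative at `p`. -/
structure HasSecondFDerivAt (f : V → W) (f' : V → V →L[ℝ] W) (f'' : V →L[ℝ] V →L[ℝ] W) (p : V) :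
    Prop where
  hasFDerivAt : ∀ᶠ q in 𝓝 p, HasFDerivAt f (f' q) q
  second : HasFDerivAt f' f'' p

namespace HasSecondFDerivAt

variable {p : V}

theorem fderiv_fderiv {f : V → W} {f' : V → V →L[ℝ] W} {f'' : V →L[ℝ] V →L[ℝ] W}
    (h : HasSecondFDerivAt f f' f'' p) : fderiv ℝ (fderiv ℝ f) p = f'' := by
  have : fderiv ℝ f =ᶠ[𝓝 p] f' := h.1.mono fun q hq => hq.fderiv
  exact (h.2.congr_of_eventuallyEq this).fderiv

theorem symm {f : V → W} {f' : V → V →L[ℝ] W} {f'' : V →L[ℝ] V →L[ℝ] W}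
    (h : HasSecondFDerivAt f f' f'' p) (v w : V) : f'' v w = f'' w v :=
  second_derivative_symmetric_of_eventually h.1 h.2 v w

theorem of_contDiffAt {f : V → W} (h : ContDiffAt ℝ 2 f p) :
    HasSecondFDerivAt f (fderiv ℝ f) (fderiv ℝ (fderiv ℝ f) p) p := by
  refine ⟨?_, ?_⟩
  · filter_upwards [h.eventually (by simp)] with q hq
    exact (hq.differentiableAt (by simp)).hasFDerivAt
  · have : ContDiffAt ℝ 1 (fderiv ℝ f) p := h.fderiv_right (by norm_num)
    exact (this.differentiableAt (by simp)).hasFDerivAt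

theorem add {f g : V → W} {f' g' : V → V →L[ℝ] W} {f'' g'' : V →L[ℝ] V →L[ℝ] W}
    (hf : HasSecondFDerivAt f f' f'' p) (hg : HasSecondFDerivAt g g' g'' p) :
    HasSecondFDerivAt (fun q => f q + g q) (fun q => f' q + g' q) (f'' + g'') p :=
  ⟨by filter_upwards [hf.1, hg.1] with q h1 h2 using h1.add h2, hf.2.add hg.2⟩

theorem clm (L : V →L[ℝ] W) : HasSecondFDerivAt L (fun _ => L) 0 p :=
  ⟨Eventually.of_forall fun _ => L.hasFDerivAt, hasFDerivAt_const _ _⟩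

theorem clm_comp {f : V → W} {f' : V → V →L[ℝ] W} {f'' : V →L[ℝ] V →L[ℝ] W} (L : W →L[ℝ] X)
    (hf : HasSecondFDerivAt f f' f'' p) :
    HasSecondFDerivAt (fun q => L (f q)) (fun q => L.comp (f' q))
      ((ContinuousLinearMap.compL ℝ V W X L).comp f'') p :=
  ⟨by filter_upwards [hf.1] with q h1 using L.hasFDerivAt.comp q h1,
    (ContinuousLinearMap.compL ℝ V W X L).hasFDerivAt.comp p hf.2⟩

theorem comp_clm {f : W → X} {f' : W → W →L[ℝ] X} {f'' : W →L[ℝ] W →L[ℝ] X} (L : V →L[ℝ] W)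
    (hf : HasSecondFDerivAt f f' f'' (L p)) :
    HasSecondFDerivAt (fun q => f (L q)) (fun q => (f' (L q)).comp L)
      (((ContinuousLinearMap.compL ℝ V W X).flip L).comp (f''.comp L)) p :=
  ⟨by
    filter_upwards [L.continuous.continuousAt.eventually hf.1] with q h1
    exact h1.comp q L.hasFDerivAt,
    ((ContinuousLinearMap.compL ℝ V W X).flip L).hasFDerivAt.comp p
      (hf.2.comp p L.hasFDerivAt)⟩

end HasSecondFDerivAt

/-- The mean value inequality is applied on the segment from `a` to `b` with the derivative compared
to its value at `a`. It varies by at most K‖b - a‖ along the segment. -/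
theorem HasLipDeriv.exists_quadratic_bound {f : V → W} {f' : V → V →L[ℝ] W} {p : V}
    (h : HasLipDeriv f f' p) :
    ∃ K : ℝ, 0 < K ∧ ∃ r : ℝ, 0 < r ∧
      (∀ a ∈ Metric.ball p r, ∀ b ∈ Metric.ball p r, ‖f' a - f' b‖ ≤ K * ‖a - b‖) ∧
      (∀ a ∈ Metric.ball p r, ∀ b ∈ Metric.ball p r, ‖f a - f b‖ ≤ K * ‖a - b‖) ∧
      ∀ a ∈ Metric.ball p r, ∀ b ∈ Metric.ball p r,
        ‖f b - f a - f' a (b - a)‖ ≤ K * ‖b - a‖ ^ 2 := by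
  obtain ⟨K₁, hK₁, r₁, hr₁, h₁⟩ := h.lipNear.exists_ball
  obtain ⟨K₂, hK₂, r₂, hr₂, h₂⟩ := h.lipNear_self.exists_ball
  obtain ⟨r₃, hr₃, h₃⟩ := Metric.eventually_nhds_iff_ball.1 h.hasFDerivAt
  refine ⟨max K₁ K₂, lt_max_of_lt_left hK₁, min r₁ (min r₂ r₃), by positivity, ?_, ?_, ?_⟩
  · intro a ha b hb
    refine (h₁ a (Metric.ball_subset_ball (by simp) ha) b
      (Metric.ball_subset_ball (by simp) hb)).trans ?_
    gcongr; simp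
  · intro a ha b hb
    refine (h₂ a (Metric.ball_subset_ball (by simp) ha) b
      (Metric.ball_subset_ball (by simp) hb)).trans ?_
    gcongr; simp
  · intro a ha b hb
    have hs : segment ℝ a b ⊆ Metric.ball p (min r₁ (min r₂ r₃)) :=
      (convex_ball _ _).segment_subset ha hb
    have hab := Convex.norm_image_sub_le_of_norm_hasFDerivWithin_le' (f := f) (f' := f')
      (s := segment ℝ a b) (φ := f' a) (C := max K₁ K₂ * ‖b - a‖) (x := a) (y := b)
      (fun q hq => (h₃ q (Metric.ball_subset_ball (by simp) (hs hq))).hasFDerivWithinAt)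
      (fun q hq => ?_) (convex_segment a b) (left_mem_segment ℝ a b) (right_mem_segment ℝ a b)
    · rw [pow_two, ← mul_assoc]; exact hab
    · refine (h₁ q (Metric.ball_subset_ball (by simp) (hs hq)) a
        (Metric.ball_subset_ball (by simp) ha)).trans ?_
      have hq' : ‖q - a‖ ≤ ‖b - a‖ := norm_sub_le_of_mem_segment hq
      gcongr; simp

/-- Local theory of Newton's method: near a point where the derivative is injective, the inverses
of the derivatives are uniformly bounded, and distances are controlled by the values. -/
theorem HasLipDeriv.exists_newton_bounds [FiniteDimensional ℝ V] [FiniteDimensional ℝ W]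
    (hdim : Module.finrank ℝ V = Module.finrank ℝ W) {f : V → W} {f' : V → V →L[ℝ] W} {p : V}
    (h : HasLipDeriv f f' p) (hinj : ∀ v, f' p v = 0 → v = 0) :
    ∃ C : ℝ, 0 < C ∧ ∃ r : ℝ, 0 < r ∧
      (∀ a ∈ Metric.ball p r, ∀ v, ‖v‖ ≤ C * ‖f' a v‖) ∧
      (∀ a ∈ Metric.ball p r, Function.Surjective (f' a)) ∧
      (∀ a ∈ Metric.ball p r, ‖a - p‖ ≤ C * ‖f a - f p‖) ∧
      (∀ a ∈ Metric.ball p r, ‖f a - f p‖ ≤ C * ‖a - p‖) ∧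
      ∀ a ∈ Metric.ball p r, ∀ b ∈ Metric.ball p r,
        ‖f b - f a - f' a (b - a)‖ ≤ C * ‖b - a‖ ^ 2 := by
  obtain ⟨K, hK, r₁, hr₁, h₁, h₂, h₃⟩ := h.exists_quadratic_bound
  obtain ⟨c, hc, hac⟩ := (f' p : V →ₗ[ℝ] W).exists_antilipschitzWith
    (LinearMap.ker_eq_bot'.2 hinj)
  have hcr : (0 : ℝ) < c := hc
  have hanti : ∀ v, ‖v‖ ≤ c * ‖f' p v‖ := fun v => by
    simpa using hac.le_mul_dist v 0
  have hp : ∀ r > 0, p ∈ Metric.ball p r := fun r hr => Metric.mem_ball_self hr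
  -- On this ball `f' a` is within 1/(2c) of `f' p`, so the lower bound at `p` survives with its
  -- constant doubled.
  have key : ∀ a ∈ Metric.ball p (min r₁ (1 / (2 * c * K))), ∀ v, ‖v‖ ≤ 2 * c * ‖f' a v‖ := by
    intro a ha v
    have ha1 : a ∈ Metric.ball p r₁ := Metric.ball_subset_ball (by simp) ha
    have ha2 : ‖a - p‖ ≤ 1 / (2 * c * K) := by
      have := Metric.ball_subset_ball (min_le_right _ _) ha
      rw [mem_ball_iff_norm] at this
      exact this.le
    have h4 := h₁ a ha1 p (hp _ hr₁)
    have h5 : ‖f' p v‖ ≤ ‖f' a v‖ + ‖f' a - f' p‖ * ‖v‖ := by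
      have := (f' a - f' p).le_opNorm v
      have h6 : f' p v = f' a v - (f' a - f' p) v := by simp
      rw [h6]
      exact (norm_sub_le _ _).trans (by gcongr)
    have h7 : ‖f' a - f' p‖ ≤ 1 / (2 * c) := by
      refine h4.trans ((mul_le_mul_of_nonneg_left ha2 hK.le).trans ?_)
      rw [mul_one_div, div_le_div_iff₀ (by positivity) (by positivity)]
      exact le_of_eq (by ring)
    have h8 := hanti v
    have h9 : ‖v‖ ≤ c * ‖f' a v‖ + 1 / 2 * ‖v‖ := by
      calc ‖v‖ ≤ c * (‖f' a v‖ + 1 / (2 * c) * ‖v‖) :=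
            h8.trans (mul_le_mul_of_nonneg_left (h5.trans (by gcongr)) hcr.le)
        _ = _ := by field_simp
    linarith
  -- The radius 1/(4cK) bounds the Taylor remainder by ‖p - a‖/(4c). After multiplication by 2c it
  -- is half of ‖p - a‖ and is absorbed, which turns 2c into 4c.
  refine ⟨max (4 * c) K, lt_max_of_lt_right hK, min (min r₁ (1 / (2 * c * K))) (1 / (4 * c * K)),
    by positivity, ?_, ?_, ?_, ?_, ?_⟩
  · intro a ha v
    refine (key a (Metric.ball_subset_ball (by simp) ha) v).trans ?_
    gcongr
    exact (by linarith : 2 * (c : ℝ) ≤ 4 * c).trans (le_max_left _ _)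
  · intro a ha
    refine (LinearMap.injective_iff_surjective_of_finrank_eq_finrank hdim
      (f := (f' a : V →ₗ[ℝ] W))).1 ?_
    rw [← LinearMap.ker_eq_bot, LinearMap.ker_eq_bot']
    intro v hv
    have h1 := key a (Metric.ball_subset_ball (by simp) ha) v
    have h2 : f' a v = 0 := hv
    rw [h2, norm_zero, mul_zero] at h1
    exact norm_le_zero_iff.1 h1
  · intro a ha
    have h1 := key a (Metric.ball_subset_ball (by simp) ha) (p - a)
    have ha1 : a ∈ Metric.ball p r₁ := Metric.ball_subset_ball (by simp) ha
    have h2 := h₃ a ha1 p (hp _ hr₁)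
    have ha2 : ‖p - a‖ ≤ 1 / (4 * c * K) := by
      have := Metric.ball_subset_ball (min_le_right _ _) ha
      rw [mem_ball_iff_norm'] at this
      exact this.le
    have h4 : ‖f' a (p - a)‖ ≤ ‖f a - f p‖ + K * ‖p - a‖ ^ 2 := by
      have h6 : f' a (p - a) = -(f a - f p) - (f p - f a - f' a (p - a)) := by abel
      rw [h6]
      exact (norm_sub_le _ _).trans (by rw [norm_neg]; gcongr)
    have h5 : K * ‖p - a‖ ^ 2 ≤ 1 / (4 * c) * ‖p - a‖ := by
      calc K * ‖p - a‖ ^ 2 = (K * ‖p - a‖) * ‖p - a‖ := by ring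
        _ ≤ (K * (1 / (4 * c * K))) * ‖p - a‖ := by gcongr
        _ = _ := by field_simp
    have h7 : ‖p - a‖ ≤ 2 * c * ‖f a - f p‖ + 1 / 2 * ‖p - a‖ := by
      calc ‖p - a‖ ≤ 2 * c * (‖f a - f p‖ + 1 / (4 * c) * ‖p - a‖) :=
            h1.trans (mul_le_mul_of_nonneg_left (h4.trans (by gcongr)) (by positivity))
        _ = _ := by field_simp; ring
    rw [norm_sub_rev a p]
    calc ‖p - a‖ ≤ 4 * c * ‖f a - f p‖ := by linarith
      _ ≤ _ := by gcongr; simp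
  · intro a ha
    refine (h₂ a (Metric.ball_subset_ball (by simp) ha) p (hp _ hr₁)).trans ?_
    gcongr; simp
  · intro a ha b hb
    refine (h₃ a (Metric.ball_subset_ball (by simp) ha) b
      (Metric.ball_subset_ball (by simp) hb)).trans ?_
    gcongr; simp

end Calculus

/-! ### Positivity by penalization. -/

/-- If a continuous family of functions `h`, positively homogeneous of degree two, is at `a`
positive where the nonnegative function `q` vanishes, then a penalty makes it positive near `a`. -/
theorem eventually_nonneg_add_penalty {X V : Type*} [TopologicalSpace X] [NormedAddCommGroup V]
    [NormedSpace ℝ V] [FiniteDimensional ℝ V] {h q : X → V → ℝ} {a : X}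
    (hc : ∀ v, ContinuousAt (fun z : X × V => h z.1 z.2) (a, v))
    (qc : ∀ v, ContinuousAt (fun z : X × V => q z.1 z.2) (a, v))
    (h_smul : ∀ b (t : ℝ) v, h b (t • v) = t ^ 2 * h b v)
    (q_smul : ∀ b (t : ℝ) v, q b (t • v) = t ^ 2 * q b v)
    (q_nonneg : ∀ b v, 0 ≤ q b v) (hpos : ∀ v, v ≠ 0 → q a v = 0 → 0 < h a v) :
    ∃ M : ℝ, 0 < M ∧ ∀ᶠ b in 𝓝 a, ∀ v, 0 ≤ h b v + M * q b v := by
  have main : ∃ M : ℝ, 0 < M ∧ ∀ᶠ b in 𝓝 a, ∀ v ∈ Metric.sphere (0 : V) 1,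
      0 ≤ h b v + M * q b v := by
    -- It suffices to find a penalty near each unit vector: finitely many such pieces cover the
    -- sphere, and the largest penalty serves for all since `q` is nonnegative.
    refine (isCompact_sphere (0 : V) 1).induction_on (p := fun S => ∃ M : ℝ, 0 < M ∧
      ∀ᶠ b in 𝓝 a, ∀ v ∈ S, 0 ≤ h b v + M * q b v) ⟨1, one_pos, by simp⟩ ?_ ?_ ?_
    · rintro S T hST ⟨M, hM, hT⟩
      exact ⟨M, hM, hT.mono fun b hb v hv => hb v (hST hv)⟩
    · rintro S T ⟨M, hM, hS⟩ ⟨M', hM', hT⟩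
      refine ⟨max M M', lt_max_of_lt_left hM, ?_⟩
      filter_upwards [hS, hT] with b h1 h2 v hv
      have := q_nonneg b v
      rcases hv with hv | hv
      · exact (h1 v hv).trans (by gcongr; simp)
      · exact (h2 v hv).trans (by gcongr; simp)
    · intro v hv
      have hv0 : v ≠ 0 := by
        rintro rfl
        simp at hv
      suffices ∃ M : ℝ, 0 < M ∧ 0 < h a v + M * q a v by
        obtain ⟨M, hM, hpos⟩ := this
        have hcont : ContinuousAt (fun z : X × V => h z.1 z.2 + M * q z.1 z.2) (a, v) :=
          (hc v).add ((qc v).const_mul M)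
        have hev := hcont.eventually_const_lt hpos
        rw [nhds_prod_eq] at hev
        obtain ⟨s, hs, t, ht, hst⟩ := mem_prod_iff.1 hev
        refine ⟨t, mem_nhdsWithin_of_mem_nhds ht, M, hM, ?_⟩
        filter_upwards [hs] with b hb u hu
        exact (hst (Set.mk_mem_prod hb hu)).le
      rcases (q_nonneg a v).eq_or_lt with h0 | h0
      · exact ⟨1, one_pos, by simpa [← h0] using hpos v hv0 h0.symm⟩
      -- Where `q` is positive this choice lifts the penalized value to at least 1, whatever the
      -- sign of `h`.
      · refine ⟨(|h a v| + 1) / q a v, by positivity, ?_⟩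
        rw [div_mul_cancel₀ _ h0.ne']
        have := neg_abs_le (h a v)
        linarith
  obtain ⟨M, hM, hev⟩ := main
  refine ⟨M, hM, hev.mono fun b hb v => ?_⟩
  rcases eq_or_ne v 0 with rfl | hv
  · have h1 := h_smul b 0 0
    have h2 := q_smul b 0 0
    simp only [smul_zero] at h1 h2
    rw [h1, h2]; simp
  · have h3 : ‖v‖ ≠ 0 := norm_ne_zero_iff.2 hv
    have h1 := hb (‖v‖⁻¹ • v) (by simp [norm_smul, h3])
    rw [h_smul, q_smul] at h1
    have h4 : 0 < (‖v‖⁻¹) ^ 2 := by positivity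
    refine le_of_mul_le_mul_left ?_ h4
    linarith

/-! ### The optimality system as a map between normed spaces. -/

/-- The inner product as a continuous bilinear map. -/
def innerCLM (m : ℕ) : Vec m →L[ℝ] Vec m →L[ℝ] ℝ :=
  (isBoundedBilinearMap_inner (𝕜 := ℝ) (E := Vec m)).toContinuousLinearMap

@[simp] theorem innerCLM_apply {m : ℕ} (a b : Vec m) : innerCLM m a b = ⟪a, b⟫_ℝ := rfl

/-- The functional `h ↦ ⟪l, A (L h)⟫`, bilinear in `l` and `A`. -/
def pairing {m : ℕ} {T V : Type*} [NormedAddCommGroup T] [NormedSpace ℝ T]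
    [NormedAddCommGroup V] [NormedSpace ℝ V] (L : T →L[ℝ] V) :
    Vec m →L[ℝ] (V →L[ℝ] Vec m) →L[ℝ] (T →L[ℝ] ℝ) :=
  ((ContinuousLinearMap.compL ℝ T (Vec m) ℝ).comp (innerCLM m)).bilinearComp
    (ContinuousLinearMap.id ℝ _) ((ContinuousLinearMap.compL ℝ T V (Vec m)).flip L)

@[simp] theorem pairing_apply {m : ℕ} {T V : Type*} [NormedAddCommGroup T] [NormedSpace ℝ T]
    [NormedAddCommGroup V] [NormedSpace ℝ V] (L : T →L[ℝ] V) (l : Vec m) (A : V →L[ℝ] Vec m)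
    (h : T) : pairing L l A h = ⟪l, A (L h)⟫_ℝ := rfl

/-- The variables `(x, y, x̃)`. -/
abbrev Tri (n₀ n₁ : ℕ) := Vec n₀ × Vec n₁ × Vec n₀

/-- Primal-dual points as a normed space: `(z, lam₀, s₀, lam₁, eta)`. -/
abbrev PDSpace (n₀ n₁ m₀ m₁ : ℕ) :=
  Primal n₀ n₁ m₁ × Vec m₀ × Vec m₀ × Vec m₁ × Vec n₀

/-- The space of residuals of the optimality system: stationarity in `(x, y, x̃)`, activity of the
master constraints, master constraints with slacks, complementarity, subproblem constraints with
slacks, and the copy constraint. -/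
abbrev Residual (n₀ n₁ m₀ m₁ : ℕ) :=
  (Tri n₀ n₁ →L[ℝ] ℝ) × (Fin m₀ → ℝ) × Vec m₀ × (Fin m₁ → ℝ) × Vec m₁ × Vec n₀

namespace PDPoint

variable {n₀ n₁ m₀ m₁ : ℕ}

/-- The coordinates of a primal-dual point. -/
def toProd (w : PDPoint n₀ n₁ m₀ m₁) : PDSpace n₀ n₁ m₀ m₁ := (w.z, w.lam₀, w.s₀, w.lam₁, w.eta)

/-- The primal-dual point with given coordinates. -/
def ofProd (e : PDSpace n₀ n₁ m₀ m₁) : PDPoint n₀ n₁ m₀ m₁ :=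
  ⟨e.1.1, e.2.1, e.2.2.1, e.1.2.1, e.1.2.2.1, e.1.2.2.2, e.2.2.2.1, e.2.2.2.2⟩

theorem toProd_move (w Δ : PDPoint n₀ n₁ m₀ m₁) (α : ℝ) :
    (w.move α Δ).toProd = w.toProd + α • Δ.toProd := rfl

/-- The variables `(x, y, x̃)` of a primal-dual point. -/
def tri (w : PDPoint n₀ n₁ m₀ m₁) : Tri n₀ n₁ := (w.x, w.y, w.xt)

/-- The linear map `(x, y, x̃, s) ↦ (x, y, x̃)`. -/
def triCLM : Primal n₀ n₁ m₁ →L[ℝ] Tri n₀ n₁ :=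
  (ContinuousLinearMap.fst ℝ _ _).prod
    (((ContinuousLinearMap.fst ℝ _ _).prod
      ((ContinuousLinearMap.fst ℝ _ _).comp (ContinuousLinearMap.snd ℝ _ _))).comp
        (ContinuousLinearMap.snd ℝ _ _))

@[simp] theorem triCLM_apply (d : Primal n₀ n₁ m₁) : triCLM d = (d.1, d.2.1, d.2.2.1) := rfl

end PDPoint

namespace TwoStage

open PDPoint

variable {n₀ n₁ m₀ m₁ : ℕ} (P : TwoStage n₀ n₁ m₀ m₁)

/-- The functional `(x, y, x̃) ↦ ⟪eta, x̃ - x⟫`, linear in `eta`. -/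
def copyForm : Vec n₀ →L[ℝ] (Tri n₀ n₁ →L[ℝ] ℝ) :=
  ((ContinuousLinearMap.compL ℝ (Tri n₀ n₁) (Vec n₀) ℝ).flip
    ((ContinuousLinearMap.snd ℝ _ _).comp (ContinuousLinearMap.snd ℝ _ _) -
      ContinuousLinearMap.fst ℝ _ _)).comp (innerCLM n₀)

@[simp] theorem copyForm_apply (eta : Vec n₀) (h : Tri n₀ n₁) :
    copyForm eta h = ⟪eta, h.2.2 - h.1⟫_ℝ := rfl

/-- Derivative of the Lagrangian in `(x, y, x̃)`. -/
def stat (w : PDPoint n₀ n₁ m₀ m₁) : Tri n₀ n₁ →L[ℝ] ℝ :=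
  (fderiv ℝ P.f₀ w.x).comp (ContinuousLinearMap.fst ℝ _ _)
    + (fderiv ℝ P.f₁ (w.y, w.xt)).comp (ContinuousLinearMap.snd ℝ _ _)
    + pairing (ContinuousLinearMap.fst ℝ _ _) w.lam₀ (fderiv ℝ P.c₀ w.x)
    + pairing (ContinuousLinearMap.snd ℝ _ _) w.lam₁ (fderiv ℝ P.c₁ (w.y, w.xt))
    + copyForm w.eta

theorem stat_apply (w : PDPoint n₀ n₁ m₀ m₁) (h : Tri n₀ n₁) :
    P.stat w h = fderiv ℝ P.f₀ w.x h.1 + fderiv ℝ P.f₁ (w.y, w.xt) h.2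
      + ⟪w.lam₀, fderiv ℝ P.c₀ w.x h.1⟫_ℝ + ⟪w.lam₁, fderiv ℝ P.c₁ (w.y, w.xt) h.2⟫_ℝ
      + ⟪w.eta, h.2.2 - h.1⟫_ℝ := rfl

/-- Hessian of the Lagrangian in `(x, y, x̃)`, as a bilinear function. -/
def hess (w : PDPoint n₀ n₁ m₀ m₁) (d h : Tri n₀ n₁) : ℝ :=
  fderiv ℝ (fderiv ℝ P.f₀) w.x d.1 h.1 + fderiv ℝ (fderiv ℝ P.f₁) (w.y, w.xt) d.2 h.2
    + ⟪w.lam₀, fderiv ℝ (fderiv ℝ P.c₀) w.x d.1 h.1⟫_ℝ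
    + ⟪w.lam₁, fderiv ℝ (fderiv ℝ P.c₁) (w.y, w.xt) d.2 h.2⟫_ℝ

/-- Derivative of `stat` at `w` in the direction `Δ`. -/
def linStat (w Δ : PDPoint n₀ n₁ m₀ m₁) : Tri n₀ n₁ →L[ℝ] ℝ :=
  (fderiv ℝ (fderiv ℝ P.f₀) w.x Δ.x).comp (ContinuousLinearMap.fst ℝ _ _)
    + (fderiv ℝ (fderiv ℝ P.f₁) (w.y, w.xt) (Δ.y, Δ.xt)).comp (ContinuousLinearMap.snd ℝ _ _)
    + (pairing (ContinuousLinearMap.fst ℝ _ _) w.lam₀ (fderiv ℝ (fderiv ℝ P.c₀) w.x Δ.x)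
      + pairing (ContinuousLinearMap.fst ℝ _ _) Δ.lam₀ (fderiv ℝ P.c₀ w.x))
    + (pairing (ContinuousLinearMap.snd ℝ _ _) w.lam₁
        (fderiv ℝ (fderiv ℝ P.c₁) (w.y, w.xt) (Δ.y, Δ.xt))
      + pairing (ContinuousLinearMap.snd ℝ _ _) Δ.lam₁ (fderiv ℝ P.c₁ (w.y, w.xt)))
    + copyForm Δ.eta

theorem linStat_apply (w Δ : PDPoint n₀ n₁ m₀ m₁) (h : Tri n₀ n₁) :
    P.linStat w Δ h = P.hess w Δ.tri h + ⟪Δ.lam₀, fderiv ℝ P.c₀ w.x h.1⟫_ℝ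
      + ⟪Δ.lam₁, fderiv ℝ P.c₁ (w.y, w.xt) h.2⟫_ℝ + ⟪Δ.eta, h.2.2 - h.1⟫_ℝ := by
  simp only [linStat, hess, tri, add_apply, ContinuousLinearMap.comp_apply, pairing_apply,
    copyForm_apply, ContinuousLinearMap.coe_fst', ContinuousLinearMap.coe_snd']
  ring

open Classical in
/-- The slacks of the constraints in `I` and the multipliers of the others. -/
def activity (I : Set (Fin m₀)) : (Vec m₀ × Vec m₀) →L[ℝ] (Fin m₀ → ℝ) :=
  ContinuousLinearMap.pi fun i =>
    if i ∈ I then (EuclideanSpace.proj i).comp (ContinuousLinearMap.fst ℝ _ _)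
    else (EuclideanSpace.proj i).comp (ContinuousLinearMap.snd ℝ _ _)

theorem activity_mem {I : Set (Fin m₀)} {i : Fin m₀} (hi : i ∈ I) (a : Vec m₀ × Vec m₀) :
    activity I a i = a.1 i := by
  simp [activity, hi]

theorem activity_notMem {I : Set (Fin m₀)} {i : Fin m₀} (hi : i ∉ I) (a : Vec m₀ × Vec m₀) :
    activity I a i = a.2 i := by
  simp [activity, hi]

/-- The coordinatewise product as a continuous bilinear map. -/
def hadamard (m : ℕ) : Vec m →L[ℝ] Vec m →L[ℝ] (Fin m → ℝ) :=
  (ContinuousLinearMap.mul ℝ (Fin m → ℝ)).bilinearComp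
    (EuclideanSpace.equiv (Fin m) ℝ).toContinuousLinearMap
    (EuclideanSpace.equiv (Fin m) ℝ).toContinuousLinearMap

@[simp] theorem hadamard_apply {m : ℕ} (a b : Vec m) (j : Fin m) :
    hadamard m a b j = a j * b j := rfl

/-- The optimality system with `μ = 0` in which the master constraints in `I` are active. -/
def residual (I : Set (Fin m₀)) (w : PDPoint n₀ n₁ m₀ m₁) : Residual n₀ n₁ m₀ m₁ :=
  (P.stat w, activity I (w.s₀, w.lam₀), P.c₀ w.x + w.s₀, hadamard m₁ w.s₁ w.lam₁,
    P.c₁ (w.y, w.xt) + w.s₁, w.xt - w.x)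

/-- Derivative of `residual` at `w` in the direction `Δ`. -/
def linResidual (I : Set (Fin m₀)) (w Δ : PDPoint n₀ n₁ m₀ m₁) : Residual n₀ n₁ m₀ m₁ :=
  (P.linStat w Δ, activity I (Δ.s₀, Δ.lam₀), fderiv ℝ P.c₀ w.x Δ.x + Δ.s₀,
    hadamard m₁ w.s₁ Δ.lam₁ + hadamard m₁ Δ.s₁ w.lam₁,
    fderiv ℝ P.c₁ (w.y, w.xt) (Δ.y, Δ.xt) + Δ.s₁, Δ.xt - Δ.x)

section Coordinates

/-- The coordinate `x`. -/
def xCLM : PDSpace n₀ n₁ m₀ m₁ →L[ℝ] Vec n₀ :=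
  (ContinuousLinearMap.fst ℝ _ _).comp (ContinuousLinearMap.fst ℝ _ _)

/-- The coordinates `(y, x̃)`. -/
def yxtCLM : PDSpace n₀ n₁ m₀ m₁ →L[ℝ] Vec n₁ × Vec n₀ :=
  (ContinuousLinearMap.snd ℝ _ _).comp (triCLM.comp (ContinuousLinearMap.fst ℝ _ _))

/-- The coordinate `s₁`. -/
def s₁CLM : PDSpace n₀ n₁ m₀ m₁ →L[ℝ] Vec m₁ :=
  (ContinuousLinearMap.snd ℝ _ _).comp ((ContinuousLinearMap.snd ℝ _ _).comp
    ((ContinuousLinearMap.snd ℝ _ _).comp (ContinuousLinearMap.fst ℝ _ _)))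

/-- The coordinate `lam₀`. -/
def lam₀CLM : PDSpace n₀ n₁ m₀ m₁ →L[ℝ] Vec m₀ :=
  (ContinuousLinearMap.fst ℝ _ _).comp (ContinuousLinearMap.snd ℝ _ _)

/-- The coordinate `s₀`. -/
def s₀CLM : PDSpace n₀ n₁ m₀ m₁ →L[ℝ] Vec m₀ :=
  (ContinuousLinearMap.fst ℝ _ _).comp ((ContinuousLinearMap.snd ℝ _ _).comp
    (ContinuousLinearMap.snd ℝ _ _))

/-- The coordinate `lam₁`. -/
def lam₁CLM : PDSpace n₀ n₁ m₀ m₁ →L[ℝ] Vec m₁ :=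
  (ContinuousLinearMap.fst ℝ _ _).comp ((ContinuousLinearMap.snd ℝ _ _).comp
    ((ContinuousLinearMap.snd ℝ _ _).comp (ContinuousLinearMap.snd ℝ _ _)))

/-- The coordinate `eta`. -/
def etaCLM : PDSpace n₀ n₁ m₀ m₁ →L[ℝ] Vec n₀ :=
  (ContinuousLinearMap.snd ℝ _ _).comp ((ContinuousLinearMap.snd ℝ _ _).comp
    ((ContinuousLinearMap.snd ℝ _ _).comp (ContinuousLinearMap.snd ℝ _ _)))

end Coordinates

/-- The problem data are `C²` with locally Lipschitz second derivatives at the primal part of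
`w`. -/
structure SmoothAt (w : PDPoint n₀ n₁ m₀ m₁) : Prop where
  f₀ : C2LipAt P.f₀ w.x
  c₀ : C2LipAt P.c₀ w.x
  f₁ : C2LipAt P.f₁ (w.y, w.xt)
  c₁ : C2LipAt P.c₁ (w.y, w.xt)

variable {P}

/-- With the active set frozen, every component is linear, bilinear, or a first-order quantity of
the data composed with coordinates. First derivatives of the data occur in it, so Lipschitz second
derivatives are what is needed. -/
theorem SmoothAt.exists_hasLipDeriv_residual {w : PDPoint n₀ n₁ m₀ m₁} (hw : P.SmoothAt w)
    (I : Set (Fin m₀)) :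
    ∃ J : PDSpace n₀ n₁ m₀ m₁ → PDSpace n₀ n₁ m₀ m₁ →L[ℝ] Residual n₀ n₁ m₀ m₁,
      HasLipDeriv (fun e => P.residual I (ofProd e)) J w.toProd ∧
      ∀ v Δ, J (toProd v) (toProd Δ) = P.linResidual I v Δ := by
  have hx : HasLipDeriv P.c₀ _ (xCLM w.toProd) := hw.c₀.hasLipDeriv
  have hx' : HasLipDeriv (fderiv ℝ P.c₀) _ (xCLM w.toProd) := hw.c₀.hasLipDeriv_fderiv
  have hf' : HasLipDeriv (fderiv ℝ P.f₀) _ (xCLM w.toProd) := hw.f₀.hasLipDeriv_fderiv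
  have hy : HasLipDeriv P.c₁ _ (yxtCLM w.toProd) := hw.c₁.hasLipDeriv
  have hy' : HasLipDeriv (fderiv ℝ P.c₁) _ (yxtCLM w.toProd) := hw.c₁.hasLipDeriv_fderiv
  have hg' : HasLipDeriv (fderiv ℝ P.f₁) _ (yxtCLM w.toProd) := hw.f₁.hasLipDeriv_fderiv
  have hl₀ := HasLipDeriv.clm (p := w.toProd) lam₀CLM
  have hl₁ := HasLipDeriv.clm (p := w.toProd) lam₁CLM
  have hs₁ := HasLipDeriv.clm (p := w.toProd) s₁CLM
  have hs₀ := HasLipDeriv.clm (p := w.toProd) s₀CLM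
  have hstat := (((((hf'.comp_clm xCLM).clm_comp ((ContinuousLinearMap.compL ℝ (Tri n₀ n₁) (Vec n₀)
      ℝ).flip (ContinuousLinearMap.fst ℝ _ _))).add
    ((hg'.comp_clm yxtCLM).clm_comp ((ContinuousLinearMap.compL ℝ (Tri n₀ n₁) (Vec n₁ × Vec n₀)
      ℝ).flip (ContinuousLinearMap.snd ℝ _ _)))).add
    (HasLipDeriv.bilin (pairing (ContinuousLinearMap.fst ℝ _ _)) hl₀ (hx'.comp_clm xCLM))).add
    (HasLipDeriv.bilin (pairing (ContinuousLinearMap.snd ℝ _ _)) hl₁ (hy'.comp_clm yxtCLM))).add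
    (HasLipDeriv.clm (p := w.toProd) (copyForm.comp etaCLM))
  have hact := HasLipDeriv.clm (p := w.toProd) ((activity I).comp (s₀CLM.prod lam₀CLM))
  have hcon₀ := (hx.comp_clm xCLM).add hs₀
  have hcompl := HasLipDeriv.bilin (hadamard m₁) hs₁ hl₁
  have hcon₁ := (hy.comp_clm yxtCLM).add hs₁
  have hcopy := HasLipDeriv.clm (p := w.toProd)
    ((ContinuousLinearMap.snd ℝ _ _).comp yxtCLM - xCLM)
  refine ⟨_, hstat.prodMk (hact.prodMk (hcon₀.prodMk (hcompl.prodMk (hcon₁.prodMk hcopy)))),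
    fun v Δ => ?_⟩
  -- The derivative assembled by the calculus rules unfolds to `linResidual`.
  rfl

end TwoStage

/-! ### Derivatives of the Lagrangian and the partial gradients. -/

namespace TwoStage

open PDPoint

variable {n₀ n₁ m₀ m₁ : ℕ} {P : TwoStage n₀ n₁ m₀ m₁}

/-- The linearized system is square, so its injectivity also gives solvability. The dual of the (x,
y, x̃) space matches these variables, and the activity block contributes one scalar per master
constraint. -/
theorem finrank_pdSpace :
    Module.finrank ℝ (PDSpace n₀ n₁ m₀ m₁) = Module.finrank ℝ (Residual n₀ n₁ m₀ m₁) := by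
  have e := LinearMap.toContinuousLinearMap (𝕜 := ℝ) (E := Tri n₀ n₁) (F' := ℝ)
  have h : Module.finrank ℝ (Tri n₀ n₁ →L[ℝ] ℝ) = Module.finrank ℝ (Tri n₀ n₁) :=
    e.finrank_eq.symm.trans Subspace.dual_finrank_eq
  have : Module.Free ℝ (Tri n₀ n₁ →L[ℝ] ℝ) := Module.Free.of_divisionRing _ _
  simp only [Module.finrank_prod, h, finrank_euclideanSpace, Fintype.card_fin,
    Module.finrank_fin_fun]
  ring

variable (P) in
/-- The problem data are `C²` at the primal part of `w`. -/
structure IsC2At (w : PDPoint n₀ n₁ m₀ m₁) : Prop where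
  f₀ : ContDiffAt ℝ 2 P.f₀ w.x
  c₀ : ContDiffAt ℝ 2 P.c₀ w.x
  f₁ : ContDiffAt ℝ 2 P.f₁ (w.y, w.xt)
  c₁ : ContDiffAt ℝ 2 P.c₁ (w.y, w.xt)

theorem SmoothAt.isC2At {w : PDPoint n₀ n₁ m₀ m₁} (hw : P.SmoothAt w) : P.IsC2At w :=
  ⟨hw.f₀.1, hw.c₀.1, hw.f₁.1, hw.c₁.1⟩

theorem IsC2At.eventually {w : PDPoint n₀ n₁ m₀ m₁} (hw : P.IsC2At w) :
    ∀ᶠ e in 𝓝 w.toProd, P.IsC2At (ofProd e) := by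
  have hx := (xCLM (n₀ := n₀) (n₁ := n₁) (m₀ := m₀) (m₁ := m₁)).continuous.tendsto w.toProd
  have hy := (yxtCLM (n₀ := n₀) (n₁ := n₁) (m₀ := m₀) (m₁ := m₁)).continuous.tendsto w.toProd
  filter_upwards [hx.eventually (hw.f₀.eventually (by simp)),
    hx.eventually (hw.c₀.eventually (by simp)), hy.eventually (hw.f₁.eventually (by simp)),
    hy.eventually (hw.c₁.eventually (by simp))] with e h1 h2 h3 h4
  exact ⟨h1, h2, h3, h4⟩

/-- First and second derivatives of the Lagrangian in `(x, y, x̃)`, without the copy constraint,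
composed with a linear map. -/
theorem IsC2At.exists_hasSecondFDerivAt {w : PDPoint n₀ n₁ m₀ m₁} (hw : P.IsC2At w) {Z : Type*}
    [NormedAddCommGroup Z] [NormedSpace ℝ Z] (L : Z →L[ℝ] Tri n₀ n₁) {q : Z} (hq : L q = w.tri) :
    ∃ g' g'', HasSecondFDerivAt (fun q => P.f₀ (L q).1 + P.f₁ (L q).2 + ⟪P.c₀ (L q).1, w.lam₀⟫_ℝ
        + ⟪P.c₁ (L q).2, w.lam₁⟫_ℝ) g' g'' q ∧
      (∀ h, g' q h = fderiv ℝ P.f₀ w.x (L h).1 + fderiv ℝ P.f₁ (w.y, w.xt) (L h).2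
        + ⟪w.lam₀, fderiv ℝ P.c₀ w.x (L h).1⟫_ℝ
        + ⟪w.lam₁, fderiv ℝ P.c₁ (w.y, w.xt) (L h).2⟫_ℝ) ∧
      ∀ d h, g'' d h = P.hess w (L d) (L h) := by
  have e1 : ((ContinuousLinearMap.fst ℝ _ _).comp L) q = w.x := by simp [hq, tri]
  have e2 : ((ContinuousLinearMap.snd ℝ _ _).comp L) q = (w.y, w.xt) := by simp [hq, tri]
  have h1 := HasSecondFDerivAt.comp_clm _ (HasSecondFDerivAt.of_contDiffAt (e1 ▸ hw.f₀))
  have h2 := HasSecondFDerivAt.comp_clm _ (HasSecondFDerivAt.of_contDiffAt (e2 ▸ hw.f₁))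
  have h3 := (HasSecondFDerivAt.comp_clm _
    (HasSecondFDerivAt.of_contDiffAt (e1 ▸ hw.c₀))).clm_comp (innerCLM m₀ w.lam₀)
  have h4 := (HasSecondFDerivAt.comp_clm _
    (HasSecondFDerivAt.of_contDiffAt (e2 ▸ hw.c₁))).clm_comp (innerCLM m₁ w.lam₁)
  have h := ((h1.add h2).add h3).add h4
  have hfun : (fun q => P.f₀ (L q).1 + P.f₁ (L q).2 + ⟪P.c₀ (L q).1, w.lam₀⟫_ℝ
      + ⟪P.c₁ (L q).2, w.lam₁⟫_ℝ) = fun q => P.f₀ (L q).1 + P.f₁ (L q).2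
      + ⟪w.lam₀, P.c₀ (L q).1⟫_ℝ + ⟪w.lam₁, P.c₁ (L q).2⟫_ℝ := funext fun q => by
    rw [real_inner_comm, real_inner_comm w.lam₁]
  rw [hfun]
  refine ⟨_, _, h, fun h => ?_, fun d h => ?_⟩
  · rw [e1, e2]
    simp
  · rw [e1, e2]
    simp [hess]

/-- The slack and copy terms are linear in z, so they contribute to the gradient but not to the
Hessian. -/
theorem IsC2At.exists_hasSecondFDerivAt_lag {w : PDPoint n₀ n₁ m₀ m₁} (hw : P.IsC2At w) :
    ∃ g' g'', HasSecondFDerivAt (fun z => P.lag z w.lam₀ w.lam₁ w.eta) g' g'' w.z ∧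
      (∀ h, g' w.z h = P.stat w (triCLM h) + ⟪h.2.2.2, w.lam₁⟫_ℝ) ∧
      ∀ d h, g'' d h = P.hess w (triCLM d) (triCLM h) := by
  obtain ⟨g', g'', hg, h1, h2⟩ := hw.exists_hasSecondFDerivAt (triCLM (m₁ := m₁)) (q := w.z) rfl
  have h3 := hg.add (HasSecondFDerivAt.clm (p := w.z) ((innerCLM m₁ w.lam₁).comp
    ((ContinuousLinearMap.snd ℝ (Vec n₀) (Vec m₁)).comp
    ((ContinuousLinearMap.snd ℝ (Vec n₁) _).comp (ContinuousLinearMap.snd ℝ (Vec n₀) _))) +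
    (copyForm w.eta).comp triCLM))
  have hfun : (fun z => P.lag z w.lam₀ w.lam₁ w.eta) = fun z => P.f₀ (triCLM z).1
      + P.f₁ (triCLM z).2 + ⟪P.c₀ (triCLM z).1, w.lam₀⟫_ℝ + ⟪P.c₁ (triCLM z).2, w.lam₁⟫_ℝ
      + (⟪w.lam₁, z.2.2.2⟫_ℝ + ⟪w.eta, z.2.2.1 - z.1⟫_ℝ) := funext fun z => by
    rw [lag, subLag, inner_add_left, real_inner_comm z.2.2.2, real_inner_comm (z.2.2.1 - z.1)]
    simp only [triCLM_apply]
    ring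
  rw [hfun]
  refine ⟨_, _, h3, ?_, ?_⟩
  · intro h
    simp [h1, stat_apply, real_inner_comm]
    ring
  · intro d h
    simp [h2]

/-- This and its analogues for y and x̃ identify the three gradients measured by θ with the
components of the single functional `stat`. -/
theorem IsC2At.gradX_inner {w : PDPoint n₀ n₁ m₀ m₁} (hw : P.IsC2At w) (h : Vec n₀) :
    ⟪P.gradX w, h⟫_ℝ = P.stat w (h, 0, 0) := by
  obtain ⟨g', g'', hg, h1, -⟩ := hw.exists_hasSecondFDerivAt_lag
  have h2 : HasFDerivAt (fun x : Vec n₀ => (x, w.y, w.xt, w.s₁))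
      ((ContinuousLinearMap.id ℝ _).prod 0) w.x := (hasFDerivAt_id _).prodMk (hasFDerivAt_const _ _)
  have h3 := (hg.hasFDerivAt.self_of_nhds : HasFDerivAt _ _ w.z).comp w.x h2
  rw [gradX, gradient, InnerProductSpace.toDual_symm_apply]
  erw [h3.fderiv]
  simp [h1]

/-- The difference depends on x alone, so gradients in y and x̃ may be taken of the full Lagrangian.
-/
theorem subLag_eq_lag_sub (z : Primal n₀ n₁ m₁) (l₀ : Vec m₀) (l₁ : Vec m₁) (eta : Vec n₀) :
    P.subLag z l₁ eta = P.lag z l₀ l₁ eta - (P.f₀ z.1 + ⟪P.c₀ z.1, l₀⟫_ℝ) := by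
  simp [lag]

theorem IsC2At.gradY_inner {w : PDPoint n₀ n₁ m₀ m₁} (hw : P.IsC2At w) (h : Vec n₁) :
    ⟪P.gradY w, h⟫_ℝ = P.stat w (0, h, 0) := by
  obtain ⟨g', g'', hg, h1, -⟩ := hw.exists_hasSecondFDerivAt_lag
  have h2 : HasFDerivAt (fun y : Vec n₁ => (w.x, y, w.xt, w.s₁))
      (ContinuousLinearMap.prod 0 ((ContinuousLinearMap.id ℝ _).prod 0)) w.y :=
    (hasFDerivAt_const _ _).prodMk ((hasFDerivAt_id _).prodMk (hasFDerivAt_const _ _))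
  have h3 := ((hg.hasFDerivAt.self_of_nhds : HasFDerivAt _ _ w.z).comp w.y h2).sub_const
    (P.f₀ w.x + ⟪P.c₀ w.x, w.lam₀⟫_ℝ)
  rw [gradY, gradient, InnerProductSpace.toDual_symm_apply]
  simp only [subLag_eq_lag_sub _ w.lam₀]
  erw [h3.fderiv]
  simp [h1]

theorem IsC2At.gradXt_inner {w : PDPoint n₀ n₁ m₀ m₁} (hw : P.IsC2At w) (h : Vec n₀) :
    ⟪P.gradXt w, h⟫_ℝ = P.stat w (0, 0, h) := by
  obtain ⟨g', g'', hg, h1, -⟩ := hw.exists_hasSecondFDerivAt_lag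
  have h2 : HasFDerivAt (fun xt : Vec n₀ => (w.x, w.y, xt, w.s₁))
      (ContinuousLinearMap.prod 0 (ContinuousLinearMap.prod 0
        ((ContinuousLinearMap.id ℝ _).prod 0))) w.xt :=
    (hasFDerivAt_const _ _).prodMk ((hasFDerivAt_const _ _).prodMk
      ((hasFDerivAt_id _).prodMk (hasFDerivAt_const _ _)))
  have h3 := ((hg.hasFDerivAt.self_of_nhds : HasFDerivAt _ _ w.z).comp w.xt h2).sub_const
    (P.f₀ w.x + ⟪P.c₀ w.x, w.lam₀⟫_ℝ)
  rw [gradXt, gradient, InnerProductSpace.toDual_symm_apply]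
  simp only [subLag_eq_lag_sub _ w.lam₀]
  erw [h3.fderiv]
  simp [h1]

/-! ### The system at a regular solution -/

theorem IsRegularSolution.smoothAt {x : Vec n₀} {y : Vec n₁} {l₀ : Vec m₀} {l₁ : Vec m₁}
    (h : P.IsRegularSolution x y l₀ l₁) : P.SmoothAt (P.primalDual x y l₀ l₁) :=
  ⟨h.smooth_f₀, h.smooth_c₀, h.smooth_f₁, h.smooth_c₁⟩

/-- The linear map `(x, y) ↦ (x, y, x)`. -/
def diagTri (n₀ n₁ : ℕ) : Vec n₀ × Vec n₁ →L[ℝ] Tri n₀ n₁ :=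
  (ContinuousLinearMap.fst ℝ _ _).prod
    ((ContinuousLinearMap.snd ℝ _ _).prod (ContinuousLinearMap.fst ℝ _ _))

@[simp] theorem diagTri_apply (p : Vec n₀ × Vec n₁) : diagTri n₀ n₁ p = (p.1, p.2, p.1) := rfl

section Solution

variable {x : Vec n₀} {y : Vec n₁} {l₀ : Vec m₀} {l₁ : Vec m₁}

theorem IsRegularSolution.exists_hasSecondFDerivAt_undecompLag
    (h : P.IsRegularSolution x y l₀ l₁) :
    ∃ g' g'', HasSecondFDerivAt (P.undecompLag l₀ l₁) g' g'' (x, y) ∧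
      (∀ d, g' (x, y) d = P.stat (P.primalDual x y l₀ l₁) (d.1, d.2, d.1)) ∧
      ∀ d e, g'' d e = P.hess (P.primalDual x y l₀ l₁) (d.1, d.2, d.1) (e.1, e.2, e.1) := by
  obtain ⟨g', g'', hg, h1, h2⟩ := h.smoothAt.isC2At.exists_hasSecondFDerivAt (diagTri n₀ n₁)
    (q := (x, y)) rfl
  refine ⟨g', g'', hg, fun d => ?_, fun d e => h2 d e⟩
  rw [h1, stat_apply]
  simp

theorem IsRegularSolution.dcon₀_apply (h : P.IsRegularSolution x y l₀ l₁) (i : Fin m₀)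
    (d : Vec n₀ × Vec n₁) : P.dcon₀ (x, y) i d = fderiv ℝ P.c₀ x d.1 i := by
  have h1 : HasFDerivAt P.c₀ (fderiv ℝ P.c₀ x) x :=
    (h.smooth_c₀.1.differentiableAt (by simp)).hasFDerivAt
  have h2 := (EuclideanSpace.proj (𝕜 := ℝ) i).hasFDerivAt.comp (x, y)
    (HasFDerivAt.comp (x, y) (g := P.c₀) (f := Prod.fst) h1 hasFDerivAt_fst)
  rw [dcon₀]
  erw [h2.fderiv]
  simp

theorem IsRegularSolution.dcon₁_apply (h : P.IsRegularSolution x y l₀ l₁) (j : Fin m₁)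
    (d : Vec n₀ × Vec n₁) : P.dcon₁ (x, y) j d = fderiv ℝ P.c₁ (y, x) (d.2, d.1) j := by
  have h1 : HasFDerivAt P.c₁ (fderiv ℝ P.c₁ (y, x)) (y, x) :=
    (h.smooth_c₁.1.differentiableAt (by simp)).hasFDerivAt
  have h2 := (EuclideanSpace.proj (𝕜 := ℝ) j).hasFDerivAt.comp (x, y)
    (HasFDerivAt.comp (x, y) (g := P.c₁) (f := fun q : Vec n₀ × Vec n₁ => (q.2, q.1)) h1
      (hasFDerivAt_snd.prodMk hasFDerivAt_fst))
  rw [dcon₁]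
  erw [h2.fderiv]
  simp

theorem IsRegularSolution.inner_eta (h : P.IsRegularSolution x y l₀ l₁) (d : Vec n₀) :
    ⟪(P.primalDual x y l₀ l₁).eta, d⟫_ℝ
      = -(fderiv ℝ P.f₁ (y, x) (0, d) + ⟪l₁, fderiv ℝ P.c₁ (y, x) (0, d)⟫_ℝ) := by
  have hf : HasFDerivAt P.f₁ (fderiv ℝ P.f₁ (y, x)) (y, x) :=
    (h.smooth_f₁.1.differentiableAt (by simp)).hasFDerivAt
  have hc : HasFDerivAt P.c₁ (fderiv ℝ P.c₁ (y, x)) (y, x) :=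
    (h.smooth_c₁.1.differentiableAt (by simp)).hasFDerivAt
  have hi : HasFDerivAt (fun x' : Vec n₀ => (y, x')) (ContinuousLinearMap.inr ℝ (Vec n₁) (Vec n₀)) x :=
    (hasFDerivAt_const _ _).prodMk (hasFDerivAt_id _)
  have h1 := (hf.comp x hi).add ((innerCLM m₁ l₁).hasFDerivAt.comp x (hc.comp x hi))
  have h2 : (fun x' => P.f₁ (y, x') + ⟪P.c₁ (y, x'), l₁⟫_ℝ)
      = fun x' => P.f₁ (y, x') + ⟪l₁, P.c₁ (y, x')⟫_ℝ := by
    simp only [real_inner_comm]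
  rw [primalDual, inner_neg_left, gradient, InnerProductSpace.toDual_symm_apply, h2]
  erw [h1.fderiv]
  simp

/-- A direction splits into a diagonal part with x̃ = x, where stationarity of the undecomposed
Lagrangian applies, and a part in x̃ alone, where the definition of η applies. -/
theorem IsRegularSolution.stat_eq_zero (h : P.IsRegularSolution x y l₀ l₁) :
    P.stat (P.primalDual x y l₀ l₁) = 0 := by
  obtain ⟨g', g'', hg, h1, -⟩ := h.exists_hasSecondFDerivAt_undecompLag
  have h2 : g' (x, y) = 0 := by
    rw [← hg.hasFDerivAt.self_of_nhds.fderiv]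
    exact h.kkt.stationary
  have h3 : ∀ d : Vec n₀, P.stat (P.primalDual x y l₀ l₁) (0, 0, d) = 0 := fun d => by
    have h6 := h.inner_eta d
    rw [stat_apply]
    simp only [primalDual] at h6 ⊢
    simp only [map_zero, inner_zero_right, sub_zero, h6]
    ring
  refine ContinuousLinearMap.ext fun d => ?_
  have h4 : d = (d.1, d.2.1, d.1) + (0, 0, d.2.2 - d.1) := by ext <;> simp
  rw [h4, map_add, h3, ← h1 (d.1, d.2.1), h2]
  simp

end Solution

end TwoStage

theorem sum_subtype_eq_sum {ι : Type*} [Fintype ι] {p : ι → Prop} [DecidablePred p] {f : ι → ℝ}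
    (hf : ∀ i, ¬p i → f i = 0) :
    ∑ i : {i // p i}, f i = ∑ i, f i := by
  rw [← Finset.sum_subtype (Finset.univ.filter p) (by simp) f, Finset.sum_filter_of_ne]
  exact fun i _ hi => by_contra fun hc => hi (hf i hc)

/-! ### Nonsingularity and curvature at the solution. -/

namespace TwoStage

open PDPoint

variable {n₀ n₁ m₀ m₁ : ℕ} {P : TwoStage n₀ n₁ m₀ m₁}

variable (P) in
/-- The active master constraints at `x`. -/
def active₀ (x : Vec n₀) : Set (Fin m₀) := {i | P.c₀ x i = 0}

section Solution

variable {x : Vec n₀} {y : Vec n₁} {l₀ : Vec m₀} {l₁ : Vec m₁}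

theorem IsRegularSolution.mult₀_eq_zero (h : P.IsRegularSolution x y l₀ l₁) {i : Fin m₀}
    (hi : P.c₀ x i ≠ 0) : l₀ i = 0 :=
  (mul_eq_zero.1 (h.kkt.compl₀ i)).resolve_right hi

theorem IsRegularSolution.mult₁_eq_zero (h : P.IsRegularSolution x y l₀ l₁) {j : Fin m₁}
    (hj : P.c₁ (y, x) j ≠ 0) : l₁ j = 0 :=
  (mul_eq_zero.1 (h.kkt.compl₁ j)).resolve_right hj

theorem IsRegularSolution.residual_eq_zero (h : P.IsRegularSolution x y l₀ l₁) :
    P.residual (P.active₀ x) (P.primalDual x y l₀ l₁) = 0 := by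
  have h1 : activity (P.active₀ x) ((P.primalDual x y l₀ l₁).s₀, (P.primalDual x y l₀ l₁).lam₀)
      = 0 := by
    ext i
    by_cases hi : i ∈ P.active₀ x
    · rw [activity_mem hi]
      have : P.c₀ x i = 0 := hi
      simp [primalDual, this]
    · rw [activity_notMem hi]
      exact h.mult₀_eq_zero hi
  have h2 : hadamard m₁ (P.primalDual x y l₀ l₁).s₁ (P.primalDual x y l₀ l₁).lam₁ = 0 := by
    ext j
    have := h.kkt.compl₁ j
    simp only [hadamard_apply, primalDual, PiLp.neg_apply, Pi.zero_apply]
    linarith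
  rw [residual, h.stat_eq_zero, h1, h2]
  simp [primalDual]

/-- Strict complementarity decouples the linearized complementarity equations: active constraints
have no slack change and inactive ones no multiplier change. Hence (Δx, Δy) is a critical direction
without curvature, and SOSC makes it zero. LICQ then eliminates the multipliers. -/
theorem IsRegularSolution.eq_zero_of_linResidual (h : P.IsRegularSolution x y l₀ l₁)
    {Δ : PDPoint n₀ n₁ m₀ m₁}
    (hΔ : P.linResidual (P.active₀ x) (P.primalDual x y l₀ l₁) Δ = 0) : Δ.toProd = 0 := by
  simp only [linResidual, Prod.mk_eq_zero] at hΔ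
  obtain ⟨hstat, hact, hcon₀, hcompl, hcon₁, hcopy⟩ := hΔ
  have hxt : Δ.xt = Δ.x := sub_eq_zero.1 hcopy
  have hcon₀' : ∀ i, fderiv ℝ P.c₀ x Δ.x i + Δ.s₀ i = 0 := fun i => congrArg (· i) hcon₀
  have hcon₁' : ∀ j, fderiv ℝ P.c₁ (y, x) (Δ.y, Δ.x) j + Δ.s₁ j = 0 := fun j => by
    rw [← hxt]
    exact congrArg (· j) hcon₁
  have hcompl' : ∀ j, -P.c₁ (y, x) j * Δ.lam₁ j + Δ.s₁ j * l₁ j = 0 := fun j => congrFun hcompl j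
  have hact₀ : ∀ i, P.c₀ x i = 0 → Δ.s₀ i = 0 := fun i hi => by
    have := congrFun hact i
    rwa [activity_mem (show i ∈ P.active₀ x from hi)] at this
  have hinact₀ : ∀ i, P.c₀ x i ≠ 0 → Δ.lam₀ i = 0 := fun i hi => by
    have := congrFun hact i
    rwa [activity_notMem (show i ∉ P.active₀ x from hi)] at this
  have hact₁ : ∀ j, P.c₁ (y, x) j = 0 → Δ.s₁ j = 0 := fun j hj => by
    have h1 := hcompl' j
    rw [hj, neg_zero, zero_mul, zero_add] at h1
    exact (mul_eq_zero.1 h1).resolve_right (h.strictCompl.2 j hj).ne'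
  have hinact₁ : ∀ j, P.c₁ (y, x) j ≠ 0 → Δ.lam₁ j = 0 := fun j hj => by
    have h1 := hcompl' j
    rw [h.mult₁_eq_zero hj, mul_zero, add_zero] at h1
    exact (mul_eq_zero.1 h1).resolve_left (neg_ne_zero.2 hj)
  have hstat' : ∀ d : Tri n₀ n₁, P.hess (P.primalDual x y l₀ l₁) (Δ.x, Δ.y, Δ.x) d
      + ⟪Δ.lam₀, fderiv ℝ P.c₀ x d.1⟫_ℝ + ⟪Δ.lam₁, fderiv ℝ P.c₁ (y, x) d.2⟫_ℝ
      + ⟪Δ.eta, d.2.2 - d.1⟫_ℝ = 0 := fun d => by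
    have h1 := congrArg (· d) hstat
    simp only [linStat_apply, tri, hxt] at h1
    exact h1
  have hcone : (Δ.x, Δ.y) ∈ P.criticalCone (x, y) l₀ l₁ := by
    have e₀ : ∀ i, P.c₀ x i = 0 → P.dcon₀ (x, y) i (Δ.x, Δ.y) = 0 := fun i hi => by
      rw [h.dcon₀_apply]
      have := hcon₀' i
      rwa [hact₀ i hi, add_zero] at this
    have e₁ : ∀ j, P.c₁ (y, x) j = 0 → P.dcon₁ (x, y) j (Δ.x, Δ.y) = 0 := fun j hj => by
      rw [h.dcon₁_apply]
      have := hcon₁' j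
      rwa [hact₁ j hj, add_zero] at this
    exact ⟨fun i hi => (e₀ i hi).le, fun i hi _ => e₀ i hi, fun j hj => (e₁ j hj).le,
      fun j hj _ => e₁ j hj⟩
  have hzero₀ : ⟪Δ.lam₀, fderiv ℝ P.c₀ x Δ.x⟫_ℝ = 0 := by
    rw [PiLp.inner_apply]
    refine Finset.sum_eq_zero fun i _ => ?_
    by_cases hi : P.c₀ x i = 0
    · have := hcon₀' i
      rw [hact₀ i hi, add_zero] at this
      rw [this, inner_zero_right]
    · rw [hinact₀ i hi, inner_zero_left]
  have hzero₁ : ⟪Δ.lam₁, fderiv ℝ P.c₁ (y, x) (Δ.y, Δ.x)⟫_ℝ = 0 := by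
    rw [PiLp.inner_apply]
    refine Finset.sum_eq_zero fun j _ => ?_
    by_cases hj : P.c₁ (y, x) j = 0
    · have := hcon₁' j
      rw [hact₁ j hj, add_zero] at this
      rw [this, inner_zero_right]
    · rw [hinact₁ j hj, inner_zero_left]
  obtain ⟨g', g'', hg, -, hg''⟩ := h.exists_hasSecondFDerivAt_undecompLag
  have hxy : (Δ.x, Δ.y) = 0 := by
    by_contra hne
    have h1 := h.secondOrder _ hcone hne
    rw [hg.fderiv_fderiv, hg''] at h1
    -- Stationarity is tested with the direction itself: the constraint terms vanish one index at a
    -- time, the copy term vanishes on the diagonal, and only the Hessian form remains.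
    have h2 := hstat' (Δ.x, Δ.y, Δ.x)
    simp only [hzero₀, hzero₁, sub_self, inner_zero_right, add_zero] at h2
    exact h1.ne' h2
  obtain ⟨hx, hy⟩ := Prod.mk_eq_zero.1 hxy
  have hs₀ : Δ.s₀ = 0 := by simpa [hx] using hcon₀
  have hs₁ : Δ.s₁ = 0 := by simpa [hx, hy, hxt, Prod.mk_zero_zero] using hcon₁
  have hess_zero : ∀ d, P.hess (P.primalDual x y l₀ l₁) (Δ.x, Δ.y, Δ.x) d = 0 := fun d => by
    simp [hess, hx, hy, Prod.mk_zero_zero]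
  simp only [hess_zero, zero_add] at hstat'
  have hlin := h.licq
  rw [LICQ, Fintype.linearIndependent_iff] at hlin
  -- Diagonal test directions remove η and leave a vanishing combination of the active gradients.
  have hmult := hlin (Sum.elim (fun i => Δ.lam₀ i) fun j => Δ.lam₁ j) (by
    refine ContinuousLinearMap.ext fun d => ?_
    have h1 := hstat' (d.1, d.2, d.1)
    rw [sub_self, inner_zero_right, add_zero, PiLp.inner_apply, PiLp.inner_apply] at h1
    rw [← sum_subtype_eq_sum (p := fun i => P.c₀ x i = 0)
        (fun i hi => by rw [hinact₀ i hi, inner_zero_left]),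
      ← sum_subtype_eq_sum (p := fun j => P.c₁ (y, x) j = 0)
        (fun j hj => by rw [hinact₁ j hj, inner_zero_left])] at h1
    simpa [h.dcon₀_apply, h.dcon₁_apply, mul_comm] using h1)
  have hl₀ : Δ.lam₀ = 0 := by
    ext i
    by_cases hi : P.c₀ x i = 0
    · exact hmult (Sum.inl ⟨i, hi⟩)
    · exact hinact₀ i hi
  have hl₁ : Δ.lam₁ = 0 := by
    ext j
    by_cases hj : P.c₁ (y, x) j = 0
    · exact hmult (Sum.inr ⟨j, hj⟩)
    · exact hinact₁ j hj
  have heta : Δ.eta = 0 := by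
    -- A test direction in x̃ alone isolates η, giving ‖Δη‖² = 0.
    have h1 := hstat' (0, 0, Δ.eta)
    simpa [hl₀, hl₁] using h1
  simp [toProd, z, hx, hy, hxt, hs₀, hs₁, hl₀, hl₁, heta]

theorem IsRegularSolution.exists_newton_bounds (h : P.IsRegularSolution x y l₀ l₁) :
    ∃ C : ℝ, 0 < C ∧ ∃ r : ℝ, 0 < r ∧
      ∀ w : PDPoint n₀ n₁ m₀ m₁, ‖w.toProd - (P.primalDual x y l₀ l₁).toProd‖ < r →
        (∀ Δ, ‖Δ.toProd‖ ≤ C * ‖P.linResidual (P.active₀ x) w Δ‖) ∧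
        (∀ b, ∃ Δ, P.linResidual (P.active₀ x) w Δ = b) ∧
        ‖w.toProd - (P.primalDual x y l₀ l₁).toProd‖ ≤ C * ‖P.residual (P.active₀ x) w‖ ∧
        ‖P.residual (P.active₀ x) w‖ ≤ C * ‖w.toProd - (P.primalDual x y l₀ l₁).toProd‖ ∧
        ∀ w' Δ : PDPoint n₀ n₁ m₀ m₁, ‖w'.toProd - (P.primalDual x y l₀ l₁).toProd‖ < r →
          Δ.toProd = w'.toProd - w.toProd →
          ‖P.residual (P.active₀ x) w' - P.residual (P.active₀ x) w
            - P.linResidual (P.active₀ x) w Δ‖ ≤ C * ‖Δ.toProd‖ ^ 2 := by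
  obtain ⟨J, hJ, hJl⟩ := h.smoothAt.exists_hasLipDeriv_residual (P.active₀ x)
  obtain ⟨C, hC, r, hr, h1, h2, h3, h4, h5⟩ := hJ.exists_newton_bounds finrank_pdSpace
    (fun v hv => by
      refine h.eq_zero_of_linResidual (Δ := ofProd v) ?_
      rw [← hJl]
      exact hv)
  have h0 : P.residual (P.active₀ x) (ofProd (P.primalDual x y l₀ l₁).toProd) = 0 :=
    h.residual_eq_zero
  rw [h0] at h3 h4
  refine ⟨C, hC, r, hr, fun w hw => ?_⟩
  rw [← mem_ball_iff_norm] at hw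
  refine ⟨fun Δ => ?_, fun b => ?_, ?_, ?_, fun w' Δ hw' hΔ => ?_⟩
  · rw [← hJl]
    exact h1 _ hw _
  · obtain ⟨v, hv⟩ := h2 _ hw b
    exact ⟨ofProd v, by rw [← hJl]; exact hv⟩
  · have := h3 _ hw
    rw [sub_zero] at this
    exact this
  · have := h4 _ hw
    rw [sub_zero] at this
    exact this
  · rw [← mem_ball_iff_norm] at hw'
    have := h5 _ hw _ hw'
    rw [← hΔ, hJl] at this
    exact this

theorem hess_smul (w : PDPoint n₀ n₁ m₀ m₁) (t : ℝ) (d : Tri n₀ n₁) :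
    P.hess w (t • d) (t • d) = t ^ 2 * P.hess w d d := by
  simp only [hess, Prod.smul_fst, Prod.smul_snd, map_smul, smul_apply,
    inner_smul_right, smul_eq_mul]
  ring

/-- The primal-dual direction `(x, y, x, 0)` with zero multipliers. -/
def diagPD (n₀ n₁ m₀ m₁ : ℕ) : Vec n₀ × Vec n₁ →L[ℝ] PDSpace n₀ n₁ m₀ m₁ :=
  (ContinuousLinearMap.inl ℝ _ _).comp ((ContinuousLinearMap.fst ℝ _ _).prod
    ((ContinuousLinearMap.snd ℝ _ _).prod ((ContinuousLinearMap.fst ℝ _ _).prod 0)))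

/-- The penalty vanishes at w* exactly on the common kernel of the active gradients. This kernel
lies in the critical cone, where SOSC gives positivity, so `eventually_nonneg_add_penalty` applies.
-/
theorem IsRegularSolution.exists_penalty (h : P.IsRegularSolution x y l₀ l₁) :
    ∃ M : ℝ, 0 < M ∧ ∀ᶠ e in 𝓝 (P.primalDual x y l₀ l₁).toProd, ∀ v : Vec n₀ × Vec n₁,
      0 ≤ P.hess (ofProd e) (diagTri n₀ n₁ v) (diagTri n₀ n₁ v)
        + M * (∑ i with P.c₀ x i = 0, fderiv ℝ P.c₀ (ofProd e).x v.1 i ^ 2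
          + ∑ j with P.c₁ (y, x) j = 0,
            fderiv ℝ P.c₁ ((ofProd e).y, (ofProd e).xt) (v.2, v.1) j ^ 2) := by
  obtain ⟨J, hJ, hJl⟩ := h.smoothAt.exists_hasLipDeriv_residual (P.active₀ x)
  -- The Hessian and both constraint derivatives are read off as components of `J`, so their joint
  -- continuity in point and direction needs no separate proof.
  have hcont : ∀ v : Vec n₀ × Vec n₁, ContinuousAt (fun z : PDSpace n₀ n₁ m₀ m₁ × (Vec n₀ × Vec n₁)
      => J z.1 (diagPD n₀ n₁ m₀ m₁ z.2)) ((P.primalDual x y l₀ l₁).toProd, v) := fun v =>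
    ContinuousAt.clm_apply (ContinuousAt.comp (f := Prod.fst) (g := J)
      hJ.lipNear.continuousAt continuousAt_fst)
      ((diagPD n₀ n₁ m₀ m₁).continuous.comp continuous_snd).continuousAt
  have hJd : ∀ (e : PDSpace n₀ n₁ m₀ m₁) v, J e (diagPD n₀ n₁ m₀ m₁ v)
      = P.linResidual (P.active₀ x) (ofProd e) (ofProd (diagPD n₀ n₁ m₀ m₁ v)) := fun e v =>
    hJl (ofProd e) (ofProd (diagPD n₀ n₁ m₀ m₁ v))
  have e1 : ∀ (e : PDSpace n₀ n₁ m₀ m₁) v, (J e (diagPD n₀ n₁ m₀ m₁ v)).1 (diagTri n₀ n₁ v)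
      = P.hess (ofProd e) (diagTri n₀ n₁ v) (diagTri n₀ n₁ v) := fun e v => by
    rw [hJd, linResidual, linStat_apply]
    simp [ofProd, diagPD, tri]
  have e2 : ∀ (e : PDSpace n₀ n₁ m₀ m₁) v, (J e (diagPD n₀ n₁ m₀ m₁ v)).2.2.1
      = fderiv ℝ P.c₀ (ofProd e).x v.1 := fun e v => by
    rw [hJd, linResidual]
    simp [ofProd, diagPD]
  have e3 : ∀ (e : PDSpace n₀ n₁ m₀ m₁) v, (J e (diagPD n₀ n₁ m₀ m₁ v)).2.2.2.2.1
      = fderiv ℝ P.c₁ ((ofProd e).y, (ofProd e).xt) (v.2, v.1) := fun e v => by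
    rw [hJd, linResidual]
    simp [ofProd, diagPD]
  refine eventually_nonneg_add_penalty
    (h := fun e v => P.hess (ofProd e) (diagTri n₀ n₁ v) (diagTri n₀ n₁ v))
    (q := fun e v => ∑ i with P.c₀ x i = 0, fderiv ℝ P.c₀ (ofProd e).x v.1 i ^ 2
      + ∑ j with P.c₁ (y, x) j = 0,
        fderiv ℝ P.c₁ ((ofProd e).y, (ofProd e).xt) (v.2, v.1) j ^ 2) ?_ ?_ ?_ ?_ ?_ ?_
  · intro v
    simp only [← e1]
    exact (continuousAt_fst.comp (hcont v)).clm_apply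
      ((diagTri n₀ n₁).continuous.comp continuous_snd).continuousAt
  · intro v
    simp only [← e2, ← e3]
    have hc := hcont v
    set G := fun z : PDSpace n₀ n₁ m₀ m₁ × (Vec n₀ × Vec n₁) => J z.1 (diagPD n₀ n₁ m₀ m₁ z.2)
    have hcomp : Continuous fun b : Residual n₀ n₁ m₀ m₁ =>
        ∑ i with P.c₀ x i = 0, b.2.2.1 i ^ 2 + ∑ j with P.c₁ (y, x) j = 0, b.2.2.2.2.1 j ^ 2 := by
      fun_prop
    exact hcomp.continuousAt.comp hc
  · intro b t v
    simp only [map_smul, hess_smul]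
  · intro b t v
    have : (t • v.2, t • v.1) = t • (v.2, v.1) := rfl
    simp only [Prod.smul_fst, Prod.smul_snd, this, map_smul, PiLp.smul_apply, smul_eq_mul, mul_pow,
      ← Finset.mul_sum, ← mul_add]
  · intro b v
    positivity
  · intro v hv hq
    obtain ⟨h1, h2⟩ := (add_eq_zero_iff_of_nonneg (by positivity) (by positivity)).1 hq
    rw [Finset.sum_eq_zero_iff_of_nonneg fun _ _ => sq_nonneg _] at h1 h2
    simp only [Finset.mem_filter, Finset.mem_univ, true_and, sq_eq_zero_iff] at h1 h2
    obtain ⟨g', g'', hg, -, hg''⟩ := h.exists_hasSecondFDerivAt_undecompLag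
    have h3 := h.secondOrder v ⟨fun i hi => ?_, fun i hi _ => ?_, fun j hj => ?_, fun j hj _ => ?_⟩ hv
    · rw [hg.fderiv_fderiv, hg''] at h3
      exact h3
    · rw [h.dcon₀_apply]; exact (h1 i hi).le
    · rw [h.dcon₀_apply]; exact h1 i hi
    · rw [h.dcon₁_apply]; exact (h2 j hj).le
    · rw [h.dcon₁_apply]; exact h2 j hj

end Solution

end TwoStage

/-! ### The quadratic program and the Newton equation. -/

namespace TwoStage

open PDPoint

variable {n₀ n₁ m₀ m₁ : ℕ} {P : TwoStage n₀ n₁ m₀ m₁}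

/-- The right-hand side `μ e` of the perturbed complementarity equations. -/
def muRes (n₀ n₁ m₀ m₁ : ℕ) (μ : ℝ) : Residual n₀ n₁ m₀ m₁ := (0, 0, 0, fun _ => μ, 0, 0)

theorem IsC2At.fderiv_barrier {w : PDPoint n₀ n₁ m₀ m₁} (hw : P.IsC2At w)
    (hs : ∀ j, 0 < w.s₁ j) (μ : ℝ) (h : Primal n₀ n₁ m₁) :
    fderiv ℝ (P.barrier μ) w.z h = fderiv ℝ P.f₀ w.x h.1
      + fderiv ℝ P.f₁ (w.y, w.xt) (h.2.1, h.2.2.1) - μ * ∑ j, h.2.2.2 j / w.s₁ j := by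
  have h1 : HasFDerivAt (fun z : Primal n₀ n₁ m₁ => P.f₀ (triCLM z).1)
      ((fderiv ℝ P.f₀ w.x).comp ((ContinuousLinearMap.fst ℝ _ _).comp triCLM)) w.z :=
    HasFDerivAt.comp w.z (g := P.f₀) (f := ((ContinuousLinearMap.fst ℝ _ _).comp triCLM))
      (hw.f₀.differentiableAt (by simp)).hasFDerivAt (ContinuousLinearMap.hasFDerivAt _)
  have h2 : HasFDerivAt (fun z : Primal n₀ n₁ m₁ => P.f₁ (triCLM z).2)
      ((fderiv ℝ P.f₁ (w.y, w.xt)).comp ((ContinuousLinearMap.snd ℝ _ _).comp triCLM)) w.z :=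
    HasFDerivAt.comp w.z (g := P.f₁) (f := ((ContinuousLinearMap.snd ℝ _ _).comp triCLM))
      (hw.f₁.differentiableAt (by simp)).hasFDerivAt (ContinuousLinearMap.hasFDerivAt _)
  let S : Primal n₀ n₁ m₁ →L[ℝ] Vec m₁ := (ContinuousLinearMap.snd ℝ _ _).comp
    ((ContinuousLinearMap.snd ℝ _ _).comp (ContinuousLinearMap.snd ℝ _ _))
  have h3 : HasFDerivAt (fun z : Primal n₀ n₁ m₁ => ∑ j, Real.log (z.2.2.2 j))
      (∑ j, ((EuclideanSpace.proj (𝕜 := ℝ) j).comp S w.z)⁻¹ •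
        ((EuclideanSpace.proj (𝕜 := ℝ) j).comp S)) w.z :=
    HasFDerivAt.fun_sum fun j _ => HasFDerivAt.log (x := w.z)
      (ContinuousLinearMap.hasFDerivAt ((EuclideanSpace.proj (𝕜 := ℝ) j).comp S)) (hs j).ne'
  have h4 : HasFDerivAt (P.barrier μ) _ w.z := (h1.add h2).sub (h3.const_mul μ)
  rw [h4.fderiv]
  simp [S, z, div_eq_inv_mul]

theorem IsC2At.fderiv_fderiv_lag {w : PDPoint n₀ n₁ m₀ m₁} (hw : P.IsC2At w)
    (d h : Primal n₀ n₁ m₁) :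
    fderiv ℝ (fderiv ℝ (fun z => P.lag z w.lam₀ w.lam₁ w.eta)) w.z d h
      = P.hess w (triCLM d) (triCLM h) := by
  obtain ⟨g', g'', hg, -, h2⟩ := hw.exists_hasSecondFDerivAt_lag
  rw [hg.fderiv_fderiv, h2]

theorem IsC2At.hess_comm {w : PDPoint n₀ n₁ m₀ m₁} (hw : P.IsC2At w) (d h : Tri n₀ n₁) :
    P.hess w d h = P.hess w h d := by
  obtain ⟨g', g'', hg, -, h2⟩ := hw.exists_hasSecondFDerivAt_lag
  have := hg.symm (d.1, d.2.1, d.2.2, 0) (h.1, h.2.1, h.2.2, 0)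
  rw [h2, h2] at this
  exact this

/-- The stationarity condition of the quadratic program in terms of the linearized system. -/
theorem IsC2At.qp_stationarity_eq {w : PDPoint n₀ n₁ m₀ m₁} (hw : P.IsC2At w)
    (hs : ∀ j, 0 < w.s₁ j) (μ : ℝ) (d h : Primal n₀ n₁ m₁) (l₀ : Vec m₀) (l₁ : Vec m₁)
    (eta : Vec n₀) :
    fderiv ℝ (P.barrier μ) w.z h
      + fderiv ℝ (fderiv ℝ (fun z => P.lag z w.lam₀ w.lam₁ w.eta)) w.z d h
      + ∑ j, w.lam₁ j / w.s₁ j * d.2.2.2 j * h.2.2.2 j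
      + ⟪l₀, fderiv ℝ P.c₀ w.x h.1⟫_ℝ
      + ⟪l₁, fderiv ℝ P.c₁ (w.y, w.xt) (h.2.1, h.2.2.1) + h.2.2.2⟫_ℝ
      + ⟪eta, h.2.2.1 - h.1⟫_ℝ
    = P.stat w (triCLM h) + P.linStat w (P.stepOf w d l₀ l₁ eta) (triCLM h)
      + ∑ j, h.2.2.2 j / w.s₁ j * (w.s₁ j * l₁ j + d.2.2.2 j * w.lam₁ j - μ) := by
  have hsum : ∑ j, h.2.2.2 j / w.s₁ j * (w.s₁ j * l₁ j + d.2.2.2 j * w.lam₁ j - μ)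
      = ⟪l₁, h.2.2.2⟫_ℝ + ∑ j, w.lam₁ j / w.s₁ j * d.2.2.2 j * h.2.2.2 j
        - μ * ∑ j, h.2.2.2 j / w.s₁ j := by
    rw [PiLp.inner_apply, Finset.mul_sum, ← Finset.sum_add_distrib, ← Finset.sum_sub_distrib]
    refine Finset.sum_congr rfl fun j _ => ?_
    have := (hs j).ne'
    simp only [RCLike.inner_apply, conj_trivial]
    field_simp
  rw [hw.fderiv_barrier hs, hw.fderiv_fderiv_lag, hsum, stat_apply, linStat_apply,
    inner_add_right]
  simp only [stepOf, tri, triCLM_apply, inner_sub_left]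
  ring

theorem stepOf_eq {w Δ : PDPoint n₀ n₁ m₀ m₁} (h : P.lin₀ w Δ.z = -(w.s₀ + Δ.s₀)) :
    P.stepOf w Δ.z (w.lam₀ + Δ.lam₀) (w.lam₁ + Δ.lam₁) (w.eta + Δ.eta) = Δ := by
  rw [stepOf, h]
  simp [z]

/-- The step given by a solution of the quadratic program solves the linearized optimality system,
up to the activity of the master constraints. -/
theorem IsQPSolution.linResidual_eq {w : PDPoint n₀ n₁ m₀ m₁} (hw : P.IsC2At w)
    (hs : ∀ j, 0 < w.s₁ j) {μ : ℝ} {d : Primal n₀ n₁ m₁} {l₀ : Vec m₀} {l₁ : Vec m₁}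
    {eta : Vec n₀} (h : P.IsQPSolution w μ d l₀ l₁ eta) (I : Set (Fin m₀)) :
    P.linResidual I w (P.stepOf w d l₀ l₁ eta)
      = muRes n₀ n₁ m₀ m₁ μ - P.residual I w + (0, activity I (-P.lin₀ w d, l₀), 0, 0, 0, 0) := by
  obtain ⟨-, hcon, hcopy⟩ := h.feasible
  have hst := h.stationary
  simp only [hw.qp_stationarity_eq hs] at hst
  simp only [linResidual, residual, muRes, Prod.mk_sub_mk, Prod.mk_add_mk, Prod.mk.injEq]
  refine ⟨?_, ?_, ?_, ?_, ?_, ?_⟩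
  · refine ContinuousLinearMap.ext fun t => ?_
    have := hst (t.1, t.2.1, t.2.2, 0)
    simp only [triCLM_apply, PiLp.zero_apply, zero_div, zero_mul, Finset.sum_const_zero,
      add_zero] at this
    simp only [sub_apply, zero_apply, add_zero]
    linarith
  · rw [zero_sub, neg_add_eq_sub, ← map_sub]
    rfl
  · simp only [stepOf, lin₀]
    abel
  · ext j
    -- A unit variation of one slack isolates the j-th linearized complementarity equation, up to
    -- the factor 1/`s₁ j`.
    have := hst (0, 0, 0, EuclideanSpace.single j 1)
    simp only [triCLM_apply, Prod.mk_zero_zero, map_zero, zero_add] at this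
    rw [Finset.sum_eq_single j (fun k _ hk => by simp [hk]) (by simp)] at this
    have hj := (hs j).ne'
    simp only [PiLp.single_eq_same] at this
    have h2 := (mul_eq_zero.1 this).resolve_left (by positivity)
    simp only [stepOf, Pi.add_apply, hadamard_apply, PiLp.sub_apply, Pi.sub_apply, Pi.zero_apply]
    linarith
  · rw [zero_sub, add_zero, eq_neg_iff_add_eq_zero]
    exact hcon
  · rw [zero_sub, add_zero, eq_neg_iff_add_eq_zero]
    exact hcopy

/-- Close to zero, the first-order cost of moving off an active constraint with multiplier `l`
outweighs a quadratic penalty. -/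
theorem half_mul_sq_le_of_abs_le {M a l : ℝ} (hM : 0 < M) (ha : a ≤ 0) (hal : |a| ≤ 2 * l / M) :
    M / 2 * a ^ 2 ≤ -(l * a) := by
  rw [abs_of_nonpos ha, le_div_iff₀ hM] at hal
  nlinarith

/-- A solution of the linearized optimality system with the right signs is a solution of the
quadratic program, provided that the penalized Hessian is nonnegative. -/
theorem IsC2At.isQPSolution {w : PDPoint n₀ n₁ m₀ m₁} (hw : P.IsC2At w)
    (hs : ∀ j, 0 < w.s₁ j) (hl : ∀ j, 0 < w.lam₁ j) {μ : ℝ} {Δ : PDPoint n₀ n₁ m₀ m₁}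
    {A₀ : Finset (Fin m₀)} {A₁ : Finset (Fin m₁)}
    (hΔ : P.linResidual A₀ w Δ = muRes n₀ n₁ m₀ m₁ μ - P.residual A₀ w)
    (hact : ∀ i ∈ A₀, 0 < w.lam₀ i + Δ.lam₀ i) (hinact : ∀ i ∉ A₀, 0 ≤ w.s₀ i + Δ.s₀ i)
    {M : ℝ} (hM : 0 < M) (hA₁ : ∀ j ∈ A₁, M ≤ w.lam₁ j / w.s₁ j)
    (hpen : ∀ v : Vec n₀ × Vec n₁, 0 ≤ P.hess w (diagTri n₀ n₁ v) (diagTri n₀ n₁ v)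
        + M * (∑ i ∈ A₀, fderiv ℝ P.c₀ w.x v.1 i ^ 2
          + ∑ j ∈ A₁, fderiv ℝ P.c₁ (w.y, w.xt) (v.2, v.1) j ^ 2)) :
    P.IsQPSolution w μ Δ.z (w.lam₀ + Δ.lam₀) (w.lam₁ + Δ.lam₁) (w.eta + Δ.eta) ∧
      P.stepOf w Δ.z (w.lam₀ + Δ.lam₀) (w.lam₁ + Δ.lam₁) (w.eta + Δ.eta) = Δ := by
  simp only [linResidual, residual, muRes, Prod.mk_sub_mk, Prod.mk.injEq] at hΔ
  obtain ⟨h1, h2, h3, h4, h5, h6⟩ := hΔ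
  have hlin : P.lin₀ w Δ.z = -(w.s₀ + Δ.s₀) := by
    rw [zero_sub, eq_neg_iff_add_eq_zero] at h3
    rw [eq_neg_iff_add_eq_zero, ← h3, lin₀]
    simp only [z]
    abel
  have hlin' : ∀ i, P.lin₀ w Δ.z i = -(w.s₀ i + Δ.s₀ i) := fun i => congrArg (· i) hlin
  have hs₀ : ∀ i ∈ A₀, w.s₀ i + Δ.s₀ i = 0 := fun i hi => by
    have := congrFun h2 i
    rw [Pi.sub_apply, activity_mem (by simpa using hi), activity_mem (by simpa using hi),
      Pi.zero_apply] at this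
    simp only at this
    linarith
  have hl₀ : ∀ i ∉ A₀, w.lam₀ i + Δ.lam₀ i = 0 := fun i hi => by
    have := congrFun h2 i
    rw [Pi.sub_apply, activity_notMem (by simpa using hi), activity_notMem (by simpa using hi),
      Pi.zero_apply] at this
    simp only at this
    linarith
  have hstep := stepOf_eq hlin
  have hfeas : Δ.z ∈ P.qpFeasible w := by
    refine ⟨fun i => ?_, ?_, ?_⟩
    · rw [hlin']
      by_cases hi : i ∈ A₀
      · rw [hs₀ i hi, neg_zero]
      · linarith [hinact i hi]
    · rw [zero_sub, eq_neg_iff_add_eq_zero] at h5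
      exact h5
    · rw [zero_sub, eq_neg_iff_add_eq_zero] at h6
      exact h6
  have hstat : ∀ h : Primal n₀ n₁ m₁, _ := fun h => hw.qp_stationarity_eq hs μ Δ.z h
    (w.lam₀ + Δ.lam₀) (w.lam₁ + Δ.lam₁) (w.eta + Δ.eta)
  rw [hstep] at hstat
  have hzero : ∀ h : Primal n₀ n₁ m₁, P.stat w (triCLM h) + P.linStat w Δ (triCLM h)
      + ∑ j, h.2.2.2 j / w.s₁ j * (w.s₁ j * (w.lam₁ + Δ.lam₁) j + Δ.z.2.2.2 j * w.lam₁ j - μ)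
      = 0 := fun h => by
    rw [h1, Finset.sum_eq_zero]
    · simp
    · intro j _
      have := congrFun h4 j
      simp only [Pi.add_apply, Pi.sub_apply, hadamard_apply] at this
      simp only [PiLp.add_apply, z]
      rw [show w.s₁ j * (w.lam₁ j + Δ.lam₁ j) + Δ.s₁ j * w.lam₁ j - μ = 0 by linarith, mul_zero]
  simp only [hzero] at hstat
  refine ⟨⟨hfeas, ?_, ?_, ?_, hstat⟩, hstep⟩
  -- The neighbourhood is chosen so that `half_mul_sq_le_of_abs_le` applies to each active master
  -- constraint.
  · have hev : ∀ᶠ d' in 𝓝 Δ.z, ∀ i ∈ A₀, |fderiv ℝ P.c₀ w.x (d' - Δ.z).1 i|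
        < 2 * (w.lam₀ i + Δ.lam₀ i) / M := by
      rw [Filter.eventually_all_finset]
      intro i hi
      have hc : Continuous fun d' : Primal n₀ n₁ m₁ => |fderiv ℝ P.c₀ w.x (d' - Δ.z).1 i| := by
        fun_prop
      refine hc.continuousAt.eventually_lt_const ?_
      have := hact i hi
      simp only [sub_self, Prod.fst_zero, map_zero, PiLp.zero_apply, abs_zero]
      positivity
    filter_upwards [mem_nhdsWithin_of_mem_nhds hev, self_mem_nhdsWithin] with d' hd' hfeas'
    obtain ⟨h, rfl⟩ : ∃ h, d' = Δ.z + h := ⟨d' - Δ.z, by abel⟩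
    simp only [add_sub_cancel_left] at hd'
    have hxt : h.2.2.1 = h.1 := by
      have e1 := hfeas.2.2
      have e2 := hfeas'.2.2
      simp only [Prod.snd_add, Prod.fst_add] at e2
      have : h.2.2.1 - h.1 = (Δ.z.2.2.1 + h.2.2.1 - (Δ.z.1 + h.1) + (w.xt - w.x))
        - (Δ.z.2.2.1 - Δ.z.1 + (w.xt - w.x)) := by abel
      rw [e1, e2, sub_zero] at this
      exact sub_eq_zero.1 this
    have hsd : h.2.2.2 = -fderiv ℝ P.c₁ (w.y, w.xt) (h.2.1, h.1) := by
      have e1 := hfeas.2.1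
      have e2 := hfeas'.2.1
      simp only [Prod.snd_add, Prod.fst_add] at e2
      have e3 : (Δ.z.2.1 + h.2.1, Δ.z.2.2.1 + h.2.2.1)
        = (Δ.z.2.1, Δ.z.2.2.1) + (h.2.1, h.1) := by rw [hxt]; rfl
      rw [e3, map_add] at e2
      rw [eq_neg_iff_add_eq_zero]
      have := congrArg₂ (· - ·) e2 e1
      simp only [sub_self] at this
      rw [← this]
      abel
    -- The difference `h` of two feasible points satisfies the homogeneous equality constraints, so
    -- λ₁ and η drop out.
    have hst := hstat h
    rw [hxt, sub_self, inner_zero_right, add_zero, hsd, add_neg_cancel, inner_zero_right,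
      add_zero] at hst
    have hlinh : ∀ i ∈ A₀, fderiv ℝ P.c₀ w.x h.1 i ≤ 0 := fun i hi => by
      have e1 := hfeas'.1 i
      have e2 : P.lin₀ w (Δ.z + h) i = P.lin₀ w Δ.z i + fderiv ℝ P.c₀ w.x h.1 i := by
        simp only [lin₀, Prod.fst_add, map_add, PiLp.add_apply]
        ring
      rw [e2, hlin', hs₀ i hi, neg_zero, zero_add] at e1
      exact e1
    have hinner : ⟪w.lam₀ + Δ.lam₀, fderiv ℝ P.c₀ w.x h.1⟫_ℝ
        ≤ -(M / 2 * ∑ i ∈ A₀, fderiv ℝ P.c₀ w.x h.1 i ^ 2) := by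
      rw [PiLp.inner_apply, ← Finset.sum_subset (Finset.subset_univ A₀), Finset.mul_sum,
        ← Finset.sum_neg_distrib]
      · refine Finset.sum_le_sum fun i hi => ?_
        have := half_mul_sq_le_of_abs_le hM (hlinh i hi) (hd' i hi).le
        simp only [RCLike.inner_apply, conj_trivial, PiLp.add_apply]
        linarith
      · intro i _ hi
        simp [hl₀ i hi]
    -- The barrier curvature λ₁/s₁ supplies the penalty on the active subproblem constraints, since
    -- there the slack change is minus the linearized constraint.
    have hslack : M * ∑ j ∈ A₁, fderiv ℝ P.c₁ (w.y, w.xt) (h.2.1, h.1) j ^ 2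
        ≤ ∑ j, w.lam₁ j / w.s₁ j * h.2.2.2 j ^ 2 := by
      rw [Finset.mul_sum]
      refine (Finset.sum_le_sum fun j hj => ?_).trans
        (Finset.sum_le_sum_of_subset_of_nonneg (Finset.subset_univ A₁) fun j _ _ => ?_)
      · rw [hsd, PiLp.neg_apply, neg_sq]
        exact mul_le_mul_of_nonneg_right (hA₁ j hj) (sq_nonneg _)
      · have := hs j
        have := hl j
        positivity
    have hp := hpen (h.1, h.2.1)
    have htri : triCLM h = diagTri n₀ n₁ (h.1, h.2.1) := by simp [hxt]
    have hquad : ∑ j, w.lam₁ j / w.s₁ j * (Δ.z.2.2.2 j + h.2.2.2 j) ^ 2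
        = ∑ j, w.lam₁ j / w.s₁ j * Δ.z.2.2.2 j ^ 2
          + 2 * ∑ j, w.lam₁ j / w.s₁ j * Δ.z.2.2.2 j * h.2.2.2 j
          + ∑ j, w.lam₁ j / w.s₁ j * h.2.2.2 j ^ 2 := by
      rw [Finset.mul_sum, ← Finset.sum_add_distrib, ← Finset.sum_add_distrib]
      exact Finset.sum_congr rfl fun j _ => by ring
    simp only [qpObjective, map_add, add_apply, hw.fderiv_fderiv_lag, Prod.snd_add,
      PiLp.add_apply, hquad]
    rw [hw.hess_comm (triCLM h) (triCLM Δ.z)]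
    rw [hw.fderiv_fderiv_lag, ← hsd] at hst
    rw [← htri] at hp
    simp only at hp
    -- By stationarity the change of the objective is -⟪λ₀⁺, ∇c₀ᵀh⟫ plus half the quadratic form at
    -- `h`. The multiplier term and the slack term together dominate half the penalty, so `hp` makes
    -- the change nonnegative.
    linarith
  · intro i
    by_cases hi : i ∈ A₀
    · exact (hact i hi).le
    · exact (hl₀ i hi).ge
  · intro i
    rw [hlin', PiLp.add_apply]
    by_cases hi : i ∈ A₀
    · rw [hs₀ i hi]; simp
    · rw [hl₀ i hi, zero_mul]

end TwoStage

/-! ### Comparison of norms and optimality measures. -/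

theorem Vec.abs_apply_le_norm {m : ℕ} (a : Vec m) (i : Fin m) : |a i| ≤ ‖a‖ :=
  PiLp.norm_apply_le a i

namespace PDPoint

variable {n₀ n₁ m₀ m₁ : ℕ}

theorem edist_nonneg (w w' : PDPoint n₀ n₁ m₀ m₁) : 0 ≤ w.edist w' := Real.sqrt_nonneg _

theorem norm_toProd_sub_le_edist (w w' : PDPoint n₀ n₁ m₀ m₁) :
    ‖w.toProd - w'.toProd‖ ≤ w.edist w' := by
  simp only [toProd, z, Prod.mk_sub_mk, Prod.norm_mk, sup_le_iff, edist]
  have h1 := sq_nonneg ‖w.x - w'.x‖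
  have h2 := sq_nonneg ‖w.lam₀ - w'.lam₀‖
  have h3 := sq_nonneg ‖w.s₀ - w'.s₀‖
  have h4 := sq_nonneg ‖w.y - w'.y‖
  have h5 := sq_nonneg ‖w.xt - w'.xt‖
  have h6 := sq_nonneg ‖w.s₁ - w'.s₁‖
  have h7 := sq_nonneg ‖w.lam₁ - w'.lam₁‖
  have h8 := sq_nonneg ‖w.eta - w'.eta‖
  refine ⟨⟨?_, ?_, ?_, ?_⟩, ?_, ?_, ?_, ?_⟩ <;> exact Real.le_sqrt_of_sq_le (by linarith)

theorem coord_norm_le (Δ : PDPoint n₀ n₁ m₀ m₁) :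
    (‖Δ.x‖ ≤ ‖Δ.toProd‖ ∧ ‖Δ.y‖ ≤ ‖Δ.toProd‖ ∧ ‖Δ.xt‖ ≤ ‖Δ.toProd‖ ∧ ‖Δ.s₁‖ ≤ ‖Δ.toProd‖) ∧
      ‖Δ.lam₀‖ ≤ ‖Δ.toProd‖ ∧ ‖Δ.s₀‖ ≤ ‖Δ.toProd‖ ∧ ‖Δ.lam₁‖ ≤ ‖Δ.toProd‖ ∧
        ‖Δ.eta‖ ≤ ‖Δ.toProd‖ := by
  have h := le_refl ‖Δ.toProd‖
  nth_rw 1 [toProd, z] at h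
  simpa only [Prod.norm_mk, sup_le_iff] using h

theorem coord_sub_norm_le (w w' : PDPoint n₀ n₁ m₀ m₁) :
    (‖w.x - w'.x‖ ≤ ‖w.toProd - w'.toProd‖ ∧ ‖w.y - w'.y‖ ≤ ‖w.toProd - w'.toProd‖ ∧
      ‖w.xt - w'.xt‖ ≤ ‖w.toProd - w'.toProd‖ ∧ ‖w.s₁ - w'.s₁‖ ≤ ‖w.toProd - w'.toProd‖) ∧
      ‖w.lam₀ - w'.lam₀‖ ≤ ‖w.toProd - w'.toProd‖ ∧ ‖w.s₀ - w'.s₀‖ ≤ ‖w.toProd - w'.toProd‖ ∧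
        ‖w.lam₁ - w'.lam₁‖ ≤ ‖w.toProd - w'.toProd‖ ∧ ‖w.eta - w'.eta‖ ≤ ‖w.toProd - w'.toProd‖ :=
  coord_norm_le (ofProd (w.toProd - w'.toProd))

/-- A point has eight blocks, and √8 ≤ 3. -/
theorem edist_le_norm_toProd_sub (w w' : PDPoint n₀ n₁ m₀ m₁) :
    w.edist w' ≤ 3 * ‖w.toProd - w'.toProd‖ := by
  obtain ⟨⟨h1, h2, h3, h4⟩, h5, h6, h7, h8⟩ := coord_sub_norm_le w w'
  set r := ‖w.toProd - w'.toProd‖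
  have hr : 0 ≤ r := norm_nonneg _
  refine Real.sqrt_le_iff.2 ⟨by positivity, ?_⟩
  have hsq : ∀ {a : ℝ}, 0 ≤ a → a ≤ r → a ^ 2 ≤ r ^ 2 := fun ha h => pow_le_pow_left₀ ha h 2
  have := hsq (norm_nonneg _) h1
  have := hsq (norm_nonneg _) h2
  have := hsq (norm_nonneg _) h3
  have := hsq (norm_nonneg _) h4
  have := hsq (norm_nonneg _) h5
  have := hsq (norm_nonneg _) h6
  have := hsq (norm_nonneg _) h7
  have := hsq (norm_nonneg _) h8
  have := sq_nonneg r
  rw [mul_pow]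
  linarith

end PDPoint

namespace TwoStage

open PDPoint

variable {n₀ n₁ m₀ m₁ : ℕ} {P : TwoStage n₀ n₁ m₀ m₁}

theorem norm_muRes_le (μ : ℝ) : ‖muRes n₀ n₁ m₀ m₁ μ‖ ≤ |μ| := by
  simp only [muRes, Prod.norm_mk, norm_zero]
  simp only [sup_le_iff, abs_nonneg, true_and, and_true]
  exact (pi_norm_const_le μ)

/-- This is the degenerate case in which μ cannot be bounded by the distance to the solution, but
does not occur in the system either. -/
theorem norm_muRes_eq_zero (hm : m₁ = 0) (μ : ℝ) : ‖muRes n₀ n₁ m₀ m₁ μ‖ = 0 := by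
  subst hm
  have : (fun _ => μ : Fin 0 → ℝ) = 0 := Subsingleton.elim _ _
  rw [muRes, this, norm_eq_zero]
  rfl

theorem IsC2At.norm_grad_le {w : PDPoint n₀ n₁ m₀ m₁} (hw : P.IsC2At w) :
    ‖P.gradX w‖ ≤ ‖P.stat w‖ ∧ ‖P.gradY w‖ ≤ ‖P.stat w‖ ∧ ‖P.gradXt w‖ ≤ ‖P.stat w‖ := by
  have key : ∀ {V : Type} [NormedAddCommGroup V] [InnerProductSpace ℝ V] (g : V)
      (t : Tri n₀ n₁), ⟪g, g⟫_ℝ = P.stat w t → ‖t‖ ≤ ‖g‖ → ‖g‖ ≤ ‖P.stat w‖ := by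
    intro V _ _ g t h1 h2
    rcases eq_or_ne g 0 with rfl | hg
    · simp
    · refine le_of_mul_le_mul_right ?_ (norm_pos_iff.2 hg)
      rw [← real_inner_self_eq_norm_mul_norm, h1]
      exact ((le_abs_self _).trans ((P.stat w).le_opNorm t)).trans (by gcongr)
  refine ⟨key _ (P.gradX w, 0, 0) (hw.gradX_inner _) ?_,
    key _ (0, P.gradY w, 0) (hw.gradY_inner _) ?_,
    key _ (0, 0, P.gradXt w) (hw.gradXt_inner _) ?_⟩ <;> simp [Prod.norm_mk]

theorem IsC2At.norm_stat_le {w : PDPoint n₀ n₁ m₀ m₁} (hw : P.IsC2At w) :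
    ‖P.stat w‖ ≤ ‖P.gradX w‖ + ‖P.gradY w‖ + ‖P.gradXt w‖ := by
  refine ContinuousLinearMap.opNorm_le_bound _ (by positivity) fun t => ?_
  have ht : t = (t.1, 0, 0) + (0, t.2.1, 0) + (0, 0, t.2.2) := by simp
  have h1 : P.stat w t = ⟪P.gradX w, t.1⟫_ℝ + ⟪P.gradY w, t.2.1⟫_ℝ + ⟪P.gradXt w, t.2.2⟫_ℝ := by
    rw [hw.gradX_inner, hw.gradY_inner, hw.gradXt_inner, ← map_add, ← map_add, ← ht]
  rw [h1, add_mul, add_mul]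
  have n1 : ‖t.1‖ ≤ ‖t‖ := norm_fst_le t
  have n2 : ‖t.2.1‖ ≤ ‖t‖ := (norm_fst_le t.2).trans (norm_snd_le t)
  have n3 : ‖t.2.2‖ ≤ ‖t‖ := (norm_snd_le t.2).trans (norm_snd_le t)
  refine (norm_add₃_le).trans ?_
  gcongr
  · exact (norm_inner_le_norm _ _).trans (by gcongr)
  · exact (norm_inner_le_norm _ _).trans (by gcongr)
  · exact (norm_inner_le_norm _ _).trans (by gcongr)

/-- The master complementarity measure reduces to the activity residual when the small one of
`s₀` and `lam₀` is dominated by the other. -/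
theorem sum_ncp_eq {w : PDPoint n₀ n₁ m₀ m₁} {I : Set (Fin m₀)}
    (hI : ∀ i ∈ I, |w.s₀ i| ≤ w.lam₀ i) (hI' : ∀ i ∉ I, |w.lam₀ i| ≤ w.s₀ i) :
    ∑ i, (max (min (w.s₀ i) (w.lam₀ i)) (max (-w.s₀ i) (-w.lam₀ i))) ^ 2
      = ∑ i, activity I (w.s₀, w.lam₀) i ^ 2 := by
  have key : ∀ a b : ℝ, |a| ≤ b → max (min a b) (max (-a) (-b)) = |a| := fun a b hab => by
    have h1 : a ≤ b := (le_abs_self a).trans hab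
    have h2 : -b ≤ -a := neg_le_neg h1
    rw [min_eq_left h1, max_eq_left h2]
    rfl
  refine Finset.sum_congr rfl fun i _ => ?_
  by_cases hi : i ∈ I
  · rw [activity_mem hi, key _ _ (hI i hi), sq_abs]
  · rw [activity_notMem hi, min_comm, max_comm (-w.s₀ i), key _ _ (hI' i hi), sq_abs]

/-- θ² collects six squared norms and m₀ + m₁ squared scalars, each at most the squared sup norm of
the perturbed residual. -/
theorem IsC2At.theta_le {w : PDPoint n₀ n₁ m₀ m₁} (hw : P.IsC2At w) {I : Set (Fin m₀)}
    (hI : ∀ i ∈ I, |w.s₀ i| ≤ w.lam₀ i) (hI' : ∀ i ∉ I, |w.lam₀ i| ≤ w.s₀ i) (μ : ℝ) :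
    P.theta w μ ≤ (6 + m₀ + m₁) * ‖P.residual I w - muRes n₀ n₁ m₀ m₁ μ‖ := by
  set r := ‖P.residual I w - muRes n₀ n₁ m₀ m₁ μ‖ with hr
  have hr0 : 0 ≤ r := norm_nonneg _
  have h := le_refl r
  nth_rw 1 [hr] at h
  simp only [residual, muRes, Prod.mk_sub_mk, Prod.norm_mk, sup_le_iff, sub_zero] at h
  obtain ⟨h1, h2, h3, h4, h5, h6⟩ := h
  have hsq : ∀ {a : ℝ}, 0 ≤ a → a ≤ r → a ^ 2 ≤ r ^ 2 := fun ha h => pow_le_pow_left₀ ha h 2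
  obtain ⟨g1, g2, g3⟩ := hw.norm_grad_le
  have := hsq (norm_nonneg _) (g1.trans h1)
  have := hsq (norm_nonneg _) (g2.trans h1)
  have := hsq (norm_nonneg _) (g3.trans h1)
  have := hsq (norm_nonneg _) h3
  have := hsq (norm_nonneg _) h5
  have := hsq (norm_nonneg _) h6
  have e1 : ∑ i, activity I (w.s₀, w.lam₀) i ^ 2 ≤ m₀ * r ^ 2 := by
    refine (Finset.sum_le_card_nsmul _ _ (r ^ 2) fun i _ => ?_).trans (by simp)
    rw [← sq_abs]
    exact hsq (abs_nonneg _) ((norm_le_pi_norm _ i).trans h2)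
  have e2 : ∑ j, (w.s₁ j * w.lam₁ j - μ) ^ 2 ≤ m₁ * r ^ 2 := by
    refine (Finset.sum_le_card_nsmul _ _ (r ^ 2) fun j _ => ?_).trans (by simp)
    rw [← sq_abs]
    exact hsq (abs_nonneg _) ((norm_le_pi_norm _ j).trans h4)
  refine Real.sqrt_le_iff.2 ⟨by positivity, ?_⟩
  rw [masterSq, subSq, sum_ncp_eq hI hI', mul_pow]
  have e3 : ((6 : ℝ) + m₀ + m₁) * r ^ 2 ≤ (6 + m₀ + m₁) ^ 2 * r ^ 2 := by
    refine mul_le_mul_of_nonneg_right ?_ (sq_nonneg r)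
    have : (0 : ℝ) ≤ m₀ := by positivity
    have : (0 : ℝ) ≤ m₁ := by positivity
    nlinarith
  linarith

/-- The factor 3 comes from the stationarity functional, which is bounded by the sum of its three
partial gradients. -/
theorem IsC2At.norm_residual_le {w : PDPoint n₀ n₁ m₀ m₁} (hw : P.IsC2At w) {I : Set (Fin m₀)}
    (hI : ∀ i ∈ I, |w.s₀ i| ≤ w.lam₀ i) (hI' : ∀ i ∉ I, |w.lam₀ i| ≤ w.s₀ i) (μ : ℝ) :
    ‖P.residual I w - muRes n₀ n₁ m₀ m₁ μ‖ ≤ 3 * P.theta w μ := by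
  have h0 : 0 ≤ P.theta w μ := Real.sqrt_nonneg _
  have hsum₀ : ∀ i, activity I (w.s₀, w.lam₀) i ^ 2 ≤ ∑ i, activity I (w.s₀, w.lam₀) i ^ 2 :=
    fun i => Finset.single_le_sum (f := fun i => activity I (w.s₀, w.lam₀) i ^ 2)
      (fun i _ => sq_nonneg _) (Finset.mem_univ i)
  have hsum₁ : ∀ j, (w.s₁ j * w.lam₁ j - μ) ^ 2 ≤ ∑ j, (w.s₁ j * w.lam₁ j - μ) ^ 2 :=
    fun j => Finset.single_le_sum (f := fun j => (w.s₁ j * w.lam₁ j - μ) ^ 2)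
      (fun j _ => sq_nonneg _) (Finset.mem_univ j)
  have p1 : 0 ≤ ∑ i, activity I (w.s₀, w.lam₀) i ^ 2 := Finset.sum_nonneg fun i _ => sq_nonneg _
  have p2 : 0 ≤ ∑ j, (w.s₁ j * w.lam₁ j - μ) ^ 2 := Finset.sum_nonneg fun j _ => sq_nonneg _
  have q1 := sq_nonneg ‖P.gradX w‖
  have q2 := sq_nonneg ‖P.gradY w‖
  have q3 := sq_nonneg ‖P.gradXt w‖
  have q4 := sq_nonneg ‖P.c₀ w.x + w.s₀‖
  have q5 := sq_nonneg ‖P.c₁ (w.y, w.xt) + w.s₁‖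
  have q6 := sq_nonneg ‖w.xt - w.x‖
  have key : ∀ a : ℝ, a ^ 2 ≤ P.masterSq w + P.subSq w μ → a ≤ P.theta w μ := fun a ha =>
    Real.le_sqrt_of_sq_le ha
  simp only [masterSq, subSq, sum_ncp_eq hI hI'] at key
  have k : ∀ a, a ≤ P.theta w μ → a ≤ 3 * P.theta w μ := fun a ha => by linarith
  simp only [residual, muRes, Prod.mk_sub_mk, Prod.norm_mk, sup_le_iff, sub_zero]
  refine ⟨?_, ?_, ?_, ?_, ?_, ?_⟩
  · have := key ‖P.gradX w‖ (by linarith)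
    have := key ‖P.gradY w‖ (by linarith)
    have := key ‖P.gradXt w‖ (by linarith)
    have := hw.norm_stat_le
    linarith
  · refine k _ ((pi_norm_le_iff_of_nonneg h0).2 fun i => key _ ?_)
    rw [Real.norm_eq_abs, sq_abs]
    linarith [hsum₀ i]
  · exact k _ (key _ (by linarith))
  · refine k _ ((pi_norm_le_iff_of_nonneg h0).2 fun j => key _ ?_)
    rw [Real.norm_eq_abs, sq_abs]
    have := hsum₁ j
    simp only [Pi.sub_apply, hadamard_apply]
    linarith
  · exact k _ (key _ (by linarith))
  · exact k _ (key _ (by linarith))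

end TwoStage

/-! ### The smoothing parameter and the fraction-to-the-boundary rule. -/

theorem eventually_mul_lt (K : ℝ) {c : ℝ} (hc : 0 < c) : ∀ᶠ μ in 𝓝[>] (0 : ℝ), K * μ < c := by
  have : ContinuousAt (fun μ : ℝ => K * μ) 0 := by fun_prop
  exact (this.eventually_lt_const (by simpa using hc)).filter_mono nhdsWithin_le_nhds

namespace AlgConsts.Valid

variable {k : AlgConsts}

theorem nextMu_pos (hk : k.Valid) {μ : ℝ} (hμ : 0 < μ) : 0 < k.nextMu μ :=
  lt_min (mul_pos hk.cmu₁_pos hμ) (Real.rpow_pos_of_pos hμ _)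

theorem nextMu_le (hk : k.Valid) {μ : ℝ} (hμ : 0 < μ) : k.nextMu μ ≤ μ :=
  (min_le_left _ _).trans (mul_le_of_le_one_left hμ.le hk.cmu₁_lt.le)

/-- The vanishing factor μ^(cmu₂ - 1) is what makes the barrier perturbation superlinearly small. -/
theorem nextMu_le_rpow {μ : ℝ} (hμ : 0 < μ) : k.nextMu μ ≤ μ ^ (k.cmu₂ - 1) * μ := by
  refine (min_le_right _ _).trans_eq ?_
  rw [← Real.rpow_add_one hμ.ne', sub_add_cancel]

/-- Quadratic errors are negligible against the new parameter: μ² is o(μ) and, because `cmu₂ < 2`,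
also o(μ^cmu₂). -/
theorem eventually_sq_le_nextMu (hk : k.Valid) (A : ℝ) :
    ∀ᶠ μ in 𝓝[>] (0 : ℝ), A * μ ^ 2 ≤ k.nextMu μ := by
  have h1 : Tendsto (fun μ : ℝ => A * μ ^ (2 - k.cmu₂)) (𝓝 0) (𝓝 (A * 0 ^ (2 - k.cmu₂))) :=
    ((Real.continuous_rpow_const (by linarith [hk.cmu₂_lt])).tendsto 0).const_mul A
  rw [Real.zero_rpow (by linarith [hk.cmu₂_lt]), mul_zero] at h1
  filter_upwards [eventually_mul_lt A hk.cmu₁_pos, self_mem_nhdsWithin,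
    (h1.eventually (ge_mem_nhds one_pos)).filter_mono nhdsWithin_le_nhds] with μ h2 hμ h3
  have hμ' : 0 < μ := hμ
  refine le_min ?_ ?_
  · rw [pow_two, ← mul_assoc]
    exact mul_le_mul_of_nonneg_right h2.le hμ'.le
  · have e : μ ^ 2 = μ ^ (2 - k.cmu₂) * μ ^ k.cmu₂ := by
      rw [← Real.rpow_add hμ', sub_add_cancel, Real.rpow_two]
    rw [e, ← mul_assoc]
    exact mul_le_of_le_one_left (Real.rpow_nonneg hμ'.le _) h3

end AlgConsts.Valid

/-- The fraction-to-the-boundary rule admits a full Newton step of the complementarity equation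
`a b = μ` if `a` is small and `b` is not. -/
theorem full_step_of_complementarity {a b da db B κ δ μ : ℝ} (ha : 0 < a) (hb : 0 < b)
    (h : a * db + da * b = μ - a * b) (haδ : a ≤ δ) (hdb : |db| ≤ δ)
    (hκ : κ / 2 ≤ b) (hB : b ≤ B) (hμ : 0 < μ) (hμ' : μ ≤ 1 / 2) (hδμ : δ ^ 2 ≤ μ / 2)
    (hδB : δ * B ≤ 1 / 2) (hδκ : δ ≤ κ / 4) : μ * a ≤ a + da ∧ μ * b ≤ b + db := by
  have hδ : 0 < δ := ha.trans_le haδ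
  obtain ⟨hdb1, hdb2⟩ := abs_le.1 hdb
  constructor
  · refine le_of_mul_le_mul_left ?_ hb
    have h1 : a * db ≤ δ ^ 2 := by
      calc a * db ≤ a * δ := mul_le_mul_of_nonneg_left hdb2 ha.le
        _ ≤ δ * δ := mul_le_mul_of_nonneg_right haδ hδ.le
        _ = δ ^ 2 := by ring
    have h2 : a * b ≤ 1 / 2 := (mul_le_mul haδ hB hb.le hδ.le).trans hδB
    have h3 : μ * (a * b) ≤ μ * (1 / 2) := mul_le_mul_of_nonneg_left h2 hμ.le
    linarith
  · have h1 : μ * b ≤ 1 / 2 * b := mul_le_mul_of_nonneg_right hμ' hb.le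
    linarith

/-! ### Uniform constants near the solution. -/

namespace TwoStage

open PDPoint

variable {n₀ n₁ m₀ m₁ : ℕ} {P : TwoStage n₀ n₁ m₀ m₁}

/-- The factor at μ = 1 is kept instead of being bounded by one, so that the superlinear estimate
also covers the case without subproblem constraints. -/
theorem norm_muRes (μ : ℝ) :
    ‖muRes n₀ n₁ m₀ m₁ μ‖ = |μ| * ‖muRes n₀ n₁ m₀ m₁ 1‖ := by
  have : muRes n₀ n₁ m₀ m₁ μ = μ • muRes n₀ n₁ m₀ m₁ 1 := by
    simp only [muRes, Prod.smul_mk, smul_zero]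
    congr
    ext
    simp
  rw [this, norm_smul, Real.norm_eq_abs]

variable (P) in
/-- Quantitative information on the optimality system near the primal-dual point of a regular
solution: a bound `C`, a margin `κ` of strict complementarity, a penalty parameter `M` and a
radius `r`. -/
structure LocalBounds (x : Vec n₀) (y : Vec n₁) (l₀ : Vec m₀) (l₁ : Vec m₁)
    (C κ M r : ℝ) : Prop where
  one_le : 1 ≤ C
  κ_pos : 0 < κ
  M_pos : 0 < M
  r_pos : 0 < r
  r_le : r ≤ κ / 4
  M_r_le : M * r ≤ κ / 2
  margin₀ : ∀ i, P.c₀ x i = 0 → κ ≤ l₀ i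
  margin₀' : ∀ i, P.c₀ x i ≠ 0 → κ ≤ -P.c₀ x i
  margin₁ : ∀ j, P.c₁ (y, x) j = 0 → κ ≤ l₁ j
  margin₁' : ∀ j, P.c₁ (y, x) j ≠ 0 → κ ≤ -P.c₁ (y, x) j
  compl₀ : ∀ i, P.c₀ x i ≠ 0 → l₀ i = 0
  compl₁ : ∀ j, P.c₁ (y, x) j ≠ 0 → l₁ j = 0
  isC2At : ∀ w : PDPoint n₀ n₁ m₀ m₁, ‖w.toProd - (P.primalDual x y l₀ l₁).toProd‖ < r →
    P.IsC2At w
  penalty : ∀ w : PDPoint n₀ n₁ m₀ m₁, ‖w.toProd - (P.primalDual x y l₀ l₁).toProd‖ < r →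
    ∀ v : Vec n₀ × Vec n₁, 0 ≤ P.hess w (diagTri n₀ n₁ v) (diagTri n₀ n₁ v)
        + M * (∑ i with P.c₀ x i = 0, fderiv ℝ P.c₀ w.x v.1 i ^ 2
          + ∑ j with P.c₁ (y, x) j = 0, fderiv ℝ P.c₁ (w.y, w.xt) (v.2, v.1) j ^ 2)
  norm_fderiv_le : ∀ w : PDPoint n₀ n₁ m₀ m₁,
    ‖w.toProd - (P.primalDual x y l₀ l₁).toProd‖ < r → ‖fderiv ℝ P.c₀ w.x‖ ≤ C
  norm_con_sub_le : ∀ w : PDPoint n₀ n₁ m₀ m₁, ‖w.toProd - (P.primalDual x y l₀ l₁).toProd‖ < r →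
    ‖P.c₀ w.x - P.c₀ x‖ ≤ C * ‖w.toProd - (P.primalDual x y l₀ l₁).toProd‖
  norm_s₁_le : ∀ w : PDPoint n₀ n₁ m₀ m₁, ‖w.toProd - (P.primalDual x y l₀ l₁).toProd‖ < r →
    ‖w.s₁‖ ≤ C
  norm_lam₁_le : ∀ w : PDPoint n₀ n₁ m₀ m₁, ‖w.toProd - (P.primalDual x y l₀ l₁).toProd‖ < r →
    ‖w.lam₁‖ ≤ C
  norm_step_le : ∀ w : PDPoint n₀ n₁ m₀ m₁, ‖w.toProd - (P.primalDual x y l₀ l₁).toProd‖ < r →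
    ∀ Δ, ‖Δ.toProd‖ ≤ C * ‖P.linResidual (P.active₀ x) w Δ‖
  exists_step : ∀ w : PDPoint n₀ n₁ m₀ m₁, ‖w.toProd - (P.primalDual x y l₀ l₁).toProd‖ < r →
    ∀ b, ∃ Δ, P.linResidual (P.active₀ x) w Δ = b
  error_le : ∀ w : PDPoint n₀ n₁ m₀ m₁, ‖w.toProd - (P.primalDual x y l₀ l₁).toProd‖ < r →
    ‖w.toProd - (P.primalDual x y l₀ l₁).toProd‖ ≤ C * ‖P.residual (P.active₀ x) w‖
  residual_le : ∀ w : PDPoint n₀ n₁ m₀ m₁, ‖w.toProd - (P.primalDual x y l₀ l₁).toProd‖ < r →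
    ‖P.residual (P.active₀ x) w‖ ≤ C * ‖w.toProd - (P.primalDual x y l₀ l₁).toProd‖
  quadratic : ∀ w w' Δ : PDPoint n₀ n₁ m₀ m₁,
    ‖w.toProd - (P.primalDual x y l₀ l₁).toProd‖ < r →
    ‖w'.toProd - (P.primalDual x y l₀ l₁).toProd‖ < r → Δ.toProd = w'.toProd - w.toProd →
    ‖P.residual (P.active₀ x) w' - P.residual (P.active₀ x) w
      - P.linResidual (P.active₀ x) w Δ‖ ≤ C * ‖Δ.toProd‖ ^ 2

section Solution

variable {x : Vec n₀} {y : Vec n₁} {l₀ : Vec m₀} {l₁ : Vec m₁}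

theorem exists_pos_le_of_forall_pos {m : ℕ} (a : Fin m → ℝ) (ha : ∀ i, 0 < a i) :
    ∃ κ : ℝ, 0 < κ ∧ ∀ i, κ ≤ a i := by
  rcases isEmpty_or_nonempty (Fin m) with h | h
  · exact ⟨1, one_pos, fun i => h.elim i⟩
  · obtain ⟨i, hi⟩ := Finite.exists_min a
    exact ⟨a i, ha i, hi⟩

theorem IsRegularSolution.exists_localBounds (h : P.IsRegularSolution x y l₀ l₁) :
    ∃ C κ M r : ℝ, P.LocalBounds x y l₀ l₁ C κ M r := by
  obtain ⟨κ₀, hκ₀, h₀⟩ := exists_pos_le_of_forall_pos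
    (fun i => if P.c₀ x i = 0 then l₀ i else -P.c₀ x i) fun i => by
      split_ifs with hi
      · exact h.strictCompl.1 i hi
      · exact neg_pos.2 (lt_of_le_of_ne (h.kkt.feasible.1 i) hi)
  obtain ⟨κ₁, hκ₁, h₁⟩ := exists_pos_le_of_forall_pos
    (fun j => if P.c₁ (y, x) j = 0 then l₁ j else -P.c₁ (y, x) j) fun j => by
      split_ifs with hj
      · exact h.strictCompl.2 j hj
      · exact neg_pos.2 (lt_of_le_of_ne (h.kkt.feasible.2 j) hj)
  obtain ⟨C, hC, r₁, hr₁, hN⟩ := h.exists_newton_bounds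
  obtain ⟨M, hM, hpen⟩ := h.exists_penalty
  obtain ⟨K, hK, r₂, hr₂, hK', hK'', -⟩ := h.smooth_c₀.hasLipDeriv.exists_quadratic_bound
  obtain ⟨r₃, hr₃, hr₃'⟩ := Metric.eventually_nhds_iff_ball.1 (hpen.and h.smoothAt.isC2At.eventually)
  set ws := P.primalDual x y l₀ l₁ with hws
  set D := ‖fderiv ℝ P.c₀ x‖ with hD
  set κ := min κ₀ κ₁ with hκ
  have hκpos : 0 < κ := lt_min hκ₀ hκ₁
  -- The bound κ/4 preserves the separation of active slacks from their multipliers, and κ/(2M)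
  -- makes λ₁/s₁ exceed the penalty parameter on active subproblem constraints.
  set r := min 1 (min r₁ (min r₂ (min r₃ (min (κ / 4) (κ / 2 / M))))) with hr
  have hrpos : 0 < r := by positivity
  have e0 : r ≤ 1 := min_le_left _ _
  have e1 : r ≤ r₁ := (min_le_right _ _).trans (min_le_left _ _)
  have e2 : r ≤ r₂ := (min_le_right _ _).trans ((min_le_right _ _).trans (min_le_left _ _))
  have e3 : r ≤ r₃ := (min_le_right _ _).trans ((min_le_right _ _).trans
    ((min_le_right _ _).trans (min_le_left _ _)))
  have e4 : r ≤ κ / 4 := (min_le_right _ _).trans ((min_le_right _ _).trans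
    ((min_le_right _ _).trans ((min_le_right _ _).trans (min_le_left _ _))))
  have e5 : r ≤ κ / 2 / M := (min_le_right _ _).trans ((min_le_right _ _).trans
    ((min_le_right _ _).trans ((min_le_right _ _).trans (min_le_right _ _))))
  have hpos1 : 0 ≤ ‖ws.s₁‖ := norm_nonneg _
  have hpos2 : 0 ≤ ‖ws.lam₁‖ := norm_nonneg _
  have hpos3 : 0 ≤ D := norm_nonneg _
  set B := C + K + (D + K) + (‖ws.s₁‖ + ‖ws.lam₁‖ + 1) with hB
  have hCB : C ≤ B := by linarith
  have hx : ∀ w : PDPoint n₀ n₁ m₀ m₁, ‖w.x - x‖ ≤ ‖w.toProd - ws.toProd‖ := fun w =>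
    (coord_sub_norm_le w ws).1.1
  have hxball : ∀ w : PDPoint n₀ n₁ m₀ m₁, ‖w.toProd - ws.toProd‖ < r →
      w.x ∈ Metric.ball x r₂ := fun w hw => by
    rw [mem_ball_iff_norm]
    exact (hx w).trans_lt (hw.trans_le e2)
  refine ⟨B, κ, M, r, ?_⟩
  exact
    { one_le := by linarith
      κ_pos := hκpos
      M_pos := hM
      r_pos := hrpos
      r_le := e4
      M_r_le := by
        rw [le_div_iff₀ hM] at e5
        linarith
      margin₀ := fun i hi => by
        have := h₀ i
        simp only [hi, if_true] at this
        exact (min_le_left _ _).trans this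
      margin₀' := fun i hi => by
        have := h₀ i
        simp only [hi, if_false] at this
        exact (min_le_left _ _).trans this
      margin₁ := fun i hi => by
        have := h₁ i
        simp only [hi, if_true] at this
        exact (min_le_right _ _).trans this
      margin₁' := fun i hi => by
        have := h₁ i
        simp only [hi, if_false] at this
        exact (min_le_right _ _).trans this
      compl₀ := fun i hi => h.mult₀_eq_zero hi
      compl₁ := fun j hj => h.mult₁_eq_zero hj
      isC2At := fun w hw => (hr₃' w.toProd (mem_ball_iff_norm.2 (hw.trans_le e3))).2
      penalty := fun w hw => (hr₃' w.toProd (mem_ball_iff_norm.2 (hw.trans_le e3))).1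
      norm_fderiv_le := fun w hw => by
        have h1 := hK' _ (hxball w hw) _ (Metric.mem_ball_self hr₂)
        have h2 := norm_le_norm_add_norm_sub' (fderiv ℝ P.c₀ w.x) (fderiv ℝ P.c₀ x)
        have h3 : K * ‖w.x - x‖ ≤ K * 1 :=
          mul_le_mul_of_nonneg_left ((hx w).trans (hw.le.trans e0)) hK.le
        linarith
      norm_con_sub_le := fun w hw => by
        refine (hK'' _ (hxball w hw) _ (Metric.mem_ball_self hr₂)).trans ?_
        exact mul_le_mul (by linarith) (hx w) (norm_nonneg _) (by linarith)
      norm_s₁_le := fun w hw => by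
        have h1 := (coord_sub_norm_le w ws).1.2.2.2
        have h2 := norm_le_norm_add_norm_sub' w.s₁ ws.s₁
        linarith
      norm_lam₁_le := fun w hw => by
        have h1 := (coord_sub_norm_le w ws).2.2.2.1
        have h2 := norm_le_norm_add_norm_sub' w.lam₁ ws.lam₁
        linarith
      norm_step_le := fun w hw Δ => ((hN w (hw.trans_le e1)).1 Δ).trans
        (mul_le_mul_of_nonneg_right hCB (norm_nonneg _))
      exists_step := fun w hw => (hN w (hw.trans_le e1)).2.1
      error_le := fun w hw => (hN w (hw.trans_le e1)).2.2.1.trans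
        (mul_le_mul_of_nonneg_right hCB (norm_nonneg _))
      residual_le := fun w hw => (hN w (hw.trans_le e1)).2.2.2.1.trans
        (mul_le_mul_of_nonneg_right hCB (norm_nonneg _))
      quadratic := fun w w' Δ hw hw' hΔ =>
        ((hN w (hw.trans_le e1)).2.2.2.2 w' Δ (hw'.trans_le e1) hΔ).trans
          (mul_le_mul_of_nonneg_right hCB (sq_nonneg _)) }

end Solution

end TwoStage

/-! ### Active-set identification and full steps. -/

namespace TwoStage

open PDPoint

variable {n₀ n₁ m₀ m₁ : ℕ} {P : TwoStage n₀ n₁ m₀ m₁}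
  {x : Vec n₀} {y : Vec n₁} {l₀ : Vec m₀} {l₁ : Vec m₁} {C κ M r : ℝ}

/-- Coordinates of points near the primal-dual solution. -/
theorem coord_bounds {w : PDPoint n₀ n₁ m₀ m₁} {δ : ℝ}
    (hw : ‖w.toProd - (P.primalDual x y l₀ l₁).toProd‖ ≤ δ) :
    (∀ i, |w.lam₀ i - l₀ i| ≤ δ) ∧ (∀ i, |w.s₀ i + P.c₀ x i| ≤ δ) ∧
      (∀ j, |w.lam₁ j - l₁ j| ≤ δ) ∧ (∀ j, |w.s₁ j + P.c₁ (y, x) j| ≤ δ) := by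
  obtain ⟨⟨-, -, -, h1⟩, h2, h3, h4, -⟩ := coord_sub_norm_le w (P.primalDual x y l₀ l₁)
  refine ⟨fun i => ?_, fun i => ?_, fun j => ?_, fun j => ?_⟩
  · exact (Vec.abs_apply_le_norm (w.lam₀ - l₀) i).trans (h2.trans hw)
  · have := (Vec.abs_apply_le_norm (w.s₀ - -P.c₀ x) i).trans (h3.trans hw)
    simpa using this
  · exact (Vec.abs_apply_le_norm (w.lam₁ - l₁) j).trans (h4.trans hw)
  · have := (Vec.abs_apply_le_norm (w.s₁ - -P.c₁ (y, x)) j).trans (h1.trans hw)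
    simpa using this

namespace LocalBounds

/-- One member of each pair (s₀, λ₀) is at least κ at w* and the other is zero, and a perturbation
of at most κ/4 cannot reverse their order. -/
theorem activity_dominated (hb : P.LocalBounds x y l₀ l₁ C κ M r) {w : PDPoint n₀ n₁ m₀ m₁}
    (hw : ‖w.toProd - (P.primalDual x y l₀ l₁).toProd‖ < r) :
    (∀ i ∈ P.active₀ x, |w.s₀ i| ≤ w.lam₀ i) ∧ ∀ i ∉ P.active₀ x, |w.lam₀ i| ≤ w.s₀ i := by
  obtain ⟨h1, h2, -, -⟩ := coord_bounds hw.le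
  have hr := hb.r_le
  have hκ := hb.κ_pos
  refine ⟨fun i hi => ?_, fun i hi => ?_⟩
  · have hi' : P.c₀ x i = 0 := hi
    have e1 := (abs_le.1 (h1 i)).1
    have e2 := h2 i
    rw [hi', add_zero] at e2
    have := hb.margin₀ i hi
    linarith
  · have e1 := h1 i
    have e2 := (abs_le.1 (h2 i)).1
    rw [hb.compl₀ i hi, sub_zero] at e1
    have := hb.margin₀' i hi
    linarith

/-- Near the solution, a small solution of the quadratic program solves the linearized optimality
system with the active set of the solution. -/
theorem exists_qp_radius (hb : P.LocalBounds x y l₀ l₁ C κ M r) :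
    ∃ ρ : ℝ, 0 < ρ ∧ ∃ r₁ : ℝ, 0 < r₁ ∧ r₁ ≤ r ∧ ∃ μ₁ : ℝ, 0 < μ₁ ∧
      ∀ w : PDPoint n₀ n₁ m₀ m₁, ‖w.toProd - (P.primalDual x y l₀ l₁).toProd‖ < r₁ →
        (∀ j, 0 < w.s₁ j) → ∀ μ, 0 < μ → μ ≤ μ₁ → ∀ d l₀' l₁' eta,
          P.IsQPSolution w μ d l₀' l₁' eta → ‖d‖ ≤ ρ →
          P.linResidual (P.active₀ x) w (P.stepOf w d l₀' l₁' eta)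
            = muRes n₀ n₁ m₀ m₁ μ - P.residual (P.active₀ x) w := by
  have hC := hb.one_le
  have hC0 : 0 < C := one_pos.trans_le hC
  have hκ := hb.κ_pos
  have hr := hb.r_pos
  have hrκ := hb.r_le
  have hCC : C ≤ C * C := le_mul_of_one_le_left hC0.le hC
  -- This one constant serves as ρ, as a bound on the radius and as the bound on μ, chosen so that
  -- C²a = κ/16.
  set a := κ / 16 / (C * C) with ha
  have ha0 : 0 < a := by positivity
  have haC : C * (C * a) = κ / 16 := by rw [ha]; field_simp
  have haC1 : C * a ≤ κ / 16 := by
    rw [← haC]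
    exact le_mul_of_one_le_left (by positivity) hC
  have haC2 : a ≤ κ / 16 := (le_mul_of_one_le_left ha0.le hC).trans haC1
  refine ⟨a, ha0, min r a, lt_min hr ha0, min_le_left _ _, a, ha0, ?_⟩
  intro w hw hs μ hμ hμa d l₀' l₁' eta hqp hd
  have hwr : ‖w.toProd - (P.primalDual x y l₀ l₁).toProd‖ < r := hw.trans_le (min_le_left _ _)
  have hwa : ‖w.toProd - (P.primalDual x y l₀ l₁).toProd‖ < a := hw.trans_le (min_le_right _ _)
  have hlin := hqp.linResidual_eq (hb.isC2At w hwr) hs (P.active₀ x)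
  set Δ := P.stepOf w d l₀' l₁' eta with hΔ
  have hclose : ∀ i, |P.lin₀ w d i - P.c₀ x i| ≤ 2 * (C * a) := fun i => by
    have h1 : P.lin₀ w d i - P.c₀ x i = (P.c₀ w.x - P.c₀ x + fderiv ℝ P.c₀ w.x d.1) i := by
      simp only [lin₀, PiLp.add_apply, PiLp.sub_apply]
      ring
    rw [h1]
    refine (Vec.abs_apply_le_norm _ i).trans ((norm_add_le _ _).trans ?_)
    have h2 : ‖P.c₀ w.x - P.c₀ x‖ ≤ C * a :=
      (hb.norm_con_sub_le w hwr).trans (mul_le_mul_of_nonneg_left hwa.le hC0.le)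
    have h3 : ‖fderiv ℝ P.c₀ w.x d.1‖ ≤ C * a :=
      ((fderiv ℝ P.c₀ w.x).le_opNorm _).trans
        (mul_le_mul (hb.norm_fderiv_le w hwr) ((norm_fst_le d).trans hd) (norm_nonneg _) hC0.le)
    linarith
  -- The linearized constraint stays within 2Ca ≤ κ/8 of c₀(x*) ≤ -κ, so it is inactive and
  -- complementarity removes its multiplier.
  have hinact : ∀ i ∉ P.active₀ x, l₀' i = 0 := fun i hi => by
    have h1 := (abs_le.1 (hclose i)).2
    have h2 := hb.margin₀' i hi
    refine (mul_eq_zero.1 (hqp.compl i)).resolve_right (ne_of_lt ?_)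
    linarith
  have hact_norm : ‖activity (P.active₀ x) (-P.lin₀ w d, l₀')‖ ≤ 2 * (C * a) := by
    refine (pi_norm_le_iff_of_nonneg (by positivity)).2 fun i => ?_
    by_cases hi : i ∈ P.active₀ x
    · have h1 := hclose i
      have hi' : P.c₀ x i = 0 := hi
      rw [hi', sub_zero] at h1
      rw [activity_mem hi]
      simpa using h1
    · rw [activity_notMem hi, hinact i hi, norm_zero]
      positivity
  -- The bound on d alone says nothing about the multipliers. They are controlled through the
  -- inverse of the linearized system, whose right-hand side is at most a + Ca + 2Ca ≤ 4Ca.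
  have hΔnorm : ‖Δ.toProd‖ ≤ 4 * (κ / 16) := by
    refine (hb.norm_step_le w hwr Δ).trans ?_
    have h1 : ‖P.linResidual (P.active₀ x) w Δ‖ ≤ 4 * (C * a) := by
      rw [hlin]
      have h2 := (norm_muRes_le (n₀ := n₀) (n₁ := n₁) (m₀ := m₀) (m₁ := m₁) μ)
      rw [abs_of_pos hμ] at h2
      have h3 : ‖P.residual (P.active₀ x) w‖ ≤ C * a :=
        (hb.residual_le w hwr).trans (mul_le_mul_of_nonneg_left hwa.le hC0.le)
      have h4 : ‖((0, activity (P.active₀ x) (-P.lin₀ w d, l₀'), 0, 0, 0, 0) :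
          Residual n₀ n₁ m₀ m₁)‖ ≤ 2 * (C * a) := by
        simp only [Prod.norm_mk, norm_zero, sup_le_iff]
        exact ⟨by positivity, hact_norm, by positivity, by positivity, by positivity,
          by positivity⟩
      have h5 : a ≤ C * a := le_mul_of_one_le_left ha0.le hC
      refine (norm_add_le _ _).trans ?_
      have h6 := norm_sub_le (muRes n₀ n₁ m₀ m₁ μ) (P.residual (P.active₀ x) w)
      linarith
    calc C * ‖P.linResidual (P.active₀ x) w Δ‖ ≤ C * (4 * (C * a)) :=
          mul_le_mul_of_nonneg_left h1 hC0.le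
      _ = 4 * (C * (C * a)) := by ring
      _ = 4 * (κ / 16) := by rw [haC]
  -- A change of at most κ/4 keeps active multipliers positive, so complementarity forces equality
  -- in the linearized constraints and the correction term disappears.
  have hact : activity (P.active₀ x) (-P.lin₀ w d, l₀') = 0 := by
    ext i
    by_cases hi : i ∈ P.active₀ x
    · rw [activity_mem hi]
      have h1 := (abs_le.1 ((coord_bounds hwa.le).1 i)).1
      have h2 := hb.margin₀ i hi
      have h3 := (abs_le.1 ((Vec.abs_apply_le_norm Δ.lam₀ i).trans
        ((coord_norm_le Δ).2.1.trans hΔnorm))).1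
      have h4 : Δ.lam₀ i = l₀' i - w.lam₀ i := rfl
      have h5 : l₀' i ≠ 0 := by
        refine ne_of_gt ?_
        linarith
      have h6 := (mul_eq_zero.1 (hqp.compl i)).resolve_left h5
      simp [h6]
    · rw [activity_notMem hi]
      exact hinact i hi
  rw [hlin, hact]
  simp only [Prod.mk_zero_zero, add_zero]

/-- A small solution of the linearized optimality system is a solution of the quadratic program. -/
theorem isQPSolution (hb : P.LocalBounds x y l₀ l₁ C κ M r) {w Δ : PDPoint n₀ n₁ m₀ m₁}
    (hw : ‖w.toProd - (P.primalDual x y l₀ l₁).toProd‖ < r)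
    (hs : ∀ j, 0 < w.s₁ j) (hl : ∀ j, 0 < w.lam₁ j) {μ : ℝ}
    (hΔ : P.linResidual (P.active₀ x) w Δ
      = muRes n₀ n₁ m₀ m₁ μ - P.residual (P.active₀ x) w) (hΔκ : ‖Δ.toProd‖ ≤ κ / 4) :
    P.IsQPSolution w μ Δ.z (w.lam₀ + Δ.lam₀) (w.lam₁ + Δ.lam₁) (w.eta + Δ.eta) ∧
      P.stepOf w Δ.z (w.lam₀ + Δ.lam₀) (w.lam₁ + Δ.lam₁) (w.eta + Δ.eta) = Δ := by
  have hset : P.active₀ x = ((Finset.univ.filter fun i => P.c₀ x i = 0 : Finset (Fin m₀)) :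
      Set (Fin m₀)) := by
    ext i
    simp [active₀]
  obtain ⟨h1, h2, h3, h4⟩ := coord_bounds hw.le
  have hκ := hb.κ_pos
  have hr := hb.r_le
  have hMr := hb.M_r_le
  obtain ⟨-, g1, g2, -, -⟩ := coord_norm_le Δ
  rw [hset] at hΔ
  refine (hb.isC2At w hw).isQPSolution hs hl hΔ (fun i hi => ?_) (fun i hi => ?_) hb.M_pos
    (fun j hj => ?_) (hb.penalty w hw)
  · have hi' : P.c₀ x i = 0 := by simpa using hi
    have e1 := (abs_le.1 (h1 i)).1
    have e2 := (abs_le.1 ((Vec.abs_apply_le_norm Δ.lam₀ i).trans (g1.trans hΔκ))).1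
    have := hb.margin₀ i hi'
    linarith
  · have hi' : P.c₀ x i ≠ 0 := by simpa using hi
    have e1 := (abs_le.1 (h2 i)).1
    have e2 := (abs_le.1 ((Vec.abs_apply_le_norm Δ.s₀ i).trans (g2.trans hΔκ))).1
    have := hb.margin₀' i hi'
    linarith
  -- On active indices λ₁ ≥ 3κ/4 and M s₁ ≤ M r ≤ κ/2.
  · have hj' : P.c₁ (y, x) j = 0 := by simpa using hj
    have e1 := (abs_le.1 (h3 j)).1
    have e2 := (abs_le.1 (h4 j)).2
    rw [hj', add_zero] at e2
    have := hb.margin₁ j hj'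
    rw [le_div_iff₀ (hs j)]
    have := mul_le_mul_of_nonneg_left e2 hb.M_pos.le
    linarith

/-- Near the solution the full step satisfies the fraction-to-the-boundary rule. -/
theorem full_step (hb : P.LocalBounds x y l₀ l₁ C κ M r) {w Δ : PDPoint n₀ n₁ m₀ m₁}
    (hw : ‖w.toProd - (P.primalDual x y l₀ l₁).toProd‖ < r)
    (hs : ∀ j, 0 < w.s₁ j) (hl : ∀ j, 0 < w.lam₁ j) {μ δ : ℝ}
    (hΔ : P.linResidual (P.active₀ x) w Δ
      = muRes n₀ n₁ m₀ m₁ μ - P.residual (P.active₀ x) w)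
    (hwδ : ‖w.toProd - (P.primalDual x y l₀ l₁).toProd‖ ≤ δ) (hΔδ : ‖Δ.toProd‖ ≤ δ)
    (hμ : 0 < μ) (hμ' : μ ≤ 1 / 2) (hδμ : δ ^ 2 ≤ μ / 2) (hδC : δ * C ≤ 1 / 2)
    (hδκ : δ ≤ κ / 4) (j : Fin m₁) :
    (μ * w.s₁ j ≤ w.s₁ j + Δ.s₁ j ∧ μ * w.lam₁ j ≤ w.lam₁ j + Δ.lam₁ j) ∧
      μ / 2 ≤ (w.s₁ j + Δ.s₁ j) * (w.lam₁ j + Δ.lam₁ j) := by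
  obtain ⟨-, -, h3, h4⟩ := coord_bounds hwδ
  have hκ := hb.κ_pos
  obtain ⟨⟨-, -, -, g1⟩, -, -, g2, -⟩ := coord_norm_le Δ
  have d1 := (Vec.abs_apply_le_norm Δ.s₁ j).trans (g1.trans hΔδ)
  have d2 := (Vec.abs_apply_le_norm Δ.lam₁ j).trans (g2.trans hΔδ)
  have b1 := ((le_abs_self _).trans (Vec.abs_apply_le_norm w.s₁ j)).trans (hb.norm_s₁_le w hw)
  have b2 := ((le_abs_self _).trans (Vec.abs_apply_le_norm w.lam₁ j)).trans (hb.norm_lam₁_le w hw)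
  have hcomp : w.s₁ j * Δ.lam₁ j + Δ.s₁ j * w.lam₁ j = μ - w.s₁ j * w.lam₁ j :=
    congrFun (congrArg (fun b => b.2.2.2.1) hΔ) j
  have e3 := abs_le.1 (h3 j)
  have e4 := abs_le.1 (h4 j)
  constructor
  · by_cases hj : P.c₁ (y, x) j = 0
    · rw [hj, add_zero] at e4
      have := hb.margin₁ j hj
      exact full_step_of_complementarity (hs j) (hl j) hcomp e4.2 d2 (by linarith) b2 hμ hμ' hδμ
        hδC hδκ
    -- On inactive indices the multiplier is the small factor and the slack the large one, so their
    -- roles are exchanged.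
    · rw [hb.compl₁ j hj, sub_zero] at e3
      have := hb.margin₁' j hj
      exact (full_step_of_complementarity (hl j) (hs j) (by linarith) e3.2 d1 (by linarith) b1
        hμ hμ' hδμ hδC hδκ).symm
  -- The linear part of the new product equals μ exactly, and the remaining product of increments is
  -- at most δ² ≤ μ/2.
  · have h5 : |Δ.s₁ j * Δ.lam₁ j| ≤ δ ^ 2 := by
      rw [abs_mul, pow_two]
      exact mul_le_mul d1 d2 (abs_nonneg _) ((abs_nonneg _).trans d1)
    have h6 := (abs_le.1 h5).1
    have h7 : (w.s₁ j + Δ.s₁ j) * (w.lam₁ j + Δ.lam₁ j)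
        = w.s₁ j * w.lam₁ j + (w.s₁ j * Δ.lam₁ j + Δ.s₁ j * w.lam₁ j) + Δ.s₁ j * Δ.lam₁ j := by
      ring
    rw [h7, hcomp]
    linarith

end LocalBounds

/-- Since 1 - τ = min(τ^max, μ) ≤ μ, keeping the fraction μ of each variable suffices for every
τ^max. -/
theorem one_mem_ftbSet {w Δ : PDPoint n₀ n₁ m₀ m₁} {k : AlgConsts} {μ : ℝ}
    (hs : ∀ j, 0 < w.s₁ j) (hl : ∀ j, 0 < w.lam₁ j)
    (h : ∀ j, μ * w.s₁ j ≤ w.s₁ j + Δ.s₁ j ∧ μ * w.lam₁ j ≤ w.lam₁ j + Δ.lam₁ j) :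
    (1 : ℝ) ∈ w.ftbSet Δ (k.tau μ) := by
  have hτ : 1 - k.tau μ ≤ μ := by
    rw [AlgConsts.tau, sub_sub_cancel]
    exact min_le_right _ _
  refine ⟨one_pos, le_rfl, fun j => ?_, fun j => ?_⟩
  · rw [one_mul]
    exact (mul_le_mul_of_nonneg_right hτ (hs j).le).trans (h j).1
  · rw [one_mul]
    exact (mul_le_mul_of_nonneg_right hτ (hl j).le).trans (h j).2

variable (P) in
/-- The properties of the iterates in the while-loop near the solution that are preserved by a
pass through its body. -/
structure LoopInvariant (x : Vec n₀) (y : Vec n₁) (l₀ : Vec m₀) (l₁ : Vec m₁) (k : AlgConsts)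
    (r : ℝ) (w : PDPoint n₀ n₁ m₀ m₁) (μ : ℝ) : Prop where
  μ_pos : 0 < μ
  near : ‖w.toProd - (P.primalDual x y l₀ l₁).toProd‖ < r
  s₁_pos : ∀ j, 0 < w.s₁ j
  lam₁_pos : ∀ j, 0 < w.lam₁ j
  compl : ∀ j, μ / 2 ≤ w.s₁ j * w.lam₁ j
  loopCond : P.LoopCond k w μ

end TwoStage

/-! ### One pass through the loop. -/

namespace TwoStage

open PDPoint

variable {n₀ n₁ m₀ m₁ : ℕ} {P : TwoStage n₀ n₁ m₀ m₁}
  {x : Vec n₀} {y : Vec n₁} {l₀ : Vec m₀} {l₁ : Vec m₁} {C κ M r : ℝ}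

/-- With the error bound for F, the loop condition puts the iterate within O(μ) of w*. -/
theorem norm_residual_le_add {w : PDPoint n₀ n₁ m₀ m₁} (hw : P.IsC2At w) {I : Set (Fin m₀)}
    (hI : ∀ i ∈ I, |w.s₀ i| ≤ w.lam₀ i) (hI' : ∀ i ∉ I, |w.lam₀ i| ≤ w.s₀ i) {k : AlgConsts}
    {μ : ℝ} (hμ : 0 < μ) (hloop : P.LoopCond k w μ) :
    ‖P.residual I w‖ ≤ (3 * k.ctol + 1) * μ := by
  have h1 := hw.norm_residual_le hI hI' μ
  have h2 : P.theta w μ ≤ k.ctol * μ := hloop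
  have h3 := norm_le_norm_add_norm_sub' (P.residual I w) (muRes n₀ n₁ m₀ m₁ μ)
  have h4 := norm_muRes_le (n₀ := n₀) (n₁ := n₁) (m₀ := m₀) (m₁ := m₁) μ
  rw [abs_of_pos hμ] at h4
  linarith

/-- The smoothing parameter is controlled by the distance to the solution, since the slacks and
multipliers of the subproblem satisfy perturbed complementarity. -/
theorem LoopInvariant.mul_norm_muRes_le {k : AlgConsts} (hb : P.LocalBounds x y l₀ l₁ C κ M r)
    {w : PDPoint n₀ n₁ m₀ m₁} {μ : ℝ} (h : P.LoopInvariant x y l₀ l₁ k r w μ) :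
    μ * ‖muRes n₀ n₁ m₀ m₁ 1‖ ≤ 2 * C * ‖w.toProd - (P.primalDual x y l₀ l₁).toProd‖ := by
  have hC0 : 0 < C := one_pos.trans_le hb.one_le
  rcases Nat.eq_zero_or_pos m₁ with hm | hm
  · rw [norm_muRes_eq_zero hm, mul_zero]
    positivity
  · have h1 := h.compl ⟨0, hm⟩
    have h2 : w.s₁ ⟨0, hm⟩ * w.lam₁ ⟨0, hm⟩ ≤ ‖P.residual (P.active₀ x) w‖ := by
      have h3 : ‖hadamard m₁ w.s₁ w.lam₁‖ ≤ ‖P.residual (P.active₀ x) w‖ :=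
        (((norm_fst_le _).trans (norm_snd_le _)).trans (norm_snd_le _)).trans
          (norm_snd_le (P.residual (P.active₀ x) w))
      exact ((le_abs_self _).trans (norm_le_pi_norm (hadamard m₁ w.s₁ w.lam₁) ⟨0, hm⟩)).trans h3
    have h3 := hb.residual_le w h.near
    have h4 := norm_muRes_le (n₀ := n₀) (n₁ := n₁) (m₀ := m₀) (m₁ := m₁) 1
    rw [abs_one] at h4
    have h5 : μ * ‖muRes n₀ n₁ m₀ m₁ 1‖ ≤ μ * 1 := mul_le_mul_of_nonneg_left h4 h.μ_pos.le
    linarith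

/-- The analysis of one pass through the while-loop near the solution. -/
theorem LocalBounds.exists_loop_bounds (hb : P.LocalBounds x y l₀ l₁ C κ M r) {k : AlgConsts}
    (hk : k.Valid) {ρ r₁ μ₁ : ℝ} (hρ : 0 < ρ) (hr₁ : 0 < r₁) (hr₁r : r₁ ≤ r) (hμ₁ : 0 < μ₁)
    (hqp : ∀ w : PDPoint n₀ n₁ m₀ m₁, ‖w.toProd - (P.primalDual x y l₀ l₁).toProd‖ < r₁ →
        (∀ j, 0 < w.s₁ j) → ∀ μ, 0 < μ → μ ≤ μ₁ → ∀ d l₀' l₁' eta,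
          P.IsQPSolution w μ d l₀' l₁' eta → ‖d‖ ≤ ρ →
          P.linResidual (P.active₀ x) w (P.stepOf w d l₀' l₁' eta)
            = muRes n₀ n₁ m₀ m₁ μ - P.residual (P.active₀ x) w) :
    ∃ D : ℝ, 0 < D ∧ ∃ μbar : ℝ, 0 < μbar ∧ ∀ (w : PDPoint n₀ n₁ m₀ m₁) (μ : ℝ),
      P.LoopInvariant x y l₀ l₁ k r₁ w μ → μ ≤ μbar →
      (∃ w' μ', P.LoopPass k ρ w μ w' μ') ∧
      ‖w.toProd - (P.primalDual x y l₀ l₁).toProd‖ ≤ D * μ ∧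
      ∀ w' μ', P.LoopPass k ρ w μ w' μ' → P.LoopInvariant x y l₀ l₁ k r₁ w' μ' ∧
        ‖w'.toProd - (P.primalDual x y l₀ l₁).toProd‖
          ≤ D * (‖w.toProd - (P.primalDual x y l₀ l₁).toProd‖ + μ ^ (k.cmu₂ - 1))
            * ‖w.toProd - (P.primalDual x y l₀ l₁).toProd‖ := by
  have hC := hb.one_le
  have hC0 : 0 < C := one_pos.trans_le hC
  have hκ := hb.κ_pos
  have hct := hk.ctol_pos
  -- The residual is at most (3 ctol + 1)μ and the barrier term adds μ' ≤ μ, so Dμ bounds both the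
  -- distance to w* and the Newton step.
  set D := C * (3 * k.ctol + 2) with hD
  have hD0 : 0 < D := by positivity
  -- Among these smallness conditions, 2Dμ < r₁ keeps the next iterate in the ball, Dμ < ρ makes the
  -- step admissible, and the last two give the full step and the next loop condition.
  obtain ⟨μbar, hμbar, hsmall⟩ : ∃ μbar : ℝ, 0 < μbar ∧ ∀ μ : ℝ, 0 < μ → μ ≤ μbar →
      1 * μ < 1 / 2 ∧ 1 * μ < μ₁ ∧ 2 * D * μ < r₁ ∧ D * μ < κ / 4 ∧ D * μ < ρ ∧
      D * C * μ < 1 / 2 ∧ 2 * D ^ 2 * μ ^ 2 ≤ k.nextMu μ ∧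
      (6 + m₀ + m₁) * C * D ^ 2 / k.ctol * μ ^ 2 ≤ k.nextMu μ := by
    have h := (eventually_mul_lt 1 (one_half_pos (α := ℝ))).and <|
      (eventually_mul_lt 1 hμ₁).and <| (eventually_mul_lt (2 * D) hr₁).and <|
      (eventually_mul_lt D (by positivity : 0 < κ / 4)).and <| (eventually_mul_lt D hρ).and <|
      (eventually_mul_lt (D * C) (one_half_pos (α := ℝ))).and <|
      (hk.eventually_sq_le_nextMu (2 * D ^ 2)).and
      (hk.eventually_sq_le_nextMu ((6 + m₀ + m₁) * C * D ^ 2 / k.ctol))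
    obtain ⟨b, hb0, hb⟩ := (mem_nhdsGT_iff_exists_Ioc_subset).1 h
    exact ⟨b, hb0, fun μ h1 h2 => hb ⟨h1, h2⟩⟩
  refine ⟨max D (C * (C * (3 * C * C + C) ^ 2) + 2 * C * C), lt_max_of_lt_left hD0, μbar, hμbar,
    ?_⟩
  intro w μ hinv hμle
  have hμ := hinv.μ_pos
  obtain ⟨s1, s2, s3, s4, s5, s6, s7, s8⟩ := hsmall μ hμ hμle
  have hnear := hinv.near.trans_le hr₁r
  have hinv' : P.LoopInvariant x y l₀ l₁ k r w μ := { hinv with near := hnear }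
  have hmuRes := hinv'.mul_norm_muRes_le hb
  set E := ‖w.toProd - (P.primalDual x y l₀ l₁).toProd‖ with hE
  have hE0 : 0 ≤ E := norm_nonneg _
  set μ' := k.nextMu μ with hμ'
  have hμ'0 : 0 < μ' := hk.nextMu_pos hμ
  have hμ'μ : μ' ≤ μ := hk.nextMu_le hμ
  have hC2 := hb.isC2At w hnear
  obtain ⟨hI, hI'⟩ := hb.activity_dominated hnear
  have hres := norm_residual_le_add hC2 hI hI' hμ hinv.loopCond
  have hED : E ≤ D * μ := by
    refine (hb.error_le w hnear).trans ((mul_le_mul_of_nonneg_left hres hC0.le).trans ?_)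
    rw [hD, mul_assoc]
    gcongr
    norm_num
  have hδC : D * μ * C ≤ 1 / 2 := by linarith
  have hδμ : (D * μ) ^ 2 ≤ μ' / 2 := by
    rw [mul_pow]
    linarith
  have hstep_le : ∀ Δ : PDPoint n₀ n₁ m₀ m₁, P.linResidual (P.active₀ x) w Δ
      = muRes n₀ n₁ m₀ m₁ μ' - P.residual (P.active₀ x) w → ‖Δ.toProd‖ ≤ D * μ := fun Δ hΔ => by
    refine (hb.norm_step_le w hnear Δ).trans ?_
    have h1 := norm_muRes_le (n₀ := n₀) (n₁ := n₁) (m₀ := m₀) (m₁ := m₁) μ'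
    rw [abs_of_pos hμ'0] at h1
    have h2 := norm_sub_le (muRes n₀ n₁ m₀ m₁ μ') (P.residual (P.active₀ x) w)
    rw [hΔ, hD, mul_assoc]
    refine mul_le_mul_of_nonneg_left ?_ hC0.le
    linarith
  have hfull : ∀ Δ : PDPoint n₀ n₁ m₀ m₁, P.linResidual (P.active₀ x) w Δ
      = muRes n₀ n₁ m₀ m₁ μ' - P.residual (P.active₀ x) w → ∀ j,
      (μ' * w.s₁ j ≤ w.s₁ j + Δ.s₁ j ∧ μ' * w.lam₁ j ≤ w.lam₁ j + Δ.lam₁ j) ∧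
      μ' / 2 ≤ (w.s₁ j + Δ.s₁ j) * (w.lam₁ j + Δ.lam₁ j) := fun Δ hΔ =>
    hb.full_step hnear hinv.s₁_pos hinv.lam₁_pos hΔ hED (hstep_le Δ hΔ) hμ'0 (by linarith) hδμ hδC
      s4.le
  refine ⟨?_, hED.trans (mul_le_mul_of_nonneg_right (le_max_left _ _) hμ.le), ?_⟩
  -- Existence of a pass: the solvable Newton equation provides a solution of the quadratic program,
  -- taken with α = 1.
  · obtain ⟨Δ, hΔ⟩ := hb.exists_step w hnear
      (muRes n₀ n₁ m₀ m₁ μ' - P.residual (P.active₀ x) w)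
    obtain ⟨h1, h2⟩ := hb.isQPSolution hnear hinv.s₁_pos hinv.lam₁_pos hΔ
      ((hstep_le Δ hΔ).trans s4.le)
    refine ⟨_, μ', rfl, Δ.z, _, _, _, 1, h1, ?_, ?_, rfl⟩
    · exact ((norm_fst_le Δ.toProd).trans (hstep_le Δ hΔ)).trans s5.le
    · rw [h2]
      exact ⟨one_mem_ftbSet hinv.s₁_pos hinv.lam₁_pos fun j => (hfull Δ hΔ j).1,
        fun α hα => hα.2.1⟩
  · rintro w' μ'' ⟨rfl, d, l₀', l₁', eta, α, hsol, hd, hα, rfl⟩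
    have hΔ := hqp w hinv.near hinv.s₁_pos μ' hμ'0 (by linarith) d l₀' l₁' eta hsol hd
    set Δ := P.stepOf w d l₀' l₁' eta with hΔdef
    -- The largest admissible step size cannot exceed one, and one is admissible.
    have hα1 : α = 1 := le_antisymm hα.1.2.1
      (hα.2 (one_mem_ftbSet hinv.s₁_pos hinv.lam₁_pos fun j => (hfull Δ hΔ j).1))
    subst hα1
    have hmove : (w.move 1 Δ).toProd = w.toProd + Δ.toProd := by rw [toProd_move, one_smul]
    have hms : ∀ j, (w.move 1 Δ).s₁ j = w.s₁ j + Δ.s₁ j := fun j => by simp [move]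
    have hml : ∀ j, (w.move 1 Δ).lam₁ j = w.lam₁ j + Δ.lam₁ j := fun j => by simp [move]
    have hΔD := hstep_le Δ hΔ
    have hnear' : ‖(w.move 1 Δ).toProd - (P.primalDual x y l₀ l₁).toProd‖ < r₁ := by
      rw [hmove, add_sub_right_comm]
      refine (norm_add_le _ _).trans_lt ?_
      linarith
    have hnear'' := hnear'.trans_le hr₁r
    -- The full Newton step satisfies F(w) + F'(w)Δ = μ'e, so only the Taylor remainder is left.
    have hquad : ‖P.residual (P.active₀ x) (w.move 1 Δ) - muRes n₀ n₁ m₀ m₁ μ'‖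
        ≤ C * ‖Δ.toProd‖ ^ 2 := by
      have h1 := hb.quadratic w (w.move 1 Δ) Δ hnear hnear'' (by rw [hmove, add_sub_cancel_left])
      rw [hΔ] at h1
      convert h1 using 2
      abel
    refine ⟨⟨hμ'0, hnear', fun j => ?_, fun j => ?_, fun j => ?_, ?_⟩, ?_⟩
    · rw [hms]
      exact (mul_pos hμ'0 (hinv.s₁_pos j)).trans_le (hfull Δ hΔ j).1.1
    · rw [hml]
      exact (mul_pos hμ'0 (hinv.lam₁_pos j)).trans_le (hfull Δ hΔ j).1.2
    · rw [hms, hml]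
      exact (hfull Δ hΔ j).2
    -- The new θ is O(μ²), and the threshold on μ was chosen to put this below ctol μ'.
    · obtain ⟨gI, gI'⟩ := hb.activity_dominated hnear''
      refine ((hb.isC2At _ hnear'').theta_le gI gI' μ').trans ?_
      have h1 : C * ‖Δ.toProd‖ ^ 2 ≤ C * (D * μ) ^ 2 := by gcongr
      have h2 : (6 + m₀ + m₁) * (C * (D * μ) ^ 2)
          = k.ctol * ((6 + m₀ + m₁) * C * D ^ 2 / k.ctol * μ ^ 2) := by
        field_simp
      calc (6 + m₀ + m₁) * ‖P.residual (P.active₀ x) (w.move 1 Δ) - muRes n₀ n₁ m₀ m₁ μ'‖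
          ≤ (6 + m₀ + m₁) * (C * (D * μ) ^ 2) := by
            gcongr
            exact hquad.trans h1
        _ ≤ k.ctol * μ' := by
            rw [h2]
            exact mul_le_mul_of_nonneg_left s8 hct.le
    · set N := ‖muRes n₀ n₁ m₀ m₁ 1‖
      have hN0 : 0 ≤ N := norm_nonneg _
      have hmu' : ‖muRes n₀ n₁ m₀ m₁ μ'‖ = μ' * N := by rw [norm_muRes, abs_of_pos hμ'0]
      -- The barrier perturbation is measured against the distance instead of against μ; the lower
      -- bound on the complementarity products allows this.
      have hμ'N : μ' * N ≤ μ ^ (k.cmu₂ - 1) * (2 * C * E) := by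
        calc μ' * N ≤ μ ^ (k.cmu₂ - 1) * μ * N :=
              mul_le_mul_of_nonneg_right (AlgConsts.Valid.nextMu_le_rpow hμ) hN0
          _ = μ ^ (k.cmu₂ - 1) * (μ * N) := by ring
          _ ≤ _ := mul_le_mul_of_nonneg_left hmuRes (Real.rpow_nonneg hμ.le _)
      have hΔE : ‖Δ.toProd‖ ≤ (3 * C * C + C) * E := by
        have h1 := hb.norm_step_le w hnear Δ
        have h2 := norm_sub_le (muRes n₀ n₁ m₀ m₁ μ') (P.residual (P.active₀ x) w)
        have h3 := hb.residual_le w hnear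
        have h4 : μ' * N ≤ 2 * C * E := (mul_le_mul_of_nonneg_right hμ'μ hN0).trans hmuRes
        rw [hΔ] at h1
        have h5 : ‖muRes n₀ n₁ m₀ m₁ μ' - P.residual (P.active₀ x) w‖ ≤ 3 * C * E := by
          linarith
        have h6 := h1.trans (mul_le_mul_of_nonneg_left h5 hC0.le)
        have h7 : 0 ≤ C * E := by positivity
        linarith
      have hfinal : ‖(w.move 1 Δ).toProd - (P.primalDual x y l₀ l₁).toProd‖
          ≤ C * (C * ((3 * C * C + C) * E) ^ 2 + μ ^ (k.cmu₂ - 1) * (2 * C * E)) := by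
        refine (hb.error_le _ hnear'').trans (mul_le_mul_of_nonneg_left ?_ hC0.le)
        refine (norm_le_norm_sub_add _ (muRes n₀ n₁ m₀ m₁ μ')).trans (add_le_add ?_ ?_)
        · exact hquad.trans (by gcongr)
        · rw [hmu']
          exact hμ'N
      have hp : 0 ≤ μ ^ (k.cmu₂ - 1) := Real.rpow_nonneg hμ.le _
      have hmax := le_max_right D (C * (C * (3 * C * C + C) ^ 2) + 2 * C * C)
      calc _ ≤ C * (C * ((3 * C * C + C) * E) ^ 2 + μ ^ (k.cmu₂ - 1) * (2 * C * E)) := hfinal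
        _ = (C * (C * (3 * C * C + C) ^ 2) * E + 2 * C * C * μ ^ (k.cmu₂ - 1)) * E := by ring
        _ ≤ (C * (C * (3 * C * C + C) ^ 2) + 2 * C * C) * (E + μ ^ (k.cmu₂ - 1)) * E := by
            refine mul_le_mul_of_nonneg_right ?_ hE0
            have q1 : 0 ≤ C * (C * (3 * C * C + C) ^ 2) * μ ^ (k.cmu₂ - 1) := by positivity
            have q2 : 0 ≤ 2 * C * C * E := by positivity
            linarith
        _ ≤ _ := by gcongr

/-! ### Iteration along a run. -/

theorem Transition.mu_pos {k : AlgConsts} (hk : k.Valid) {ρ μ μ' : ℝ} {w w' : PDPoint n₀ n₁ m₀ m₁}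
    (h : P.Transition k ρ w μ w' μ') (hμ : 0 < μ) : 0 < μ' := by
  by_cases hc : P.LoopCond k w μ
  · rw [(h.1 hc).1]
    exact hk.nextMu_pos hμ
  · rwa [(h.2 hc).1]

theorem IsRun.mu_pos_of_le {k : AlgConsts} (hk : k.Valid) {ρ : ℝ} {N : ℕ∞}
    {w : ℕ → PDPoint n₀ n₁ m₀ m₁} {μ : ℕ → ℝ} (h : P.IsRun k ρ N w μ) (t : ℕ) (ht : (t : ℕ∞) ≤ N) :
    0 < μ t := by
  induction t with
  | zero => exact h.mu_pos
  | succ t ih =>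
    have hlt : (t : ℕ∞) < N := lt_of_lt_of_le (by exact_mod_cast t.lt_succ_self) ht
    exact (h.trans t hlt).mu_pos hk (ih hlt.le)

/-- F₁ vanishes, so θ equals θ₀ and the complementarity products equal μ. -/
theorem IsMasterIterate.loopInvariant {k : AlgConsts} {w : PDPoint n₀ n₁ m₀ m₁} {μ : ℝ}
    (h : P.IsMasterIterate k w μ) (hμ : 0 < μ)
    (hw : ‖w.toProd - (P.primalDual x y l₀ l₁).toProd‖ < r) :
    P.LoopInvariant x y l₀ l₁ k r w μ where
  μ_pos := hμ
  near := hw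
  s₁_pos := h.s₁_pos
  lam₁_pos := h.lam₁_pos
  compl j := by
    have := h.sub.compl j
    linarith
  loopCond := by
    have h0 : P.subSq w μ = 0 := by
      simp [subSq, h.sub.y_eq, h.sub.xt_eq, h.sub.con, h.sub.copy, h.sub.compl]
    rw [LoopCond, theta, h0, add_zero]
    exact h.theta₀_le

end TwoStage

end

/-- Finite `N` lets the loop claims reach the last iterate of an initial piece of a run, where the
existence of a further pass is not presupposed. -/
theorem mainTheorem2 {n₀ n₁ m₀ m₁ : ℕ} (P : TwoStage n₀ n₁ m₀ m₁)
    (x : Vec n₀) (y : Vec n₁) (l₀ : Vec m₀) (l₁ : Vec m₁)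
    (hsol : P.IsRegularSolution x y l₀ l₁) :
    ∃ ρ : ℝ, 0 < ρ ∧ ∀ k : AlgConsts, k.Valid →
      ∃ ε : ℝ, 0 < ε ∧ ∃ μbar : ℝ, 0 < μbar ∧
        ∀ (N : ℕ∞) (w : ℕ → PDPoint n₀ n₁ m₀ m₁) (μ : ℕ → ℝ), P.IsRun k ρ N w μ →
          ∀ t₀ : ℕ, (t₀ : ℕ∞) ≤ N → P.IsMasterIterate k (w t₀) (μ t₀) →
            (w t₀).edist (P.primalDual x y l₀ l₁) ≤ ε → μ t₀ ≤ μbar →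
            (∀ t : ℕ, t₀ ≤ t → (t : ℕ∞) ≤ N →
              P.LoopCond k (w t) (μ t) ∧
              ∃ (w' : PDPoint n₀ n₁ m₀ m₁) (μ' : ℝ), P.LoopPass k ρ (w t) (μ t) w' μ') ∧
            (N = ⊤ →
              Tendsto (fun t => (w t).edist (P.primalDual x y l₀ l₁)) atTop (𝓝 0) ∧
              (fun t => (w (t + 1)).edist (P.primalDual x y l₀ l₁)) =o[atTop]
                (fun t => (w t).edist (P.primalDual x y l₀ l₁))) := by
  obtain ⟨C, κ, M, r, hb⟩ := hsol.exists_localBounds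
  obtain ⟨ρ, hρ, r₁, hr₁, hr₁r, μ₁, hμ₁, hqp⟩ := hb.exists_qp_radius
  refine ⟨ρ, hρ, fun k hk => ?_⟩
  obtain ⟨D, hD, μbar, hμbar, hloop⟩ := hb.exists_loop_bounds hk hρ hr₁ hr₁r hμ₁ hqp
  -- Halving the radius turns the non-strict bound on the start into the strict one of the
  -- invariant.
  refine ⟨r₁ / 2, half_pos hr₁, μbar, hμbar, ?_⟩
  intro N w μ hrun t₀ ht₀ hmaster hdist hμ₀
  set ws := P.primalDual x y l₀ l₁ with hws
  have hμpos₀ := hrun.mu_pos_of_le hk t₀ ht₀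
  have hinv : ∀ t : ℕ, t₀ ≤ t → (t : ℕ∞) ≤ N →
      P.LoopInvariant x y l₀ l₁ k r₁ (w t) (μ t) ∧ μ t ≤ μbar := by
    intro t ht
    induction t, ht using Nat.le_induction with
    | base =>
      refine fun _ => ⟨hmaster.loopInvariant hμpos₀ ?_, hμ₀⟩
      exact ((PDPoint.norm_toProd_sub_le_edist _ _).trans hdist).trans_lt (half_lt_self hr₁)
    | succ t ht ih =>
      intro htN
      have hlt : (t : ℕ∞) < N := lt_of_lt_of_le (by exact_mod_cast t.lt_succ_self) htN
      obtain ⟨h1, h2⟩ := ih hlt.le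
      have hpass := (hrun.trans t hlt).1 h1.loopCond
      refine ⟨((hloop _ _ h1 h2).2.2 _ _ hpass).1, ?_⟩
      rw [hpass.1]
      exact (hk.nextMu_le h1.μ_pos).trans h2
  refine ⟨fun t ht htN => ?_, ?_⟩
  · obtain ⟨h1, h2⟩ := hinv t ht htN
    exact ⟨h1.loopCond, (hloop _ _ h1 h2).1⟩
  · rintro rfl
    have hinv' : ∀ t, t₀ ≤ t → P.LoopInvariant x y l₀ l₁ k r₁ (w t) (μ t) ∧ μ t ≤ μbar :=
      fun t ht => hinv t ht le_top
    have hpass : ∀ t, t₀ ≤ t → P.LoopPass k ρ (w t) (μ t) (w (t + 1)) (μ (t + 1)) := fun t ht =>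
      (hrun.trans t (WithTop.coe_lt_top t)).1 (hinv' t ht).1.loopCond
    have hμgeom : ∀ n, μ (n + t₀) ≤ k.cmu₁ ^ n * μ t₀ := by
      intro n
      induction n with
      | zero => simp
      | succ n ih =>
        have h1 := (hpass (n + t₀) (Nat.le_add_left _ _)).1
        rw [show n + 1 + t₀ = n + t₀ + 1 by ring, h1, pow_succ', mul_assoc]
        exact (min_le_left _ _).trans (mul_le_mul_of_nonneg_left ih hk.cmu₁_pos.le)
    have hμ0 : Tendsto μ atTop (𝓝 0) := by
      rw [← tendsto_add_atTop_iff_nat t₀]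
      refine squeeze_zero (fun n => (hinv' _ (Nat.le_add_left _ _)).1.μ_pos.le) hμgeom ?_
      have := (tendsto_pow_atTop_nhds_zero_of_lt_one hk.cmu₁_pos.le hk.cmu₁_lt).mul_const (μ t₀)
      simpa using this
    have hE0 : Tendsto (fun t => ‖(w t).toProd - ws.toProd‖) atTop (𝓝 0) := by
      refine squeeze_zero' (Eventually.of_forall fun t => norm_nonneg _)
        ((eventually_ge_atTop t₀).mono fun t ht => ?_) (by simpa using hμ0.const_mul D)
      obtain ⟨h1, h2⟩ := hinv' t ht
      exact (hloop _ _ h1 h2).2.1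
    -- This is the ratio of successive errors; the factor 3 converts the sup norm back to the
    -- Euclidean distance.
    have hg0 : Tendsto (fun t => 3 * (D * (‖(w t).toProd - ws.toProd‖ + μ t ^ (k.cmu₂ - 1))))
        atTop (𝓝 0) := by
      have h1 : Tendsto (fun t => μ t ^ (k.cmu₂ - 1)) atTop (𝓝 0) := by
        have h2 := hμ0.rpow_const (p := k.cmu₂ - 1) (Or.inr (by linarith [hk.cmu₂_gt]))
        rwa [Real.zero_rpow (by linarith [hk.cmu₂_gt])] at h2
      simpa using ((hE0.add h1).const_mul D).const_mul 3
    refine ⟨?_, ?_⟩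
    · exact squeeze_zero (fun t => PDPoint.edist_nonneg _ _)
        (fun t => PDPoint.edist_le_norm_toProd_sub _ _) (by simpa using hE0.const_mul 3)
    · refine IsLittleO.of_bound fun c hc => ?_
      filter_upwards [eventually_ge_atTop t₀, hg0.eventually (ge_mem_nhds hc)] with t ht hgt
      obtain ⟨h1, h2⟩ := hinv' t ht
      have h3 := ((hloop _ _ h1 h2).2.2 _ _ (hpass t ht)).2
      have h4 := PDPoint.edist_le_norm_toProd_sub (w (t + 1)) ws
      have h5 := PDPoint.norm_toProd_sub_le_edist (w t) ws
      rw [Real.norm_of_nonneg (PDPoint.edist_nonneg _ _),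
        Real.norm_of_nonneg (PDPoint.edist_nonneg _ _)]
      calc (w (t + 1)).edist ws ≤ 3 * ‖(w (t + 1)).toProd - ws.toProd‖ := h4
        _ ≤ 3 * (D * (‖(w t).toProd - ws.toProd‖ + μ t ^ (k.cmu₂ - 1))
            * ‖(w t).toProd - ws.toProd‖) := by gcongr
        _ = 3 * (D * (‖(w t).toProd - ws.toProd‖ + μ t ^ (k.cmu₂ - 1)))
            * ‖(w t).toProd - ws.toProd‖ := by ring
        _ ≤ c * ‖(w t).toProd - ws.toProd‖ := by gcongr
        _ ≤ c * (w t).edist ws := by gcongr
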